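/- **Setting.** Let $\mathbb P_0$ be a probability measure on a space carrying covariates $X\in\mathbb R^d$, a continuous treatment $A$ with values in a measurable set $\mathcal A\subset\mathbb R$, a response $Y$ and potential responses $Y(a)$, $a\in\mathcal A$, where the responses take values in a measurable set $\mathcal Y\subset[0,M]$. Let $f_0(a|x)$ be the conditional density of $A$ given $X=x$, fix a version of the conditional probability $\mathbb P_0(\cdot\,|X=x,A=a)$ that is defined, and concentrated on $\{X=x,A=a\}$, for all $a\in\mathcal A$ and almost every $x$, and let $f_0(y|a,x)$ be the density of $Y$ under it. All conditional statements refer to this version, and "almost every $x$" to the law of $X$. Assume: * (consistency) $Y=Y(a)$ if $A=a$; * (unconfoundedness) $Y(a)$ is independent of $A$ given $X$ for every $a\in\mathcal A$: for almost every $x$ and all $a,a'\in\mathcal A$ the law of $Y(a)$ given $X=x,A=a'$ does not depend on $a'$; * (positivity) there is $\epsilon>0$ with $\inf_{a\in\mathcal A}\operatorname{ess\,inf}_x f_0(a|x)\ge\epsilon$; * (smoothness) $f_0(y|a,x)$ and $f_0(a|x)$ are three times differentiable in $a$ in the interior of $\mathcal A$, and they and these derivatives are bounded uniformly in $(y,a,x)$.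 Let $K\ge 0$ be a bounded measurable symmetric function with $\int K(u)\,du=1$, $\int uK(u)\,du=0$, $\int u^2K(u)\,du<\infty$, and $K_h(x)=h^{-1}K(x/h)$. Let $\pi:\mathbb R^d\to\mathbb R$ be a measurable policy such that for some $r>0$ the interval $(\pi(x)-r,\pi(x)+r)$ is contained in $\mathcal A$ for almost every $x$, and such that for almost every $x$ and almost every $y\in\mathcal Y$, $f_0(y|\pi(x),x)=0$ implies $\partial^2_{aa}f_0(y|\pi(x),x)=0$ (e.g. $f_0(y|\pi(x),x)>0$), so that the quotient in $B_\pi$ below makes sense. Let $\eta>0$. **Target and estimator.** Let $$Q_{\mathrm{DRO}}(\pi)=\inf\{\mathbb E_{\mathbb P}[Y(\pi(X))]:\ \mathrm{KL}(\mathbb P\|\mathbb P_0)\le\eta\},\qquad \phi(\pi,\alpha)=-\alpha\log\mathbb E[e^{-Y(\pi(X))/\alpha}]-\alpha\eta .$$ From i.i.d. copies $(X_i,A_i,Y_i)$ of $(X,A,Y)$ and a bandwidth $h>0$ define $$\hat W_N^h(\pi,\alpha)=\frac{\sum_{i=1}^N\frac{K_h(\pi(X_i)-A_i)}{f_0(A_i|X_i)}e^{-Y_i/\alpha}}{\sum_{i=1}^N\frac{K_h(\pi(X_i)-A_i)}{f_0(A_i|X_i)}},\qquad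 \hat Q^h_{\mathrm{DRO}}(\pi)=\max_{\alpha\ge0}\{-\alpha\log\hat W_N^h(\pi,\alpha)-\alpha\eta\}.$$ At $\alpha=0$ both dual objectives are defined by their limits as $\alpha\downarrow0$, and an undefined ratio with vanishing denominator (an event whose probability tends to $0$) is read as $0$, with $\log 0:=0$. Put $$B_\pi(\alpha)=\frac{\int u^2K(u)du}{2}\,\mathbb E\Big[\mathbb E\Big[e^{-Y/\alpha}\frac{\partial^2_{aa}f_0(Y|\pi(X),X)}{f_0(Y|\pi(X),X)}\Big|A=\pi(X),X\Big]\Big],$$ $$\mathbb V_\pi(\alpha)=\Big(\int K(u)^2du\Big)\Big\{\mathbb E\Big[\mathbb E\Big[\tfrac{e^{-2Y/\alpha}}{f_0(\pi(X)|X)}\Big|A=\pi(X),X\Big]\Big]+\mathbb E\Big[\tfrac1{f_0(\pi(X)|X)}\Big]\big(\mathbb E[e^{-Y(\pi(X))/\alpha}]\big)^2-2\,\mathbb E\Big[\mathbb E\Big[\tfrac{e^{-Y/\alpha}}{f_0(\pi(X)|X)}\Big|A=\pi(X),X\Big]\Big]\mathbb E[e^{-Y(\pi(X))/\alpha}]\Big\}.$$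 **Theorem.** Let $h=h_N>0$ with $h\to0$, $Nh\to\infty$ and $Nh^5\to C\in[0,\infty)$ as $N\to\infty$. Let $\alpha_*\ge 0$ satisfy $\phi(\pi,\alpha_*)\ge\phi(\pi,\alpha)$ for all $\alpha\ge0$. Then $\alpha_*>0$, the variance below is non-negative, and $$\sqrt{Nh}\left(\hat Q^h_{\mathrm{DRO}}(\pi)-Q_{\mathrm{DRO}}(\pi)+\frac{\alpha_*B_\pi(\alpha_*)}{\mathbb E[e^{-Y(\pi(X))/\alpha_*}]}h^2\right)\xrightarrow{d}\mathcal N\left(0,\frac{\alpha_*^2\,\mathbb V_\pi(\alpha_*)}{\big(\mathbb E[e^{-Y(\pi(X))/\alpha_*}]\big)^2}\right).$$ -/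

import Mathlib

open MeasureTheory ProbabilityTheory Filter Topology

noncomputable section

/-- The population: a probability space `(Ω, P₀)` carrying covariates `X ∈ ℝ^d`, a continuous
treatment `A` with values in the treatment space `actions ⊂ ℝ`, the observed response `Y` and the
potential responses `Y(a)`, together with the conditional probability `P₀(· | X = x, A = a)`
and the conditional densities `f₀(a | x)` and `f₀(y | a, x)`.

As conditional laws are evaluated at the null events `{X = x, A = a}` (in particular at
`a = π(x)`), the conditional probability is a fixed version that is proper, i.e. lives on
`{X = x, A = a}`, at every treatment level. -/
structure Population (Ω : Type*) [MeasurableSpace Ω] (d : ℕ) where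
  /-- the underlying probability measure -/
  P₀ : Measure Ω
  isProb : IsProbabilityMeasure P₀
  /-- the treatment space -/
  actions : Set ℝ
  measurableSet_actions : MeasurableSet actions
  /-- the response space -/
  outcomes : Set ℝ
  measurableSet_outcomes : MeasurableSet outcomes
  /-- the covariates -/
  X : Ω → EuclideanSpace ℝ (Fin d)
  measurable_X : Measurable X
  /-- the treatment -/
  A : Ω → ℝ
  measurable_A : Measurable A
  A_mem : ∀ ω, A ω ∈ actions
  /-- the observed response -/
  Y : Ω → ℝ
  measurable_Y : Measurable Y
  /-- the potential responses: `Ypot a` is `Y(a)` -/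
  Ypot : ℝ → Ω → ℝ
  measurable_Ypot : Measurable (fun p : ℝ × Ω => Ypot p.1 p.2)
  Ypot_mem : ∀ a ∈ actions, ∀ ω, Ypot a ω ∈ outcomes
  /-- responses are non-negative and bounded -/
  outcomes_bounded : ∃ M : ℝ, outcomes ⊆ Set.Icc 0 M
  /-- `cond (x, a)` is `P₀(· | X = x, A = a)` -/
  cond : Kernel (EuclideanSpace ℝ (Fin d) × ℝ) Ω
  isMarkov_cond : IsMarkovKernel cond
  /-- the law of total probability -/
  bind_cond : (P₀.map (fun ω => (X ω, A ω))).bind cond = P₀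
  /-- given `X = x, A = a`, one has `X = x` and `A = a` -/
  cond_proper : ∀ᵐ x ∂(P₀.map X), ∀ a ∈ actions, ∀ᵐ ω ∂(cond (x, a)), X ω = x ∧ A ω = a
  /-- `fA a x` is the density `f₀(a | x)` of `A` given `X = x` -/
  fA : ℝ → EuclideanSpace ℝ (Fin d) → ℝ
  measurable_fA : Measurable (fun p : ℝ × EuclideanSpace ℝ (Fin d) => fA p.1 p.2)
  fA_nonneg : ∀ x, ∀ a ∈ actions, 0 ≤ fA a x
  law_XA : P₀.map (fun ω => (X ω, A ω)) =
    ((P₀.map X).prod (volume.restrict actions)).withDensity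
      (fun p => ENNReal.ofReal (fA p.2 p.1))
  /-- `fY y a x` is the density `f₀(y | a, x)` of `Y` given `A = a, X = x` -/
  fY : ℝ → ℝ → EuclideanSpace ℝ (Fin d) → ℝ
  measurable_fY :
    Measurable (fun p : ℝ × ℝ × EuclideanSpace ℝ (Fin d) => fY p.1 p.2.1 p.2.2)
  fY_nonneg : ∀ x, ∀ a ∈ actions, ∀ y ∈ outcomes, 0 ≤ fY y a x
  law_Y : ∀ᵐ x ∂(P₀.map X), ∀ a ∈ actions,
    (cond (x, a)).map Y =
      (volume.restrict outcomes).withDensity (fun y => ENNReal.ofReal (fY y a x))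

namespace Population

variable {Ω : Type*} [MeasurableSpace Ω] {d : ℕ} (D : Population Ω d)

/-! ### Causal and regularity assumptions -/

/-- Consistency: if `A = a`, then `Y = Y(a)`. -/
def Consistency : Prop := ∀ ω a, D.A ω = a → D.Y ω = D.Ypot a ω

/-- Unconfoundedness: for every `a`, the potential response `Y(a)` is independent of `A` given
`X`, i.e. the law of `Y(a)` given `X = x, A = a'` does not depend on `a'`. -/
def Unconfoundedness : Prop :=
  ∀ᵐ x ∂(D.P₀.map D.X), ∀ a ∈ D.actions, ∀ a' ∈ D.actions, ∀ a'' ∈ D.actions,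
    (D.cond (x, a')).map (D.Ypot a) = (D.cond (x, a'')).map (D.Ypot a)

/-- Positivity: `inf_a essinf_x f₀(a | x) ≥ ε > 0`. -/
def Positivity : Prop :=
  ∃ ε : ℝ, 0 < ε ∧ ∀ a ∈ D.actions, ∀ᵐ x ∂(D.P₀.map D.X), ε ≤ D.fA a x

/-- `g` is three times differentiable at every point of the open set `s`, and there it is bounded
by `L` together with its first three derivatives. -/
def _root_.ThreeTimesDiffBounded (g : ℝ → ℝ) (s : Set ℝ) (L : ℝ) : Prop :=
  ∀ a ∈ s, (∀ k < 3, DifferentiableAt ℝ (iteratedDeriv k g) a) ∧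
    ∀ k ≤ 3, |iteratedDeriv k g a| ≤ L

/-- `f₀(y | a, x)` and `f₀(a | x)` are three times differentiable in `a`, and bounded with these
derivatives, uniformly in `(y, a, x)`. -/
def SmoothDensities : Prop :=
  ∃ L : ℝ, ∀ᵐ x ∂(D.P₀.map D.X),
    ThreeTimesDiffBounded (fun a => D.fA a x) (interior D.actions) L ∧
    ∀ y ∈ D.outcomes, ThreeTimesDiffBounded (fun a => D.fY y a x) (interior D.actions) L

/-- The second derivative `∂²_{aa} f₀(y | a, x)`. -/
def fYaa (y a : ℝ) (x : EuclideanSpace ℝ (Fin d)) : ℝ :=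
  iteratedDeriv 2 (fun a' => D.fY y a' x) a

/-- The policy takes values in the interior of the treatment space, at a distance from the
boundary that is bounded below. -/
def InteriorPolicy (π : EuclideanSpace ℝ (Fin d) → ℝ) : Prop :=
  ∃ r : ℝ, 0 < r ∧ ∀ᵐ x ∂(D.P₀.map D.X), Metric.ball (π x) r ⊆ D.actions

/-- The quotient `∂²_{aa} f₀(y | π(x), x) / f₀(y | π(x), x)` makes sense: its numerator vanishes
wherever its denominator does (for instance because the density is positive). -/
def ScoreWellDefined (π : EuclideanSpace ℝ (Fin d) → ℝ) : Prop :=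
  ∀ᵐ x ∂(D.P₀.map D.X), ∀ᵐ y ∂(volume.restrict D.outcomes),
    D.fY y (π x) x = 0 → D.fYaa y (π x) x = 0

end Population

/-! ### Kernels -/

/-- A (non-negative, bounded) second-order kernel function with finite second moment. -/
structure IsSecondOrderKernel (K : ℝ → ℝ) : Prop where
  measurable : Measurable K
  nonneg : ∀ u, 0 ≤ K u
  bounded : ∃ M : ℝ, ∀ u, |K u| ≤ M
  symm : ∀ u, K (-u) = K u
  integral_one : ∫ u, K u = 1
  first_moment : ∫ u, u * K u = 0
  second_moment : Integrable (fun u => u ^ 2 * K u)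

/-- The scaled kernel `K_h(x) = K(x / h) / h`. -/
def scaledKernel (K : ℝ → ℝ) (h x : ℝ) : ℝ := 1 / h * K (x / h)

/-! ### The dual objective -/

/-- `α ↦ -α log W(α) - αη` for `α > 0`, extended to `α = 0` by its limit from the right. -/
def dualObjective (W : ℝ → ℝ) (η α : ℝ) : ℝ :=
  if α = 0 then limUnder (𝓝[>] (0 : ℝ)) (fun β => -β * Real.log (W β) - β * η)
  else -α * Real.log (W α) - α * η

/-- The dual value `sup_{α ≥ 0} {-α log W(α) - αη}`. -/
def dualValue (W : ℝ → ℝ) (η : ℝ) : ℝ := sSup (dualObjective W η '' Set.Ici 0)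

namespace Population

variable {Ω : Type*} [MeasurableSpace Ω] {d : ℕ} (D : Population Ω d)

/-! ### Population quantities -/

/-- The response `Y(π(X))` under the policy `π`. -/
def policyOutcome (π : EuclideanSpace ℝ (Fin d) → ℝ) (ω : Ω) : ℝ := D.Ypot (π (D.X ω)) ω

/-- The distributionally robust value: the infimum of `E_P[Y(π(X))]` over all probability
measures `P` with `KL(P ‖ P₀) ≤ η`. -/
def QDRO (π : EuclideanSpace ℝ (Fin d) → ℝ) (η : ℝ) : ℝ :=
  sInf {v : ℝ | ∃ P : Measure Ω, IsProbabilityMeasure P ∧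
    InformationTheory.klDiv P D.P₀ ≤ ENNReal.ofReal η ∧ v = ∫ ω, D.policyOutcome π ω ∂P}

/-- `E[exp(-Y(π(X)) / α)]`. -/
def W (π : EuclideanSpace ℝ (Fin d) → ℝ) (α : ℝ) : ℝ :=
  ∫ ω, Real.exp (-(D.policyOutcome π ω) / α) ∂D.P₀

/-- `α` maximizes `φ(π, ·)` over `[0, ∞)`, where
`φ(π, α) = -α log E[exp(-Y(π(X)) / α)] - αη`. -/
def IsDualOptimal (π : EuclideanSpace ℝ (Fin d) → ℝ) (η α : ℝ) : Prop :=
  0 ≤ α ∧ ∀ β, 0 ≤ β → dualObjective (D.W π) η β ≤ dualObjective (D.W π) η α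

/-- `E[ E[g(Y, X) | A = π(X), X] ]`. -/
def policyMean (π : EuclideanSpace ℝ (Fin d) → ℝ)
    (g : ℝ → EuclideanSpace ℝ (Fin d) → ℝ) : ℝ :=
  ∫ ω, (∫ ω', g (D.Y ω') (D.X ω) ∂(D.cond (D.X ω, π (D.X ω)))) ∂D.P₀

/-- The bias constant `B_π(α)`. -/
def bias (K : ℝ → ℝ) (π : EuclideanSpace ℝ (Fin d) → ℝ) (α : ℝ) : ℝ :=
  (∫ u, u ^ 2 * K u) / 2 *
    D.policyMean π (fun y x => Real.exp (-y / α) * (D.fYaa y (π x) x / D.fY y (π x) x))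

/-- The variance constant `V_π(α)`. -/
def variance (K : ℝ → ℝ) (π : EuclideanSpace ℝ (Fin d) → ℝ) (α : ℝ) : ℝ :=
  (∫ u, K u ^ 2) *
    (D.policyMean π (fun y x => Real.exp (-(2 * y) / α) / D.fA (π x) x)
      + (∫ ω, 1 / D.fA (π (D.X ω)) (D.X ω) ∂D.P₀) * D.W π α ^ 2
      - 2 * D.policyMean π (fun y x => Real.exp (-y / α) / D.fA (π x) x) * D.W π α)

/-! ### The estimator -/

/-- The weight `K_h(π(x) - a) / f₀(a | x)` of an observation `(x, a, y)`. -/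
def weight (K : ℝ → ℝ) (π : EuclideanSpace ℝ (Fin d) → ℝ) (h : ℝ)
    (z : EuclideanSpace ℝ (Fin d) × ℝ × ℝ) : ℝ :=
  scaledKernel K h (π z.1 - z.2.1) / D.fA z.2.1 z.1

/-- The kernel IPW estimator `W̄_N^h(π, α)` computed from the first `N` points of a sample. -/
def Wbar (K : ℝ → ℝ) (π : EuclideanSpace ℝ (Fin d) → ℝ) (h : ℝ) (N : ℕ)
    (z : ℕ → EuclideanSpace ℝ (Fin d) × ℝ × ℝ) (α : ℝ) : ℝ :=
  1 / (N : ℝ) * ∑ i ∈ Finset.range N, D.weight K π h (z i) * Real.exp (-(z i).2.2 / α)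

/-- The normalization factor `S_N^h`. -/
def normalizer (K : ℝ → ℝ) (π : EuclideanSpace ℝ (Fin d) → ℝ) (h : ℝ) (N : ℕ)
    (z : ℕ → EuclideanSpace ℝ (Fin d) × ℝ × ℝ) : ℝ :=
  1 / (N : ℝ) * ∑ i ∈ Finset.range N, D.weight K π h (z i)

/-- The normalized estimator `Ŵ_N^h(π, α) = W̄_N^h(π, α) / S_N^h`. -/
def What (K : ℝ → ℝ) (π : EuclideanSpace ℝ (Fin d) → ℝ) (h : ℝ) (N : ℕ)
    (z : ℕ → EuclideanSpace ℝ (Fin d) × ℝ × ℝ) (α : ℝ) : ℝ :=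
  D.Wbar K π h N z α / D.normalizer K π h N z

/-- The estimator `Q̂_DRO^h(π) = max_{α ≥ 0} {-α log Ŵ_N^h(π, α) - αη}`. -/
def Qhat (K : ℝ → ℝ) (π : EuclideanSpace ℝ (Fin d) → ℝ) (η h : ℝ) (N : ℕ)
    (z : ℕ → EuclideanSpace ℝ (Fin d) × ℝ × ℝ) : ℝ :=
  dualValue (D.What K π h N z) η

/-- `Z₀, Z₁, …` are i.i.d. copies of the observation `(X, A, Y)`. -/
def IsIIDSample {Ω' : Type*} [MeasurableSpace Ω'] (Pr : Measure Ω')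
    (Z : ℕ → Ω' → EuclideanSpace ℝ (Fin d) × ℝ × ℝ) : Prop :=
  iIndepFun Z Pr ∧ ∀ i, IdentDistrib (Z i) (fun ω => (D.X ω, D.A ω, D.Y ω)) Pr D.P₀

end Population

end

/-!
The dual objective `φ(α) = -α log E[exp(-U / α)] - αη` of a bounded variable `U` is concave on
`(0, ∞)`, with derivative `dualSlope` a function of the two moments `W = E[exp(-U / α)]` and
`E[U exp(-U / α)]`. As `Y(π(X))` has no atoms, the maximum is not attained at `0`
(`pos_of_dualOptimal`), and at the maximizer `αs` the derivative vanishes. Hence the measure tilted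
by `exp(-U / αs)` has Kullback-Leibler divergence exactly `η` from the population and attains
`Q_DRO = φ(αs)` (`sInf_klBall_eq_dualObjective`).

The estimator is the dual value of a weighted empirical measure, so the same concavity applies to
the sample objective `φ̂`. Its derivative at `αs` is of the order `G⁻¹` of the sampling error, where
`G = √(N h)`, and its maximizer is consistent; therefore `Q̂ - φ̂(αs)` is of smaller order than
`G⁻¹` (`Population.tendsto_Qhat_sub_momentValue`). This envelope argument reduces the theorem to the
estimator at the fixed point `αs`. There `φ̂(αs)` is a smooth function of two kernel-weighted means,
and the delta method linearizes it: up to an error negligible against `G⁻¹`, `φ̂(αs) - φ(αs)` is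
`-(αs / W)` times the kernel-weighted mean of `exp(-Y / αs) - W`.

By consistency and unconfoundedness, the moments of `Y(π(X))` are the means over `X` of the
conditional moments of `Y` given `A = π(X)` and `X` (`Population.map_policyOutcome`), which
kernel-weighted means estimate. The Taylor expansion of `a ↦ E[g(Y) | A = a, X = x]` at `π(x)`
gives their bias, `h² (∫ u² K / 2)` times the mean of `∫ ∂²_{aa} f₀(y | π(x), x) g(y) dy` over `X`
(`Population.tendsto_bias`), and positivity their variance, of order `1 / (N h)`
(`Population.tendsto_second_moment`). The summands are bounded by a constant multiple of `1 / h`,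
so that a central limit theorem for triangular arrays with negligible bounds
(`tendstoInDistribution_triangular`) yields the normal limit. The bias is multiplied by `G h² = √(N
h⁵)`, which stays bounded, and cancels the correction term in the limit.
-/

noncomputable section

/-! ### The dual objective of a bounded random variable -/

section Dual

variable {Ω : Type*} [MeasurableSpace Ω]

/-- `E[exp(-U / α)]`. -/
def expMoment (μ : Measure Ω) (U : Ω → ℝ) (α : ℝ) : ℝ := ∫ ω, Real.exp (-(U ω) / α) ∂μ

/-- `E[U exp(-U / α)]`. -/
def tiltMoment (μ : Measure Ω) (U : Ω → ℝ) (α : ℝ) : ℝ := ∫ ω, U ω * Real.exp (-(U ω) / α) ∂μ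

/-- The derivative at `α` of the dual objective `α ↦ -α log W(α) - αη`, in terms of the values
`w = W(α) = E[exp(-U / α)]` and `e = E[U exp(-U / α)]`. -/
def dualSlope (η α w e : ℝ) : ℝ := -Real.log w - e / (α * w) - η

variable {μ : Measure Ω} [IsProbabilityMeasure μ] {U : Ω → ℝ} {M : ℝ}

lemma integrable_exp_neg_div (hU : AEMeasurable U μ) (hM : ∀ᵐ ω ∂μ, U ω ∈ Set.Icc 0 M)
    {α : ℝ} (hα : 0 < α) : Integrable (fun ω => Real.exp (-(U ω) / α)) μ := by
  refine Integrable.of_bound (by fun_prop) 1 ?_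
  filter_upwards [hM] with ω hω
  rw [Real.norm_eq_abs, abs_of_pos (Real.exp_pos _), Real.exp_le_one_iff]
  exact div_nonpos_of_nonpos_of_nonneg (by linarith [hω.1]) hα.le

lemma integrable_mul_exp_neg_div (hU : AEMeasurable U μ) (hM : ∀ᵐ ω ∂μ, U ω ∈ Set.Icc 0 M)
    {α : ℝ} (hα : 0 < α) : Integrable (fun ω => U ω * Real.exp (-(U ω) / α)) μ := by
  refine Integrable.of_bound (by fun_prop) M ?_
  filter_upwards [hM] with ω hω
  rw [norm_mul, Real.norm_eq_abs, Real.norm_eq_abs, abs_of_pos (Real.exp_pos _),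
    abs_of_nonneg hω.1]
  have : Real.exp (-(U ω) / α) ≤ 1 := by
    rw [Real.exp_le_one_iff]
    exact div_nonpos_of_nonpos_of_nonneg (by linarith [hω.1]) hα.le
  nlinarith [hω.1, hω.2, Real.exp_pos (-(U ω) / α)]

lemma expMoment_pos (hU : AEMeasurable U μ) (hM : ∀ᵐ ω ∂μ, U ω ∈ Set.Icc 0 M)
    {α : ℝ} (hα : 0 < α) : 0 < expMoment μ U α :=
  integral_exp_pos (integrable_exp_neg_div hU hM hα)

lemma expMoment_continuousAt (hU : AEMeasurable U μ) (hM : ∀ᵐ ω ∂μ, U ω ∈ Set.Icc 0 M)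
    {α : ℝ} (hα : 0 < α) : ContinuousAt (expMoment μ U) α := by
  have hev : ∀ᶠ β in 𝓝 α, 0 < β := lt_mem_nhds hα
  refine continuousAt_of_dominated (bound := fun _ => 1) ?_ ?_ (integrable_const _) ?_
  · exact Eventually.of_forall fun β => by fun_prop
  · filter_upwards [hev] with β hβ
    filter_upwards [hM] with ω hω
    rw [Real.norm_eq_abs, abs_of_pos (Real.exp_pos _), Real.exp_le_one_iff]
    exact div_nonpos_of_nonpos_of_nonneg (by linarith [hω.1]) hβ.le
  · refine Eventually.of_forall fun ω => ?_
    have : ContinuousAt (fun β : ℝ => -(U ω) / β) α :=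
      continuousAt_const.div continuousAt_id hα.ne'
    exact this.rexp

lemma tiltMoment_continuousAt (hU : AEMeasurable U μ) (hM : ∀ᵐ ω ∂μ, U ω ∈ Set.Icc 0 M)
    {α : ℝ} (hα : 0 < α) : ContinuousAt (tiltMoment μ U) α := by
  have hev : ∀ᶠ β in 𝓝 α, 0 < β := lt_mem_nhds hα
  refine continuousAt_of_dominated (bound := fun _ => M) ?_ ?_ (integrable_const _) ?_
  · exact Eventually.of_forall fun β => by fun_prop
  · filter_upwards [hev] with β hβ
    filter_upwards [hM] with ω hω
    rw [norm_mul, Real.norm_eq_abs, Real.norm_eq_abs, abs_of_pos (Real.exp_pos _),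
      abs_of_nonneg hω.1]
    have : Real.exp (-(U ω) / β) ≤ 1 := by
      rw [Real.exp_le_one_iff]
      exact div_nonpos_of_nonpos_of_nonneg (by linarith [hω.1]) hβ.le
    nlinarith [hω.1, hω.2, Real.exp_pos (-(U ω) / β)]
  · refine Eventually.of_forall fun ω => ?_
    have : ContinuousAt (fun β : ℝ => -(U ω) / β) α :=
      continuousAt_const.div continuousAt_id hα.ne'
    exact continuousAt_const.mul this.rexp

lemma dualSlope_continuousAt (hU : AEMeasurable U μ) (hM : ∀ᵐ ω ∂μ, U ω ∈ Set.Icc 0 M)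
    (η : ℝ) {α : ℝ} (hα : 0 < α) :
    ContinuousAt (fun β => dualSlope η β (expMoment μ U β) (tiltMoment μ U β)) α := by
  have hW := expMoment_continuousAt hU hM hα
  have hE := tiltMoment_continuousAt hU hM hα
  have hW0 := (expMoment_pos hU hM hα).ne'
  unfold dualSlope
  exact ((hW.log hW0).neg.sub (hE.div (continuousAt_id.mul hW) (mul_ne_zero hα.ne' hW0))).sub
    continuousAt_const

lemma dualObjective_of_pos {W : ℝ → ℝ} {η α : ℝ} (hα : 0 < α) :
    dualObjective W η α = -α * Real.log (W α) - α * η := if_neg hα.ne'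

lemma dualObjective_continuousAt (hU : AEMeasurable U μ) (hM : ∀ᵐ ω ∂μ, U ω ∈ Set.Icc 0 M)
    (η : ℝ) {α : ℝ} (hα : 0 < α) : ContinuousAt (dualObjective (expMoment μ U) η) α := by
  have hW := expMoment_continuousAt hU hM hα
  have hW0 := (expMoment_pos hU hM hα).ne'
  have h1 : ContinuousAt (fun β => -β * Real.log (expMoment μ U β) - β * η) α :=
    (continuousAt_id.neg.mul (hW.log hW0)).sub (continuousAt_id.mul continuousAt_const)
  refine h1.congr ?_
  filter_upwards [lt_mem_nhds hα] with β hβ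
  rw [dualObjective_of_pos hβ]

/-- Jensen's inequality for the measure tilted by `exp(-U / α)`, whose mean is `E / W`. -/
lemma le_expMoment (hU : AEMeasurable U μ) (hM : ∀ᵐ ω ∂μ, U ω ∈ Set.Icc 0 M)
    {α β : ℝ} (hα : 0 < α) (hβ : 0 < β) :
    Real.exp ((1 / α - 1 / β) * (tiltMoment μ U α / expMoment μ U α)) * expMoment μ U α
      ≤ expMoment μ U β ∧
    (α ≠ β → (∀ c, ¬ ∀ᵐ ω ∂μ, U ω = c) →
      Real.exp ((1 / α - 1 / β) * (tiltMoment μ U α / expMoment μ U α)) * expMoment μ U α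
        < expMoment μ U β) := by
  set s := 1 / α - 1 / β with hs
  set w := expMoment μ U α with hw
  set e := tiltMoment μ U α with he
  set c := e / w with hc
  have hw0 : 0 < w := expMoment_pos hU hM hα
  have i1 := integrable_exp_neg_div hU hM hα
  have i2 := integrable_mul_exp_neg_div hU hM hα
  have i3 := integrable_exp_neg_div hU hM hβ
  -- the tangent line of `exp` at `s c`, as a function of `s U`
  let f : Ω → ℝ := fun ω => Real.exp (s * c) *
    ((1 - s * c) * Real.exp (-(U ω) / α) + s * (U ω * Real.exp (-(U ω) / α)))
  have hfi : Integrable f μ := ((i1.const_mul _).add (i2.const_mul _)).const_mul _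
  have hf : ∫ ω, f ω ∂μ = Real.exp (s * c) * w := by
    have h1 : ∫ ω, f ω ∂μ = Real.exp (s * c) * ((1 - s * c) * w + s * e) := by
      simp only [f]
      rw [integral_const_mul, integral_add (i1.const_mul _) (i2.const_mul _),
        integral_const_mul, integral_const_mul]
      rfl
    rw [h1]
    have : c * w = e := by rw [hc]; field_simp
    rw [← this]; ring
  have hid : ∀ ω, Real.exp (-(U ω) / β) - f ω = Real.exp (s * c) * Real.exp (-(U ω) / α) *
      (Real.exp (s * (U ω - c)) - (s * (U ω - c) + 1)) := by
    intro ω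
    have : Real.exp (-(U ω) / β) = Real.exp (s * c) * Real.exp (-(U ω) / α) *
        Real.exp (s * (U ω - c)) := by
      rw [← Real.exp_add, ← Real.exp_add]
      congr 1
      rw [hs]; field_simp; ring
    rw [this]; simp only [f]; ring
  have hnn : ∀ ω, 0 ≤ Real.exp (-(U ω) / β) - f ω := by
    intro ω
    rw [hid]
    have := Real.add_one_le_exp (s * (U ω - c))
    exact mul_nonneg (by positivity) (by linarith)
  have hint : ∫ ω, (Real.exp (-(U ω) / β) - f ω) ∂μ =
      expMoment μ U β - Real.exp (s * c) * w := by
    rw [integral_sub i3 hfi, hf]; rfl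
  have h0 : 0 ≤ ∫ ω, (Real.exp (-(U ω) / β) - f ω) ∂μ := integral_nonneg hnn
  refine ⟨by linarith, fun hne hconst => ?_⟩
  have hpos : 0 < ∫ ω, (Real.exp (-(U ω) / β) - f ω) ∂μ := by
    refine lt_of_le_of_ne h0 fun h => hconst c ?_
    have hz := (integral_eq_zero_iff_of_nonneg hnn (i3.sub hfi)).1 h.symm
    filter_upwards [hz] with ω hω
    by_contra hUc
    have hs0 : s ≠ 0 := by
      intro h0
      apply hne
      rw [hs] at h0
      field_simp at h0
      linarith
    have := Real.add_one_lt_exp (mul_ne_zero hs0 (sub_ne_zero.2 hUc))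
    have hω' := hω
    simp only [Pi.zero_apply] at hω'
    rw [hid] at hω'
    have h2 : 0 < Real.exp (s * c) * Real.exp (-(U ω) / α) *
      (Real.exp (s * (U ω - c)) - (s * (U ω - c) + 1)) := mul_pos (by positivity) (by linarith)
    linarith
  linarith

/-- `dualSlope` is a supergradient of the (concave) dual objective. -/
lemma dualObjective_le_affine (hU : AEMeasurable U μ) (hM : ∀ᵐ ω ∂μ, U ω ∈ Set.Icc 0 M)
    (η : ℝ) {α β : ℝ} (hα : 0 < α) (hβ : 0 < β) :
    dualObjective (expMoment μ U) η β ≤ dualObjective (expMoment μ U) η α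
        + dualSlope η α (expMoment μ U α) (tiltMoment μ U α) * (β - α) ∧
    (α ≠ β → (∀ c, ¬ ∀ᵐ ω ∂μ, U ω = c) →
      dualObjective (expMoment μ U) η β < dualObjective (expMoment μ U) η α
        + dualSlope η α (expMoment μ U α) (tiltMoment μ U α) * (β - α)) := by
  rw [dualObjective_of_pos hα, dualObjective_of_pos hβ]
  have hw0 := expMoment_pos hU hM hα
  have key := le_expMoment hU hM hα hβ
  unfold dualSlope
  set w := expMoment μ U α
  set e := tiltMoment μ U α
  set v := expMoment μ U β
  have hid : -α * Real.log w - α * η + (-Real.log w - e / (α * w) - η) * (β - α) =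
      -β * ((1 / α - 1 / β) * (e / w) + Real.log w) - β * η := by
    field_simp; ring
  have hlog : Real.log (Real.exp ((1 / α - 1 / β) * (e / w)) * w) =
      (1 / α - 1 / β) * (e / w) + Real.log w := by
    rw [Real.log_mul (Real.exp_pos _).ne' hw0.ne', Real.log_exp]
  rw [hid, ← hlog]
  constructor
  · have := Real.log_le_log (by positivity) key.1
    nlinarith
  · intro hne hc
    have := Real.log_lt_log (by positivity) (key.2 hne hc)
    nlinarith

lemma dualSlope_strictAnti (hU : AEMeasurable U μ) (hM : ∀ᵐ ω ∂μ, U ω ∈ Set.Icc 0 M)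
    (hc : ∀ c, ¬ ∀ᵐ ω ∂μ, U ω = c) (η : ℝ) {α β : ℝ} (hα : 0 < α) (hαβ : α < β) :
    dualSlope η β (expMoment μ U β) (tiltMoment μ U β)
      < dualSlope η α (expMoment μ U α) (tiltMoment μ U α) := by
  have h1 := (dualObjective_le_affine hU hM η hα (hα.trans hαβ)).2 hαβ.ne hc
  have h2 := (dualObjective_le_affine hU hM η (hα.trans hαβ) hα).1
  nlinarith

/-- At an interior maximizer the derivative of the dual objective vanishes. -/
lemma dualSlope_eq_zero (hU : AEMeasurable U μ) (hM : ∀ᵐ ω ∂μ, U ω ∈ Set.Icc 0 M)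
    (η : ℝ) {α : ℝ} (hα : 0 < α)
    (hmax : ∀ β, 0 ≤ β → dualObjective (expMoment μ U) η β ≤ dualObjective (expMoment μ U) η α) :
    dualSlope η α (expMoment μ U α) (tiltMoment μ U α) = 0 := by
  have hcont := dualSlope_continuousAt hU hM η hα
  -- a nonzero slope keeps its sign near `α`, and a step in its direction improves the objective
  rcases lt_trichotomy (dualSlope η α (expMoment μ U α) (tiltMoment μ U α)) 0 with h | h | h
  · exfalso
    have hev := (hcont.eventually (gt_mem_nhds h)).filter_mono
      (nhdsWithin_le_nhds (s := Set.Iio α))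
    have hev2 : ∀ᶠ β in 𝓝[<] α, 0 < β := (lt_mem_nhds hα).filter_mono nhdsWithin_le_nhds
    obtain ⟨β, ⟨hβ1, hβ2⟩, hβ3⟩ := ((hev.and hev2).and self_mem_nhdsWithin).exists
    have h1 := (dualObjective_le_affine hU hM η hβ2 hα).1
    have h2 := hmax β hβ2.le
    have h3 : β < α := hβ3
    nlinarith
  · exact h
  · exfalso
    have hev := (hcont.eventually (lt_mem_nhds h)).filter_mono
      (nhdsWithin_le_nhds (s := Set.Ioi α))
    obtain ⟨β, hβ1, hβ3⟩ := (hev.and self_mem_nhdsWithin).exists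
    have h3 : α < β := hβ3
    have h1 := (dualObjective_le_affine hU hM η (hα.trans h3) hα).1
    have h2 := hmax β (hα.trans h3).le
    nlinarith

/-- As `α ↓ 0` the dual objective converges to the essential infimum of `U`. -/
lemma exists_tendsto_dualObjective (hU : AEMeasurable U μ) (hM : ∀ᵐ ω ∂μ, U ω ∈ Set.Icc 0 M)
    (η : ℝ) : ∃ m ≤ M, (∀ᵐ ω ∂μ, m ≤ U ω) ∧
      Tendsto (fun β => -β * Real.log (expMoment μ U β) - β * η) (𝓝[>] 0) (𝓝 m) := by
  -- `m` is the essential infimum of `U`; the lower bound on the moment comes from `{U < m + δ}`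
  let S : Set ℝ := {c | ∀ᵐ ω ∂μ, c ≤ U ω}
  have hS0 : (0 : ℝ) ∈ S := by filter_upwards [hM] with ω hω using hω.1
  have hSM : ∀ c ∈ S, c ≤ M := by
    intro c hc
    have hc' : ∀ᵐ ω ∂μ, c ≤ U ω := hc
    obtain ⟨ω, h1, h2⟩ := (hc'.and hM).exists
    exact h1.trans h2.2
  have hbdd : BddAbove S := ⟨M, hSM⟩
  set m := sSup S with hm
  have hmS : ∀ᵐ ω ∂μ, m ≤ U ω := by
    have h1 : ∀ n : ℕ, ∀ᵐ ω ∂μ, m - 1 / ((n : ℝ) + 1) < U ω := by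
      intro n
      have hlt : m - 1 / ((n : ℝ) + 1) < m := sub_lt_self _ Nat.one_div_pos_of_nat
      obtain ⟨c, hc, hcm⟩ := exists_lt_of_lt_csSup ⟨0, hS0⟩ hlt
      filter_upwards [hc] with ω hω using hcm.trans_le hω
    filter_upwards [ae_all_iff.2 h1] with ω hω
    refine le_of_forall_pos_lt_add fun ε hε => ?_
    obtain ⟨n, hn⟩ := exists_nat_one_div_lt hε
    linarith [hω n]
  refine ⟨m, csSup_le ⟨0, hS0⟩ hSM, hmS, ?_⟩
  have key : Tendsto (fun β => -β * Real.log (expMoment μ U β)) (𝓝[>] 0) (𝓝 m) := by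
    rw [tendsto_order]
    constructor
    · intro a ha
      filter_upwards [self_mem_nhdsWithin] with β (hβ : 0 < β)
      have h1 : expMoment μ U β ≤ Real.exp (-m / β) := by
        calc expMoment μ U β ≤ ∫ _, Real.exp (-m / β) ∂μ := by
              refine integral_mono_ae (integrable_exp_neg_div hU hM hβ) (integrable_const _) ?_
              filter_upwards [hmS] with ω hω
              gcongr
          _ = _ := by simp
      have h2 := Real.log_le_log (expMoment_pos hU hM hβ) h1
      rw [Real.log_exp] at h2
      have h3 : β * Real.log (expMoment μ U β) ≤ -m := by
        calc _ ≤ β * (-m / β) := by gcongr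
          _ = -m := by field_simp
      linarith
    · intro a ha
      set δ := (a - m) / 2 with hδ
      have hδ0 : 0 < δ := by rw [hδ]; linarith
      have hp : 0 < μ.real {ω | U ω < m + δ} := by
        rw [measureReal_def, ENNReal.toReal_pos_iff]
        refine ⟨pos_iff_ne_zero.2 fun h0 => ?_, measure_lt_top _ _⟩
        have : m + δ ∈ S := by
          have h1 : ∀ᵐ ω ∂μ, ¬ (U ω < m + δ) := by
            rw [ae_iff]; simpa using h0
          filter_upwards [h1] with ω hω using not_lt.1 hω
        linarith [le_csSup hbdd this]
      set p := μ.real {ω | U ω < m + δ}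
      have hlim : Tendsto (fun β : ℝ => m + δ - β * Real.log p) (𝓝[>] 0)
          (𝓝 (m + δ - 0 * Real.log p)) :=
        (tendsto_const_nhds.sub (tendsto_id.mul_const _)).mono_left nhdsWithin_le_nhds
      have hlt : m + δ - 0 * Real.log p < a := by rw [hδ]; linarith
      filter_upwards [hlim.eventually (gt_mem_nhds hlt), self_mem_nhdsWithin]
        with β hβ2 (hβ : 0 < β)
      have h1 : Real.exp (-(m + δ) / β) * p ≤ expMoment μ U β := by
        have hnull : NullMeasurableSet {ω | U ω < m + δ} μ :=
          nullMeasurableSet_lt hU aemeasurable_const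
        calc Real.exp (-(m + δ) / β) * p
            = ∫ ω, {ω | U ω < m + δ}.indicator (fun _ => Real.exp (-(m + δ) / β)) ω ∂μ := by
              rw [integral_indicator₀ hnull, setIntegral_const, smul_eq_mul, mul_comm]
          _ ≤ _ := by
              refine integral_mono_ae ((integrable_const _).indicator₀ hnull)
                (integrable_exp_neg_div hU hM hβ) (Eventually.of_forall fun ω => ?_)
              by_cases hω : ω ∈ {ω | U ω < m + δ}
              · simp only [Set.indicator_of_mem hω]
                have : U ω ≤ m + δ := le_of_lt hω
                gcongr
              · simp only [Set.indicator_of_notMem hω]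
                positivity
      have h2 := Real.log_le_log (by positivity) h1
      rw [Real.log_mul (Real.exp_pos _).ne' hp.ne', Real.log_exp] at h2
      have h3 : -(m + δ) + β * Real.log p ≤ β * Real.log (expMoment μ U β) := by
        calc -(m + δ) + β * Real.log p = β * (-(m + δ) / β + Real.log p) := by field_simp
          _ ≤ _ := by gcongr
      linarith
  have h2 : Tendsto (fun β : ℝ => β * η) (𝓝[>] 0) (𝓝 (0 * η)) :=
    (tendsto_id.mul_const _).mono_left nhdsWithin_le_nhds
  simpa using key.sub h2

lemma dualObjective_zero {W : ℝ → ℝ} {η m : ℝ}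
    (hm : Tendsto (fun β => -β * Real.log (W β) - β * η) (𝓝[>] 0) (𝓝 m)) :
    dualObjective W η 0 = m := by
  rw [dualObjective, if_pos rfl]
  exact hm.limUnder_eq

/-- When `U` has no atoms, `0` does not maximize the dual objective. -/
lemma pos_of_dualOptimal (hU : AEMeasurable U μ) (hM : ∀ᵐ ω ∂μ, U ω ∈ Set.Icc 0 M)
    (hatom : ∀ c, μ {ω | U ω = c} = 0) {η α : ℝ} (hα : 0 ≤ α)
    (hmax : ∀ β, 0 ≤ β → dualObjective (expMoment μ U) η β ≤ dualObjective (expMoment μ U) η α) :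
    0 < α := by
  refine lt_of_le_of_ne hα fun h0 => ?_
  subst h0
  obtain ⟨m, -, hmU, hlim⟩ := exists_tendsto_dualObjective hU hM η
  -- the objective at `β` is `m + β (-log E[exp(-(U - m) / β)] - η)`, and the logarithm diverges
  have hne : ∀ᵐ ω ∂μ, U ω ≠ m := by rw [ae_iff]; simpa using hatom m
  have hlim2 : Tendsto (fun β => ∫ ω, Real.exp (-(U ω - m) / β) ∂μ) (𝓝[>] 0) (𝓝 0) := by
    have : Tendsto (fun β => ∫ ω, Real.exp (-(U ω - m) / β) ∂μ) (𝓝[>] 0)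
        (𝓝 (∫ _, (0 : ℝ) ∂μ)) := by
      refine tendsto_integral_filter_of_dominated_convergence (fun _ => 1)
        (Eventually.of_forall fun β => by fun_prop) ?_ (integrable_const _) ?_
      · filter_upwards [self_mem_nhdsWithin] with β (hβ : 0 < β)
        filter_upwards [hmU] with ω hω
        rw [Real.norm_eq_abs, abs_of_pos (Real.exp_pos _), Real.exp_le_one_iff]
        exact div_nonpos_of_nonpos_of_nonneg (by linarith) hβ.le
      · filter_upwards [hmU, hne] with ω h1 h2
        have h3 : 0 < U ω - m := sub_pos.2 (lt_of_le_of_ne h1 h2.symm)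
        refine Real.tendsto_exp_atBot.comp ?_
        have : Tendsto (fun β : ℝ => -(U ω - m) * β⁻¹) (𝓝[>] 0) atBot :=
          tendsto_inv_nhdsGT_zero.const_mul_atTop_of_neg (by linarith)
        exact this.congr fun β => (div_eq_mul_inv _ _).symm
    simpa using this
  obtain ⟨β, hβ1, hβ⟩ := ((hlim2.eventually (gt_mem_nhds (Real.exp_pos (-η)))).and
    self_mem_nhdsWithin).exists
  have hβ : 0 < β := hβ
  have h1 : expMoment μ U β = Real.exp (-m / β) * ∫ ω, Real.exp (-(U ω - m) / β) ∂μ := by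
    rw [expMoment, ← integral_const_mul]
    refine integral_congr_ae (Eventually.of_forall fun ω => ?_)
    simp only
    rw [← Real.exp_add]; congr 1; field_simp; ring
  have hpos : 0 < ∫ ω, Real.exp (-(U ω - m) / β) ∂μ := by
    have := expMoment_pos hU hM hβ
    rw [h1] at this
    exact (pos_iff_pos_of_mul_pos this).1 (Real.exp_pos _)
  have h2 := hmax β hβ.le
  rw [dualObjective_zero hlim, dualObjective_of_pos hβ, h1,
    Real.log_mul (Real.exp_pos _).ne' hpos.ne', Real.log_exp] at h2
  have h3 := Real.log_lt_log hpos hβ1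
  rw [Real.log_exp] at h3
  have h4 : -β * (-m / β + Real.log (∫ ω, Real.exp (-(U ω - m) / β) ∂μ)) - β * η
      = m - β * (Real.log (∫ ω, Real.exp (-(U ω - m) / β) ∂μ) + η) := by field_simp; ring
  rw [h4] at h2
  nlinarith

lemma dualObjective_le_bound (hU : AEMeasurable U μ) (hM : ∀ᵐ ω ∂μ, U ω ∈ Set.Icc 0 M)
    {η : ℝ} (hη : 0 ≤ η) {α : ℝ} (hα : 0 ≤ α) : dualObjective (expMoment μ U) η α ≤ M := by
  rcases hα.eq_or_lt with rfl | hα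
  · obtain ⟨m, hm, -, hlim⟩ := exists_tendsto_dualObjective hU hM η
    rw [dualObjective_zero hlim]; exact hm
  · rw [dualObjective_of_pos hα]
    have h1 : Real.exp (-M / α) ≤ expMoment μ U α := by
      calc Real.exp (-M / α) = ∫ _, Real.exp (-M / α) ∂μ := by simp
        _ ≤ _ := by
          refine integral_mono_ae (integrable_const _) (integrable_exp_neg_div hU hM hα) ?_
          filter_upwards [hM] with ω hω
          have := hω.2
          gcongr
    have h2 := Real.log_le_log (Real.exp_pos _) h1
    rw [Real.log_exp] at h2
    have h3 : -M ≤ α * Real.log (expMoment μ U α) := by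
      calc -M = α * (-M / α) := by field_simp
        _ ≤ _ := by gcongr
    nlinarith

lemma bddAbove_dualObjective (hU : AEMeasurable U μ) (hM : ∀ᵐ ω ∂μ, U ω ∈ Set.Icc 0 M)
    {η : ℝ} (hη : 0 ≤ η) : BddAbove (dualObjective (expMoment μ U) η '' Set.Ici 0) := by
  refine ⟨M, ?_⟩
  rintro _ ⟨α, hα, rfl⟩
  exact dualObjective_le_bound hU hM hη hα

lemma le_dualValue (hU : AEMeasurable U μ) (hM : ∀ᵐ ω ∂μ, U ω ∈ Set.Icc 0 M)
    {η : ℝ} (hη : 0 ≤ η) {α : ℝ} (hα : 0 ≤ α) :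
    dualObjective (expMoment μ U) η α ≤ dualValue (expMoment μ U) η :=
  le_csSup (bddAbove_dualObjective hU hM hη) ⟨α, hα, rfl⟩

/-- A bound of the dual objective on a dense set of `(0, ∞)` bounds the dual value. -/
lemma dualValue_le (hU : AEMeasurable U μ) (hM : ∀ᵐ ω ∂μ, U ω ∈ Set.Icc 0 M)
    {η b : ℝ} (hb : ∀ q : ℚ, 0 < q → dualObjective (expMoment μ U) η q ≤ b) :
    dualValue (expMoment μ U) η ≤ b := by
  have hpos : ∀ α, 0 < α → dualObjective (expMoment μ U) η α ≤ b := by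
    intro α hα
    have hcont := dualObjective_continuousAt hU hM η hα
    by_contra! hlt
    have hev := (hcont.eventually (lt_mem_nhds hlt)).and (lt_mem_nhds hα)
    obtain ⟨l, u, ⟨hl, hu⟩, hlu⟩ := mem_nhds_iff_exists_Ioo_subset.1 hev
    obtain ⟨q, hq1, hq2⟩ := exists_rat_btwn (hl.trans hu)
    have h1 := hlu ⟨hq1, hq2⟩
    exact absurd (hb q (by exact_mod_cast h1.2)) (not_le.2 h1.1)
  refine csSup_le ⟨_, ⟨0, Set.mem_Ici.2 le_rfl, rfl⟩⟩ ?_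
  rintro _ ⟨α, hα, rfl⟩
  rcases (Set.mem_Ici.1 hα).eq_or_lt with rfl | hα
  · obtain ⟨m, -, -, hlim⟩ := exists_tendsto_dualObjective hU hM η
    rw [dualObjective_zero hlim]
    refine le_of_tendsto hlim ?_
    filter_upwards [self_mem_nhdsWithin] with β (hβ : 0 < β)
    rw [← dualObjective_of_pos hβ]
    exact hpos β hβ
  · exact hpos α hα

lemma dualValue_eq_iSup (hU : AEMeasurable U μ) (hM : ∀ᵐ ω ∂μ, U ω ∈ Set.Icc 0 M)
    {η : ℝ} (hη : 0 ≤ η) : dualValue (expMoment μ U) η =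
      ⨆ q : {q : ℚ // 0 < q}, dualObjective (expMoment μ U) η ((q : ℚ) : ℝ) := by
  have : Nonempty {q : ℚ // 0 < q} := ⟨⟨1, one_pos⟩⟩
  have hq : ∀ q : {q : ℚ // 0 < q}, (0 : ℝ) ≤ ((q : ℚ) : ℝ) := fun q => by
    exact_mod_cast q.2.le
  refine le_antisymm (dualValue_le hU hM fun q hq0 => ?_) (ciSup_le fun q => ?_)
  · refine le_ciSup (f := fun q : {q : ℚ // 0 < q} =>
      dualObjective (expMoment μ U) η ((q : ℚ) : ℝ)) ⟨M, ?_⟩ ⟨q, hq0⟩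
    rintro _ ⟨q, rfl⟩
    exact dualObjective_le_bound hU hM hη (hq q)
  · exact le_dualValue hU hM hη (hq q)

/-- If the slope changes its sign between `α - δ` and `α + δ`, the dual value exceeds the
objective at `α` by at most `δ` times the slope at `α`. -/
lemma dualValue_le_of_slope (hU : AEMeasurable U μ) (hM : ∀ᵐ ω ∂μ, U ω ∈ Set.Icc 0 M)
    {η α δ : ℝ} (hδ : 0 < δ) (hδα : δ < α)
    (h1 : 0 ≤ dualSlope η (α - δ) (expMoment μ U (α - δ)) (tiltMoment μ U (α - δ)))
    (h2 : dualSlope η (α + δ) (expMoment μ U (α + δ)) (tiltMoment μ U (α + δ)) ≤ 0) :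
    dualValue (expMoment μ U) η ≤ dualObjective (expMoment μ U) η α +
      δ * |dualSlope η α (expMoment μ U α) (tiltMoment μ U α)| := by
  refine dualValue_le hU hM fun q hq => ?_
  have hq : (0 : ℝ) < q := by exact_mod_cast hq
  set s := dualSlope η α (expMoment μ U α) (tiltMoment μ U α)
  have hα : 0 < α := hδ.trans hδα
  have hs1 := le_abs_self s
  have hs2 := neg_abs_le s
  have hnear : ∀ β, 0 < β → |β - α| ≤ δ → dualObjective (expMoment μ U) η β ≤
      dualObjective (expMoment μ U) η α + δ * |s| := by
    intro β hβ hβα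
    have h3 := (dualObjective_le_affine hU hM η hα hβ).1
    have h4 : s * (β - α) ≤ δ * |s| := by
      calc s * (β - α) ≤ |s * (β - α)| := le_abs_self _
        _ = |β - α| * |s| := by rw [abs_mul, mul_comm]
        _ ≤ _ := by gcongr
    linarith
  rcases le_or_gt (q : ℝ) (α - δ) with hc | hc
  · have h3 := (dualObjective_le_affine hU hM η (sub_pos.2 hδα) hq).1
    have h4 := hnear (α - δ) (sub_pos.2 hδα) (by
      rw [sub_sub_cancel_left, abs_neg, abs_of_pos hδ])
    nlinarith
  rcases le_or_gt (α + δ) (q : ℝ) with hc' | hc'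
  · have h3 := (dualObjective_le_affine hU hM η (show 0 < α + δ by linarith) hq).1
    have h4 := hnear (α + δ) (by linarith) (by
      rw [add_sub_cancel_left, abs_of_pos hδ])
    nlinarith
  · exact hnear q hq (abs_le.2 ⟨by linarith, by linarith⟩)

end Dual

/-! ### Stochastic order symbols -/

section StochasticOrder

variable {Ω' : Type*} [MeasurableSpace Ω'] {Pr : Measure Ω'}

/-- The filter on pairs (sample size, sample point) of the events whose probability tends to `1`.
A sequence of random variables converges in probability to a constant iff it converges along
this filter as a function of both arguments. -/
def inProb (Pr : Measure Ω') : Filter (ℕ × Ω') where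
  sets := {S | Tendsto (fun N : ℕ => Pr {ω | (N, ω) ∉ S}) atTop (𝓝 0)}
  univ_sets := by simp
  sets_of_superset := by
    intro S T hS hST
    refine tendsto_of_tendsto_of_tendsto_of_le_of_le tendsto_const_nhds hS (fun _ => zero_le)
      fun N => measure_mono fun ω hω hωS => hω (hST hωS)
  inter_sets := by
    intro S T hS hT
    have h := Tendsto.add hS hT
    rw [add_zero] at h
    refine tendsto_of_tendsto_of_tendsto_of_le_of_le tendsto_const_nhds h (fun _ => zero_le)
      fun N => ?_
    refine (measure_mono fun ω hω => ?_).trans (measure_union_le _ _)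
    by_contra hc
    simp only [Set.mem_union, Set.mem_ofPred_eq, not_or, not_not] at hc
    exact hω hc

lemma eventually_inProb {p : ℕ × Ω' → Prop} :
    (∀ᶠ z in inProb Pr, p z) ↔ Tendsto (fun N : ℕ => Pr {ω | ¬ p (N, ω)}) atTop (𝓝 0) := Iff.rfl

lemma eventually_inProb_of_ae {p : ℕ × Ω' → Prop}
    (h : ∀ᶠ N : ℕ in atTop, ∀ᵐ ω ∂Pr, p (N, ω)) : ∀ᶠ z in inProb Pr, p z := by
  rw [eventually_inProb]
  refine (tendsto_const_nhds (x := 0)).congr' ?_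
  filter_upwards [h] with N hN
  exact (ae_iff.1 hN).symm

lemma tendsto_fst_inProb : Tendsto Prod.fst (inProb Pr) atTop := by
  intro S hS
  refine eventually_inProb_of_ae (p := fun z => z.1 ∈ S) ?_
  filter_upwards [hS] with N hN using Eventually.of_forall fun _ => hN

lemma tendstoInMeasure_of_inProb {X : ℕ → Ω' → ℝ}
    (h : Tendsto (fun z : ℕ × Ω' => X z.1 z.2) (inProb Pr) (𝓝 0)) :
    TendstoInMeasure Pr X atTop 0 := by
  rw [tendstoInMeasure_iff_norm]
  intro ε hε
  have h1 := eventually_inProb.1 (h.eventually (Metric.ball_mem_nhds 0 hε))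
  refine h1.congr fun N => ?_
  congr 1
  ext ω
  simp

/-- The sequence `X` is bounded in probability (tight). -/
def BoundedInProb (Pr : Measure Ω') (X : ℕ × Ω' → ℝ) : Prop :=
  ∀ κ : ENNReal, 0 < κ → ∃ B : ℝ, ∀ᶠ N : ℕ in atTop, Pr {ω | B < |X (N, ω)|} ≤ κ

lemma BoundedInProb.of_isBigO {X Y : ℕ × Ω' → ℝ} (hY : BoundedInProb Pr Y)
    (h : X =O[inProb Pr] Y) : BoundedInProb Pr X := by
  intro κ hκ
  obtain ⟨C, hC0, hC⟩ := h.exists_pos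
  obtain ⟨B, hB⟩ := hY (κ / 2) (ENNReal.half_pos hκ.ne')
  have h1 := eventually_inProb.1 hC.bound
  refine ⟨C * B, ?_⟩
  filter_upwards [hB, h1.eventually (ge_mem_nhds (ENNReal.half_pos hκ.ne'))] with N h2 h3
  calc Pr {ω | C * B < |X (N, ω)|} ≤ Pr ({ω | ¬ ‖X (N, ω)‖ ≤ C * ‖Y (N, ω)‖} ∪
        {ω | B < |Y (N, ω)|}) := by
        refine measure_mono fun ω hω => ?_
        by_contra hc
        simp only [Set.mem_union, Set.mem_ofPred_eq, not_or, not_not, not_lt,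
          Real.norm_eq_abs] at hc hω
        nlinarith
    _ ≤ κ / 2 + κ / 2 := (measure_union_le _ _).trans (add_le_add h3 h2)
    _ = κ := ENNReal.add_halves κ

lemma BoundedInProb.add {X Y : ℕ × Ω' → ℝ} (hX : BoundedInProb Pr X) (hY : BoundedInProb Pr Y) :
    BoundedInProb Pr (fun z => X z + Y z) := by
  intro κ hκ
  obtain ⟨B, hB⟩ := hX (κ / 2) (ENNReal.half_pos hκ.ne')
  obtain ⟨B', hB'⟩ := hY (κ / 2) (ENNReal.half_pos hκ.ne')
  refine ⟨B + B', ?_⟩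
  filter_upwards [hB, hB'] with N h2 h3
  calc Pr {ω | B + B' < |X (N, ω) + Y (N, ω)|} ≤ Pr ({ω | B < |X (N, ω)|} ∪
        {ω | B' < |Y (N, ω)|}) := by
        refine measure_mono fun ω hω => ?_
        by_contra hc
        simp only [Set.mem_union, Set.mem_ofPred_eq, not_or, not_lt] at hc hω
        linarith [abs_add_le (X (N, ω)) (Y (N, ω))]
    _ ≤ κ / 2 + κ / 2 := (measure_union_le _ _).trans (add_le_add h2 h3)
    _ = κ := ENNReal.add_halves κ

/-- `O_p(1) o_p(1) = o_p(1)`. -/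
lemma BoundedInProb.mul_tendsto_zero {X Y : ℕ × Ω' → ℝ} (hX : BoundedInProb Pr X)
    (hY : Tendsto Y (inProb Pr) (𝓝 0)) : Tendsto (fun z => X z * Y z) (inProb Pr) (𝓝 0) := by
  rw [Metric.tendsto_nhds]
  intro ε hε
  rw [eventually_inProb, ENNReal.tendsto_nhds_zero]
  intro κ hκ
  obtain ⟨B, hB⟩ := hX (κ / 2) (ENNReal.half_pos hκ.ne')
  have hpos : 0 < ε / (|B| + 1) := by positivity
  have h1 := eventually_inProb.1 (hY.eventually (Metric.ball_mem_nhds 0 hpos))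
  filter_upwards [hB, h1.eventually (ge_mem_nhds (ENNReal.half_pos hκ.ne'))] with N h2 h3
  refine (measure_mono (fun ω hω => ?_)).trans (((measure_union_le _ _).trans
    (add_le_add h2 h3)).trans (ENNReal.add_halves κ).le)
  by_contra hc
  simp only [Set.mem_union, Set.mem_ofPred_eq, not_or, not_lt, dist_zero_right,
    Real.norm_eq_abs, norm_mul] at hc hω
  have h4 : |X (N, ω)| * |Y (N, ω)| < ε := by
    calc |X (N, ω)| * |Y (N, ω)| ≤ (|B| + 1) * |Y (N, ω)| := by
          gcongr; linarith [hc.1, le_abs_self B]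
      _ < (|B| + 1) * (ε / (|B| + 1)) := by gcongr; exact not_le.1 hc.2
      _ = ε := by field_simp
  linarith

/-- Chebyshev's inequality: bounded second moments give boundedness in probability. -/
lemma BoundedInProb.of_integral_sq [IsFiniteMeasure Pr] {X : ℕ × Ω' → ℝ} {C : ℝ}
    (hint : ∀ᶠ N : ℕ in atTop, Integrable (fun ω => X (N, ω) ^ 2) Pr)
    (hC : ∀ᶠ N : ℕ in atTop, ∫ ω, X (N, ω) ^ 2 ∂Pr ≤ C) : BoundedInProb Pr X := by
  intro κ hκ
  have hlim : Tendsto (fun B : ℝ => ENNReal.ofReal (C / B ^ 2)) atTop (𝓝 0) := by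
    rw [← ENNReal.ofReal_zero]
    refine (ENNReal.continuous_ofReal.tendsto 0).comp ?_
    exact Tendsto.const_div_atTop (tendsto_pow_atTop two_ne_zero) C
  obtain ⟨B, hB, hB0⟩ := ((hlim.eventually (ge_mem_nhds hκ)).and (eventually_gt_atTop 0)).exists
  refine ⟨B, ?_⟩
  filter_upwards [hint, hC] with N h1 h2
  refine le_trans ?_ hB
  have h3 := mul_meas_ge_le_integral_of_nonneg
    (Eventually.of_forall fun ω => sq_nonneg (X (N, ω))) h1 (B ^ 2)
  have h4 : Pr.real {ω | B ^ 2 ≤ X (N, ω) ^ 2} ≤ C / B ^ 2 := by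
    rw [le_div_iff₀ (by positivity)]; linarith
  calc Pr {ω | B < |X (N, ω)|} ≤ Pr {ω | B ^ 2 ≤ X (N, ω) ^ 2} := by
        refine measure_mono fun ω hω => ?_
        simp only [Set.mem_ofPred_eq] at hω ⊢
        rw [← sq_abs (X (N, ω))]
        gcongr
    _ = ENNReal.ofReal (Pr.real {ω | B ^ 2 ≤ X (N, ω) ^ 2}) := by
        rw [ofReal_measureReal]
    _ ≤ _ := ENNReal.ofReal_le_ofReal h4

lemma BoundedInProb.of_bounded {X : ℕ × Ω' → ℝ} {x : ℕ → ℝ} (hX : ∀ z, X z = x z.1) {C : ℝ}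
    (hC : ∀ᶠ N in atTop, |x N| ≤ C) : BoundedInProb Pr X := by
  intro κ _
  refine ⟨C, ?_⟩
  filter_upwards [hC] with N hN
  have : {ω : Ω' | C < |X (N, ω)|} = ∅ := by
    ext ω
    simp [hX, hN]
  simp [this]

variable {E : Type*} [NormedAddCommGroup E]

lemma tendsto_of_boundedInProb {G : ℕ → ℝ} (hG : Tendsto G atTop atTop) {X : ℕ × Ω' → E} {x₀ : E}
    (h : BoundedInProb Pr (fun z => G z.1 * ‖X z - x₀‖)) : Tendsto X (inProb Pr) (𝓝 x₀) := by
  rw [tendsto_iff_norm_sub_tendsto_zero]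
  have hinv : Tendsto (fun z : ℕ × Ω' => (G z.1)⁻¹) (inProb Pr) (𝓝 0) :=
    (tendsto_inv_atTop_zero.comp hG).comp tendsto_fst_inProb
  refine (h.mul_tendsto_zero hinv).congr' ?_
  filter_upwards [tendsto_fst_inProb.eventually (hG.eventually_gt_atTop 0)] with z hz
  field_simp

variable [NormedSpace ℝ E]

/-- The delta method: a linearization error is negligible at the rate of convergence. -/
lemma delta_method {G : ℕ → ℝ} (hG : Tendsto G atTop atTop) {X : ℕ × Ω' → E} {x₀ : E}
    (h : BoundedInProb Pr (fun z => G z.1 * ‖X z - x₀‖)) {f : E → ℝ} {L : E →L[ℝ] ℝ}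
    (hf : HasFDerivAt f L x₀) :
    Tendsto (fun z => G z.1 * (f (X z) - f x₀ - L (X z - x₀))) (inProb Pr) (𝓝 0) := by
  have hX := tendsto_of_boundedInProb hG h
  have ho := hf.isLittleO.comp_tendsto hX
  have hr : Tendsto (fun z => (f (X z) - f x₀ - L (X z - x₀)) / ‖X z - x₀‖) (inProb Pr) (𝓝 0) := by
    have := ho.norm_right.tendsto_div_nhds_zero
    simpa [Function.comp_def] using this
  refine (h.mul_tendsto_zero hr).congr fun z => ?_
  by_cases hz : ‖X z - x₀‖ = 0
  · have : X z = x₀ := sub_eq_zero.1 (norm_eq_zero.1 hz)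
    simp [this]
  · field_simp

lemma BoundedInProb.comp_hasFDerivAt {G : ℕ → ℝ} (hG : Tendsto G atTop atTop) {X : ℕ × Ω' → E}
    {x₀ : E} (h : BoundedInProb Pr (fun z => G z.1 * ‖X z - x₀‖)) {f : E → ℝ}
    (hf : DifferentiableAt ℝ f x₀) :
    BoundedInProb Pr (fun z => G z.1 * (f (X z) - f x₀)) := by
  have hX := tendsto_of_boundedInProb hG h
  refine h.of_isBigO ?_
  refine (Asymptotics.isBigO_refl _ _).mul ?_
  exact (hf.isBigO_sub.comp_tendsto hX).norm_right

end StochasticOrder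

/-! ### A central limit theorem for bounded triangular arrays -/

section TriangularArray

variable {Ω' : Type*} [MeasurableSpace Ω'] {Pr : Measure Ω'} [IsProbabilityMeasure Pr]

/-- Second-order expansion of the characteristic function of a bounded centered variable. -/
lemma norm_charFun_sub_le {X : Ω' → ℝ} (hX : AEMeasurable X Pr) {c : ℝ}
    (hb : ∀ᵐ ω ∂Pr, |X ω| ≤ c) (h0 : ∫ ω, X ω ∂Pr = 0) {s : ℝ} (hs : |s| * c ≤ 1) :
    ‖charFun (Pr.map X) s - (1 - ((s ^ 2 / 2 * ∫ ω, X ω ^ 2 ∂Pr : ℝ) : ℂ))‖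
      ≤ |s| ^ 3 * c * ∫ ω, X ω ^ 2 ∂Pr := by
  have iX : Integrable X Pr := Integrable.of_bound hX.aestronglyMeasurable c hb
  have iX2 : Integrable (fun ω => X ω ^ 2) Pr := by
    refine Integrable.of_bound (by fun_prop) (c ^ 2) ?_
    filter_upwards [hb] with ω hω
    rw [norm_pow, Real.norm_eq_abs]
    gcongr
  have iE : Integrable (fun ω => Complex.exp (s * X ω * Complex.I)) Pr := by
    refine Integrable.of_bound (by fun_prop) 1 (Eventually.of_forall fun ω => ?_)
    rw [← Complex.ofReal_mul, Complex.norm_exp_ofReal_mul_I]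
  -- the second-order Taylor polynomial of the integrand
  let q : Ω' → ℂ := fun ω => 1 + (s * X ω) * Complex.I + ((-(s ^ 2 / 2) * X ω ^ 2 : ℝ) : ℂ)
  have i1 : Integrable (fun ω => ((s * X ω : ℝ) : ℂ) * Complex.I) Pr :=
    ((iX.const_mul s).ofReal (𝕜 := ℂ)).mul_const _
  have i2 : Integrable (fun ω => ((-(s ^ 2 / 2) * X ω ^ 2 : ℝ) : ℂ)) Pr :=
    (iX2.const_mul _).ofReal
  have hqeq : q = fun ω => (1 : ℂ) + ((s * X ω : ℝ) : ℂ) * Complex.I +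
      ((-(s ^ 2 / 2) * X ω ^ 2 : ℝ) : ℂ) := by
    funext ω; simp [q]
  have i3 : Integrable (fun ω => (1 : ℂ) + ((s * X ω : ℝ) : ℂ) * Complex.I) Pr :=
    (integrable_const _).add i1
  have iq : Integrable q Pr := by
    rw [hqeq]; exact i3.add i2
  have hq : ∫ ω, q ω ∂Pr = 1 - ((s ^ 2 / 2 * ∫ ω, X ω ^ 2 ∂Pr : ℝ) : ℂ) := by
    rw [hqeq, integral_add i3 i2, integral_add (integrable_const _) i1, integral_mul_const,
      integral_complex_ofReal, integral_complex_ofReal, integral_const_mul, integral_const_mul, h0]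
    simp [sub_eq_add_neg]
  rw [charFun_apply_real, integral_map hX (by fun_prop), ← hq, ← integral_sub iE iq,
    ← integral_const_mul]
  refine norm_integral_le_of_norm_le (iX2.const_mul _) ?_
  filter_upwards [hb] with ω hω
  have hx : ‖(s * X ω * Complex.I : ℂ)‖ = |s| * |X ω| := by simp
  have hx1 : ‖(s * X ω * Complex.I : ℂ)‖ ≤ 1 := by
    rw [hx]
    exact (mul_le_mul_of_nonneg_left hω (abs_nonneg s)).trans hs
  have hexp := Complex.exp_bound hx1 (n := 3) (by norm_num)
  have hsum : ∑ m ∈ Finset.range 3, (s * X ω * Complex.I : ℂ) ^ m / (m.factorial : ℂ) = q ω := by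
    simp only [Finset.sum_range_succ, Finset.sum_range_zero, q, Nat.factorial]
    push_cast
    linear_combination (s * X ω : ℂ) ^ 2 / 2 * Complex.I_sq
  rw [hsum, hx] at hexp
  refine hexp.trans ?_
  calc (|s| * |X ω|) ^ 3 * (((Nat.succ 3 : ℕ) : ℝ) * ((Nat.factorial 3 : ℕ) * (3 : ℕ) : ℝ)⁻¹)
      ≤ (|s| * |X ω|) ^ 3 * 1 := by
        gcongr
        norm_num [Nat.factorial]
    _ = |s| ^ 3 * |X ω| * X ω ^ 2 := by rw [← sq_abs (X ω)]; ring
    _ ≤ |s| ^ 3 * c * X ω ^ 2 := by gcongr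

/-- **Central limit theorem** for a triangular array of bounded functions of an i.i.d. sequence,
whose bounds are `o(√N)`. -/
theorem tendstoInDistribution_triangular {E : Type*} [MeasurableSpace E] {Z : ℕ → Ω' → E}
    (hind : iIndepFun Z Pr) (hident : ∀ i, IdentDistrib (Z i) (Z 0) Pr Pr)
    {f : ℕ → E → ℝ} (hf : ∀ N, Measurable (f N)) {c : ℕ → ℝ}
    (hc : ∀ N, ∀ᵐ ω ∂Pr, |f N (Z 0 ω)| ≤ c N)
    (hcN : Tendsto (fun N : ℕ => (Real.sqrt N)⁻¹ * c N) atTop (𝓝 0))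
    (hmean : ∀ N, ∫ ω, f N (Z 0 ω) ∂Pr = 0) {v : ℝ} (hv : 0 ≤ v)
    (hvar : Tendsto (fun N => ∫ ω, f N (Z 0 ω) ^ 2 ∂Pr) atTop (𝓝 v)) :
    TendstoInDistribution
      (fun (N : ℕ) ω => (Real.sqrt N)⁻¹ * ∑ i ∈ Finset.range N, f N (Z i ω)) atTop
      (fun x : ℝ => x) (fun _ => Pr) (gaussianReal 0 v.toNNReal) where
  forall_aemeasurable N := .const_mul (Finset.aemeasurable_fun_sum _ fun i _ =>
    (hf N).comp_aemeasurable (hident i).aemeasurable_fst) _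
  tendsto := by
    refine ProbabilityMeasure.tendsto_iff_tendsto_charFun.2 fun t => ?_
    have hlaw : charFun ((gaussianReal 0 v.toNNReal).map (fun x : ℝ => x)) t =
        Complex.exp ((-(t ^ 2 / 2 * v) : ℝ) : ℂ) := by
      rw [show (fun x : ℝ => x) = id from rfl, Measure.map_id, charFun_gaussianReal]
      congr 1
      rw [Real.coe_toNNReal v hv]
      push_cast; ring
    have hrow : ∀ N : ℕ, charFun (Pr.map fun ω =>
        (Real.sqrt N)⁻¹ * ∑ i ∈ Finset.range N, f N (Z i ω)) t =
        charFun (Pr.map fun ω => f N (Z 0 ω)) ((Real.sqrt N)⁻¹ * t) ^ N := fun N =>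
      charFun_inv_sqrt_mul_sum (X := fun i ω => f N (Z i ω))
        (hind.comp (fun _ => f N) fun _ => hf N) fun i => (hident i).comp (hf N)
    simp only [ProbabilityMeasure.coe_mk]
    rw [hlaw]
    simp_rw [hrow]
    have key : Tendsto (fun N : ℕ => (N : ℂ) *
        (charFun (Pr.map fun ω => f N (Z 0 ω)) ((Real.sqrt N)⁻¹ * t) - 1)) atTop
        (𝓝 ((-(t ^ 2 / 2 * v) : ℝ) : ℂ)) := by
      have hmain : Tendsto (fun N : ℕ => ((-(t ^ 2 / 2 * ∫ ω, f N (Z 0 ω) ^ 2 ∂Pr) : ℝ) : ℂ)) atTop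
          (𝓝 ((-(t ^ 2 / 2 * v) : ℝ) : ℂ)) :=
        (Complex.continuous_ofReal.tendsto _).comp (hvar.const_mul _).neg
      have herr : Tendsto (fun N : ℕ => |t| ^ 3 * ((Real.sqrt N)⁻¹ * c N) *
          ∫ ω, f N (Z 0 ω) ^ 2 ∂Pr) atTop (𝓝 0) := by
        have := (hcN.const_mul (|t| ^ 3)).mul hvar
        simpa using this
      have hsmall : ∀ᶠ N : ℕ in atTop, |t| * ((Real.sqrt N)⁻¹ * c N) ≤ 1 := by
        have := hcN.const_mul |t|
        rw [mul_zero] at this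
        exact this.eventually (ge_mem_nhds one_pos)
      refine (tendsto_iff_of_dist ?_).1 hmain
      refine squeeze_zero' (Eventually.of_forall fun _ => dist_nonneg) ?_ herr
      filter_upwards [hsmall, eventually_gt_atTop 0] with N hN hN0
      have hN0' : (0 : ℝ) < N := by exact_mod_cast hN0
      have hsq : (0 : ℝ) < Real.sqrt N := Real.sqrt_pos.2 hN0'
      have hsq2 : Real.sqrt N ^ 2 = N := Real.sq_sqrt hN0'.le
      have habs : |(Real.sqrt N)⁻¹ * t| = (Real.sqrt N)⁻¹ * |t| := by
        rw [abs_mul, abs_of_pos (inv_pos.2 hsq)]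
      have h1 := norm_charFun_sub_le ((hf N).comp_aemeasurable (hident 0).aemeasurable_fst)
        (hc N) (hmean N) (s := (Real.sqrt N)⁻¹ * t) (by rw [habs]; linarith)
      simp only [Function.comp_def] at h1
      set I := ∫ ω, f N (Z 0 ω) ^ 2 ∂Pr
      set φ := charFun (Pr.map fun ω => f N (Z 0 ω)) ((Real.sqrt N)⁻¹ * t)
      have hNc : (N : ℂ) = ((Real.sqrt N ^ 2 : ℝ) : ℂ) := by rw [hsq2]; simp
      have h2 : ((-(t ^ 2 / 2 * I) : ℝ) : ℂ) - (N : ℂ) * (φ - 1) =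
          -((N : ℂ) * (φ - (1 - ((((Real.sqrt N)⁻¹ * t) ^ 2 / 2 * I : ℝ) : ℂ)))) := by
        have h3 : (N : ℂ) * ((((Real.sqrt N)⁻¹ * t) ^ 2 / 2 * I : ℝ) : ℂ) =
            ((t ^ 2 / 2 * I : ℝ) : ℂ) := by
          rw [hNc, ← Complex.ofReal_mul]
          congr 1
          field_simp
        rw [Complex.ofReal_neg, ← h3]; ring
      rw [dist_eq_norm, h2, norm_neg, norm_mul, Complex.norm_natCast]
      calc (N : ℝ) * _ ≤ N * (|(Real.sqrt N)⁻¹ * t| ^ 3 * c N * I) := by gcongr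
        _ = Real.sqrt N ^ 2 * (|(Real.sqrt N)⁻¹ * t| ^ 3 * c N * I) := by rw [hsq2]
        _ = _ := by rw [habs]; field_simp
    refine (Complex.tendsto_one_add_pow_exp_of_tendsto key).congr fun N => ?_
    congr 1; ring

end TriangularArray

/-! ### Duality for Kullback-Leibler balls -/

section KLDuality

variable {Ω : Type*} [MeasurableSpace Ω] {μ : Measure Ω} [IsProbabilityMeasure μ]
  {U : Ω → ℝ} {M : ℝ}

/-- Weak duality, i.e. the Gibbs variational inequality. -/
lemma dualObjective_le_integral (hU : AEMeasurable U μ) (hM : ∀ᵐ ω ∂μ, U ω ∈ Set.Icc 0 M)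
    {η α : ℝ} (hη : 0 ≤ η) (hα : 0 < α) {P : Measure Ω} [IsProbabilityMeasure P]
    (hP : InformationTheory.klDiv P μ ≤ ENNReal.ofReal η) :
    dualObjective (expMoment μ U) η α ≤ ∫ ω, U ω ∂P := by
  obtain ⟨hac, hint⟩ := InformationTheory.klDiv_ne_top_iff.1
    (ne_top_of_le_ne_top ENNReal.ofReal_ne_top hP)
  have hkl : ∫ ω, llr P μ ω ∂P ≤ η := by
    rw [← InformationTheory.toReal_klDiv_of_measure_eq hac (by simp)]
    exact ENNReal.toReal_le_of_le_ofReal hη hP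
  have iU : Integrable U P := by
    refine Integrable.of_bound (hU.mono_ac hac).aestronglyMeasurable M ?_
    filter_upwards [hac hM] with ω hω
    rw [Real.norm_eq_abs, abs_of_nonneg hω.1]; exact hω.2
  have if' : Integrable (fun ω => -(U ω) / α) P := iU.neg.div_const α
  have iexp := integrable_exp_neg_div hU hM hα
  have h1 := integral_llr_tilted_right hac if' iexp hint
  have : IsProbabilityMeasure (μ.tilted fun ω => -(U ω) / α) := isProbabilityMeasure_tilted iexp
  have h2 : 0 ≤ ∫ ω, llr P (μ.tilted fun ω => -(U ω) / α) ω ∂P := by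
    rw [← InformationTheory.toReal_klDiv_of_measure_eq
      (hac.trans (absolutelyContinuous_tilted iexp)) (by simp)]
    exact ENNReal.toReal_nonneg
  have h3 : ∫ ω, -(U ω) / α ∂P = -(∫ ω, U ω ∂P) / α := by
    rw [integral_div, integral_neg]
  rw [h1, h3] at h2
  rw [dualObjective_of_pos hα]
  change 0 ≤ _ - _ + Real.log (expMoment μ U α) at h2
  set x := ∫ ω, U ω ∂P
  have h4 : 0 ≤ α * (η - -x / α + Real.log (expMoment μ U α)) :=
    mul_nonneg hα.le (by linarith)
  have h5 : α * (η - -x / α + Real.log (expMoment μ U α)) =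
      x - (-α * Real.log (expMoment μ U α) - α * η) := by field_simp; ring
  linarith

/-- Strong duality: where the slope of the dual objective vanishes, the measure tilted by
`exp(-U / α)` has divergence exactly `η`, and its mean equals the dual objective. -/
theorem sInf_klBall_eq_dualObjective (hU : AEMeasurable U μ)
    (hM : ∀ᵐ ω ∂μ, U ω ∈ Set.Icc 0 M) {η α : ℝ} (hη : 0 ≤ η) (hα : 0 < α)
    (hslope : dualSlope η α (expMoment μ U α) (tiltMoment μ U α) = 0) :
    sInf {v : ℝ | ∃ P : Measure Ω, IsProbabilityMeasure P ∧
      InformationTheory.klDiv P μ ≤ ENNReal.ofReal η ∧ v = ∫ ω, U ω ∂P} =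
      dualObjective (expMoment μ U) η α := by
  refine IsLeast.csInf_eq ⟨?_, ?_⟩
  · have iexp := integrable_exp_neg_div hU hM hα
    have hW := expMoment_pos hU hM hα
    set Q := μ.tilted fun ω => -(U ω) / α with hQ
    have hQp : IsProbabilityMeasure Q := isProbabilityMeasure_tilted iexp
    have hac : Q ≪ μ := tilted_absolutelyContinuous μ _
    have iU : Integrable U Q := by
      refine Integrable.of_bound (hU.mono_ac hac).aestronglyMeasurable M ?_
      filter_upwards [hac hM] with ω hω
      rw [Real.norm_eq_abs, abs_of_nonneg hω.1]; exact hω.2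
    have hmean : ∫ ω, U ω ∂Q = tiltMoment μ U α / expMoment μ U α := by
      rw [hQ, integral_tilted]
      unfold tiltMoment expMoment
      rw [← integral_div]
      refine integral_congr_ae (Eventually.of_forall fun ω => ?_)
      simp only [smul_eq_mul]; ring
    have hllr : llr Q μ =ᵐ[Q] fun ω => -(U ω) / α - Real.log (expMoment μ U α) :=
      hac (log_rnDeriv_tilted_left_self iexp)
    have iu' : Integrable (fun ω => -(U ω) / α) Q := iU.neg.div_const α
    have hkl : ∫ ω, llr Q μ ω ∂Q = η := by
      rw [integral_congr_ae hllr, integral_sub iu' (integrable_const _), integral_div,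
        integral_neg, hmean]
      simp only [integral_const, probReal_univ, smul_eq_mul, one_mul]
      unfold dualSlope at hslope
      have : tiltMoment μ U α / (α * expMoment μ U α) =
        tiltMoment μ U α / expMoment μ U α / α := by field_simp
      rw [this] at hslope
      rw [neg_div]; linarith
    refine ⟨Q, hQp, ?_, ?_⟩
    · rw [InformationTheory.klDiv_of_ac_of_integrable hac
        ((integrable_congr hllr).2 (iu'.sub (integrable_const _))), hkl]
      simp
    · rw [hmean, dualObjective_of_pos hα]
      unfold dualSlope at hslope
      have h1 : Real.log (expMoment μ U α) + η = -(tiltMoment μ U α / (α * expMoment μ U α)) := by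
        linarith
      have h2 : -α * Real.log (expMoment μ U α) - α * η =
          -α * (Real.log (expMoment μ U α) + η) := by ring
      rw [h2, h1]; field_simp
  · rintro _ ⟨P, hPp, hP, rfl⟩
    exact dualObjective_le_integral hU hM hη hα hP

end KLDuality

/-! ### Disintegration of the population laws -/

namespace Population

variable {Ω : Type*} [MeasurableSpace Ω] {d : ℕ} (D : Population Ω d)

attribute [instance] Population.isProb Population.isMarkov_cond

instance isProbabilityMeasure_map_X : IsProbabilityMeasure (D.P₀.map D.X) :=
  Measure.isProbabilityMeasure_map D.measurable_X.aemeasurable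

lemma measurable_XA : Measurable (fun ω => (D.X ω, D.A ω)) :=
  D.measurable_X.prodMk D.measurable_A

lemma measurable_XAY : Measurable (fun ω => (D.X ω, D.A ω, D.Y ω)) :=
  D.measurable_X.prodMk (D.measurable_A.prodMk D.measurable_Y)

/-- The law of an observation `(X, A, Y)`. -/
def obsLaw : Measure (EuclideanSpace ℝ (Fin d) × ℝ × ℝ) :=
  D.P₀.map (fun ω => (D.X ω, D.A ω, D.Y ω))

instance isProbabilityMeasure_obsLaw : IsProbabilityMeasure D.obsLaw :=
  Measure.isProbabilityMeasure_map D.measurable_XAY.aemeasurable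

/-- The conditional law of `Y` given `X = x, A = a`. -/
def condY : Kernel (EuclideanSpace ℝ (Fin d) × ℝ) ℝ := D.cond.map D.Y

instance isMarkovKernel_condY : IsMarkovKernel D.condY :=
  Kernel.IsMarkovKernel.map _ D.measurable_Y

lemma condY_apply (z : EuclideanSpace ℝ (Fin d) × ℝ) : D.condY z = (D.cond z).map D.Y :=
  Kernel.map_apply _ D.measurable_Y z

/-- The conditional mean `E[g(Y) | X = x, A = a]`. -/
def condMean (g : ℝ → ℝ) (z : EuclideanSpace ℝ (Fin d) × ℝ) : ℝ := ∫ y, g y ∂(D.condY z)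

lemma measurable_condMean {g : ℝ → ℝ} (hg : Measurable g) : Measurable (D.condMean g) :=
  (hg.stronglyMeasurable.integral_kernel (κ := D.condY)).measurable

lemma abs_condMean_le {g : ℝ → ℝ} {c : ℝ} {z : EuclideanSpace ℝ (Fin d) × ℝ}
    (hc : ∀ᵐ y ∂(D.condY z), |g y| ≤ c) : |D.condMean g z| ≤ c := by
  have := norm_integral_le_of_norm_le_const (μ := D.condY z) (f := g) (C := c) (by simpa using hc)
  simpa [condMean] using this

lemma ae_map_XA {p : EuclideanSpace ℝ (Fin d) × ℝ → Prop}
    (h : ∀ᵐ x ∂(D.P₀.map D.X), ∀ᵐ a ∂(volume.restrict D.actions), p (x, a))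
    (hp : MeasurableSet {z | p z}) :
    ∀ᵐ z ∂(D.P₀.map (fun ω => (D.X ω, D.A ω))), p z := by
  rw [D.law_XA]
  refine withDensity_absolutelyContinuous _ _ ?_
  exact (Measure.ae_prod_iff_ae_ae hp).2 h

lemma ae_map_XA_of_forall {p : EuclideanSpace ℝ (Fin d) × ℝ → Prop}
    (h : ∀ᵐ x ∂(D.P₀.map D.X), ∀ a ∈ D.actions, p (x, a)) :
    ∀ᵐ z ∂(D.P₀.map (fun ω => (D.X ω, D.A ω))), p z := by
  rw [D.law_XA]
  refine withDensity_absolutelyContinuous _ _ ?_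
  have h1 : ∀ᵐ z ∂((D.P₀.map D.X).prod (volume.restrict D.actions)),
      ∀ a ∈ D.actions, p (z.1, a) := Measure.quasiMeasurePreserving_fst.ae h
  have h2 : ∀ᵐ z ∂((D.P₀.map D.X).prod (volume.restrict D.actions)), z.2 ∈ D.actions :=
    Measure.quasiMeasurePreserving_snd.ae (ae_restrict_mem D.measurableSet_actions)
  filter_upwards [h1, h2] with z hz1 hz2 using hz1 _ hz2

lemma lintegral_P₀_eq {s : Set Ω} (hs : MeasurableSet s) :
    D.P₀ s = ∫⁻ z, D.cond z s ∂(D.P₀.map (fun ω => (D.X ω, D.A ω))) := by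
  conv_lhs => rw [← D.bind_cond]
  exact Measure.bind_apply hs (Kernel.aemeasurable _)

/-- As the version of the conditional probability is proper, the law of an observation
disintegrates along `condY`. -/
lemma obsLaw_eq : D.obsLaw =
    ((D.P₀.map (fun ω => (D.X ω, D.A ω))) ⊗ₘ D.condY).map (fun p => (p.1.1, p.1.2, p.2)) := by
  have hm : Measurable (fun p : (EuclideanSpace ℝ (Fin d) × ℝ) × ℝ => (p.1.1, p.1.2, p.2)) := by
    fun_prop
  ext s hs
  rw [obsLaw, Measure.map_apply D.measurable_XAY hs, D.lintegral_P₀_eq (D.measurable_XAY hs),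
    Measure.map_apply hm hs, Measure.compProd_apply (hm hs)]
  refine lintegral_congr_ae ?_
  refine D.ae_map_XA_of_forall ?_
  filter_upwards [D.cond_proper] with x hx a ha
  rw [D.condY_apply, Measure.map_apply D.measurable_Y (measurable_prodMk_left (hm hs))]
  refine measure_congr ?_
  filter_upwards [hx a ha] with ω hω
  apply propext
  change (D.X ω, D.A ω, D.Y ω) ∈ s ↔ (x, a, D.Y ω) ∈ s
  rw [hω.1, hω.2]

lemma integral_obsLaw {H : EuclideanSpace ℝ (Fin d) × ℝ × ℝ → ℝ} (hH : Measurable H)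
    (hint : Integrable H D.obsLaw) :
    ∫ z, H z ∂D.obsLaw = ∫ x, (∫ a in D.actions,
      D.fA a x * ∫ y, H (x, a, y) ∂(D.condY (x, a))) ∂(D.P₀.map D.X) := by
  have hm : Measurable (fun p : (EuclideanSpace ℝ (Fin d) × ℝ) × ℝ => (p.1.1, p.1.2, p.2)) := by
    fun_prop
  rw [obsLaw_eq] at hint
  rw [integrable_map_measure hH.aestronglyMeasurable hm.aemeasurable] at hint
  rw [obsLaw_eq, integral_map hm.aemeasurable hH.aestronglyMeasurable,
    Measure.integral_compProd (by exact hint)]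
  have hint2 : Integrable (fun z : EuclideanSpace ℝ (Fin d) × ℝ =>
      ∫ y, H (z.1, z.2, y) ∂(D.condY z)) (D.P₀.map (fun ω => (D.X ω, D.A ω))) := by
    rw [Measure.compProd] at hint
    simpa [Function.comp_def] using hint.integral_compProd
  have hfm : Measurable (fun p : EuclideanSpace ℝ (Fin d) × ℝ => ENNReal.ofReal (D.fA p.2 p.1)) :=
    (D.measurable_fA.comp measurable_swap).ennreal_ofReal
  have hlt : ∀ᵐ p ∂((D.P₀.map D.X).prod (volume.restrict D.actions)),
      ENNReal.ofReal (D.fA p.2 p.1) < ⊤ := Eventually.of_forall fun _ => ENNReal.ofReal_lt_top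
  rw [D.law_XA] at hint2 ⊢
  rw [integrable_withDensity_iff_integrable_smul' hfm hlt] at hint2
  rw [integral_withDensity_eq_integral_toReal_smul hfm hlt, integral_prod _ hint2]
  refine integral_congr_ae (Eventually.of_forall fun x => ?_)
  refine setIntegral_congr_fun D.measurableSet_actions fun a ha => ?_
  simp only [smul_eq_mul]
  rw [ENNReal.toReal_ofReal (D.fA_nonneg x a ha)]

lemma policy_mem {π : EuclideanSpace ℝ (Fin d) → ℝ} (hπ : D.InteriorPolicy π) :
    ∀ᵐ x ∂(D.P₀.map D.X), π x ∈ D.actions := by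
  obtain ⟨r, hr, h⟩ := hπ
  filter_upwards [h] with x hx using hx (Metric.mem_ball_self hr)

lemma measurable_policyOutcome {π : EuclideanSpace ℝ (Fin d) → ℝ} (hπ : Measurable π) :
    Measurable (D.policyOutcome π) :=
  D.measurable_Ypot.comp ((hπ.comp D.measurable_X).prodMk measurable_id)

lemma exists_bound (D : Population Ω d) : ∃ M : ℝ, 0 ≤ M ∧ D.outcomes ⊆ Set.Icc 0 M := by
  obtain ⟨M, hM⟩ := D.outcomes_bounded
  exact ⟨max M 0, le_max_right _ _, hM.trans (Set.Icc_subset_Icc_right (le_max_left _ _))⟩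

lemma Y_mem (hcons : D.Consistency) (ω : Ω) : D.Y ω ∈ D.outcomes := by
  rw [hcons ω (D.A ω) rfl]
  exact D.Ypot_mem _ (D.A_mem ω) ω

lemma policyOutcome_mem {π : EuclideanSpace ℝ (Fin d) → ℝ} (hπ : D.InteriorPolicy π) :
    ∀ᵐ ω ∂D.P₀, D.policyOutcome π ω ∈ D.outcomes := by
  filter_upwards [ae_of_ae_map D.measurable_X.aemeasurable (D.policy_mem hπ)] with ω hω
  exact D.Ypot_mem _ hω ω

/-- By unconfoundedness and consistency, the law of `Y(π(X))` is the mixture over `X` of the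
conditional laws of `Y` given `X` and `A = π(X)`. -/
lemma map_policyOutcome (hcons : D.Consistency) (hunconf : D.Unconfoundedness)
    {π : EuclideanSpace ℝ (Fin d) → ℝ} (hπ : Measurable π) (hπ_int : D.InteriorPolicy π) :
    D.P₀.map (D.policyOutcome π) =
      (((D.P₀.map D.X).map (fun x => (x, π x))) ⊗ₘ D.condY).map Prod.snd := by
  have hU := D.measurable_policyOutcome hπ
  have hpair : Measurable (fun x => (x, π x)) := measurable_id.prodMk hπ
  ext s hs
  have hmeas : Measurable fun x => D.condY (x, π x) s :=
    (D.condY.measurable_coe hs).comp hpair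
  rw [Measure.map_apply hU hs, D.lintegral_P₀_eq (hU hs), Measure.map_apply measurable_snd hs,
    Measure.compProd_apply (measurable_snd hs)]
  have h2 : ∀ z : EuclideanSpace ℝ (Fin d) × ℝ, Prod.mk z ⁻¹' (Prod.snd ⁻¹' s) = s :=
    fun _ => rfl
  simp only [h2]
  rw [lintegral_map (D.condY.measurable_coe hs) hpair]
  have h3 : ∫⁻ x, D.condY (x, π x) s ∂(D.P₀.map D.X) =
      ∫⁻ z, D.condY (z.1, π z.1) s ∂(D.P₀.map (fun ω => (D.X ω, D.A ω))) := by
    rw [lintegral_map hmeas D.measurable_X,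
      lintegral_map (f := fun z : EuclideanSpace ℝ (Fin d) × ℝ => D.condY (z.1, π z.1) s)
        (hmeas.comp measurable_fst) D.measurable_XA]
  rw [h3]
  refine lintegral_congr_ae (D.ae_map_XA_of_forall ?_)
  filter_upwards [D.cond_proper, hunconf, D.policy_mem hπ_int] with x hx1 hx2 hx3 a ha
  have hYp : Measurable (D.Ypot (π x)) := D.measurable_Ypot.comp measurable_prodMk_left
  calc D.cond (x, a) (D.policyOutcome π ⁻¹' s) = D.cond (x, a) (D.Ypot (π x) ⁻¹' s) := by
        refine measure_congr ?_
        filter_upwards [hx1 a ha] with ω hω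
        apply propext
        change D.Ypot (π (D.X ω)) ω ∈ s ↔ D.Ypot (π x) ω ∈ s
        rw [hω.1]
    _ = D.cond (x, π x) (D.Ypot (π x) ⁻¹' s) := by
        rw [← Measure.map_apply hYp hs, ← Measure.map_apply hYp hs,
          hx2 (π x) hx3 a ha (π x) hx3]
    _ = D.cond (x, π x) (D.Y ⁻¹' s) := by
        refine measure_congr ?_
        filter_upwards [hx1 (π x) hx3] with ω hω
        apply propext
        change D.Ypot (π x) ω ∈ s ↔ D.Y ω ∈ s
        rw [hcons ω (π x) hω.2]
    _ = D.condY (x, π x) s := by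
        rw [D.condY_apply, Measure.map_apply D.measurable_Y hs]

lemma integral_policyOutcome (hcons : D.Consistency) (hunconf : D.Unconfoundedness)
    {π : EuclideanSpace ℝ (Fin d) → ℝ} (hπ : Measurable π) (hπ_int : D.InteriorPolicy π)
    {g : ℝ → ℝ} (hg : Measurable g)
    (hint : Integrable (fun ω => g (D.policyOutcome π ω)) D.P₀) :
    ∫ ω, g (D.policyOutcome π ω) ∂D.P₀ = ∫ x, D.condMean g (x, π x) ∂(D.P₀.map D.X) := by
  have hU := D.measurable_policyOutcome hπ
  have hpair : Measurable (fun x => (x, π x)) := measurable_id.prodMk hπ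
  have hint' : Integrable g (D.P₀.map (D.policyOutcome π)) :=
    (integrable_map_measure hg.aestronglyMeasurable hU.aemeasurable).2 hint
  rw [D.map_policyOutcome hcons hunconf hπ hπ_int,
    integrable_map_measure hg.aestronglyMeasurable measurable_snd.aemeasurable] at hint'
  have : IsProbabilityMeasure ((D.P₀.map D.X).map (fun x => (x, π x))) :=
    Measure.isProbabilityMeasure_map hpair.aemeasurable
  rw [← integral_map hU.aemeasurable hg.aestronglyMeasurable,
    D.map_policyOutcome hcons hunconf hπ hπ_int,
    integral_map measurable_snd.aemeasurable hg.aestronglyMeasurable,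
    Measure.integral_compProd (by exact hint'), integral_map hpair.aemeasurable]
  · rfl
  · exact (D.measurable_condMean hg).aestronglyMeasurable

/-- The law of `Y(π(X))` has no atoms, because the conditional laws of `Y` have densities. -/
lemma policyOutcome_no_atom (hcons : D.Consistency) (hunconf : D.Unconfoundedness)
    {π : EuclideanSpace ℝ (Fin d) → ℝ} (hπ : Measurable π) (hπ_int : D.InteriorPolicy π) (c : ℝ) :
    D.P₀ {ω | D.policyOutcome π ω = c} = 0 := by
  have hU := D.measurable_policyOutcome hπ
  have hpair : Measurable (fun x => (x, π x)) := measurable_id.prodMk hπ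
  have hs : MeasurableSet ({c} : Set ℝ) := measurableSet_singleton c
  have h1 : D.P₀ {ω | D.policyOutcome π ω = c} = D.P₀.map (D.policyOutcome π) {c} := by
    rw [Measure.map_apply hU hs]; rfl
  rw [h1, D.map_policyOutcome hcons hunconf hπ hπ_int, Measure.map_apply measurable_snd hs,
    Measure.compProd_apply (measurable_snd hs)]
  have h2 : ∀ z : EuclideanSpace ℝ (Fin d) × ℝ, Prod.mk z ⁻¹' (Prod.snd ⁻¹' {c}) = ({c} : Set ℝ) :=
    fun _ => rfl
  simp only [h2]
  rw [lintegral_map (D.condY.measurable_coe hs) hpair, ← lintegral_zero]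
  refine lintegral_congr_ae ?_
  filter_upwards [D.law_Y, D.policy_mem hπ_int] with x hx1 hx2
  rw [D.condY_apply, hx1 _ hx2]
  refine withDensity_absolutelyContinuous _ _ ?_
  exact (Measure.absolutelyContinuous_of_le Measure.restrict_le_self) (by simp)

/-- Positivity holds at almost every treatment level, simultaneously for almost every covariate. -/
lemma ae_ae_le_fA {ε : ℝ} (h : ∀ a ∈ D.actions, ∀ᵐ x ∂(D.P₀.map D.X), ε ≤ D.fA a x) :
    ∀ᵐ x ∂(D.P₀.map D.X), ∀ᵐ a ∂(volume.restrict D.actions), ε ≤ D.fA a x := by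
  have hm : MeasurableSet {p : ℝ × EuclideanSpace ℝ (Fin d) | ε ≤ D.fA p.1 p.2} :=
    measurableSet_le measurable_const D.measurable_fA
  refine (Measure.ae_ae_comm (p := fun a x => ε ≤ D.fA a x) hm).1 ?_
  filter_upwards [ae_restrict_mem D.measurableSet_actions] with a ha using h a ha

end Population

/-! ### Taylor expansion of the conditional means -/

section Taylor

lemma ThreeTimesDiffBounded.mono {f : ℝ → ℝ} {s t : Set ℝ} {L L' : ℝ}
    (hf : ThreeTimesDiffBounded f t L) (hst : s ⊆ t) (hL : L ≤ L') :
    ThreeTimesDiffBounded f s L' :=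
  fun a ha => ⟨(hf a (hst ha)).1, fun k hk => ((hf a (hst ha)).2 k hk).trans hL⟩

variable {f : ℝ → ℝ} {p r L : ℝ}

lemma ThreeTimesDiffBounded.abs_le (hf : ThreeTimesDiffBounded f (Metric.ball p r) L)
    {a : ℝ} (ha : a ∈ Metric.ball p r) : |f a| ≤ L := by
  simpa using (hf a ha).2 0 (by norm_num)

lemma ThreeTimesDiffBounded.differentiableAt (hf : ThreeTimesDiffBounded f (Metric.ball p r) L)
    {a : ℝ} (ha : a ∈ Metric.ball p r) : DifferentiableAt ℝ f a := by
  simpa using (hf a ha).1 0 (by norm_num)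

lemma ThreeTimesDiffBounded.abs_sub_le (hf : ThreeTimesDiffBounded f (Metric.ball p r) L)
    {a : ℝ} (ha : a ∈ Metric.ball p r) : |f a - f p| ≤ L * |a - p| := by
  have hr : 0 < r := Metric.pos_of_mem_ball ha
  refine (convex_ball p r).norm_image_sub_le_of_norm_deriv_le (𝕜 := ℝ)
    (fun b hb => hf.differentiableAt hb) (fun b hb => ?_) (Metric.mem_ball_self hr) ha
  simpa [iteratedDeriv_one] using (hf b hb).2 1 (by norm_num)

/-- Symmetric second differences approximate the second derivative to third order. -/
lemma ThreeTimesDiffBounded.abs_second_difference_le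
    (hf : ThreeTimesDiffBounded f (Metric.ball p r) L) {t : ℝ} (ht : |t| < r) :
    |f (p + t) + f (p - t) - 2 * f p - t ^ 2 * iteratedDeriv 2 f p| ≤ 2 * L * |t| ^ 3 := by
  set f1 := iteratedDeriv 1 f with hf1
  set f2 := iteratedDeriv 2 f with hf2
  have hr : 0 < r := (abs_nonneg t).trans_lt ht
  have hp : p ∈ Metric.ball p r := Metric.mem_ball_self hr
  have hL : 0 ≤ L := (abs_nonneg _).trans (hf.abs_le hp)
  have hsub : Metric.closedBall p |t| ⊆ Metric.ball p r := Metric.closedBall_subset_ball ht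
  have hmem : ∀ b ∈ Metric.closedBall p |t|, |b - p| ≤ |t| := fun b hb => by
    simpa [Real.dist_eq] using hb
  have hpc : p ∈ Metric.closedBall p |t| := Metric.mem_closedBall_self (abs_nonneg t)
  have d0 : ∀ b ∈ Metric.ball p r, HasDerivAt f (f1 b) b := fun b hb => by
    rw [hf1, iteratedDeriv_one]; exact (hf.differentiableAt hb).hasDerivAt
  have d1 : ∀ b ∈ Metric.ball p r, HasDerivAt f1 (f2 b) b := fun b hb => by
    rw [hf2, iteratedDeriv_succ]; exact ((hf b hb).1 1 (by norm_num)).hasDerivAt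
  have h2 : ∀ b ∈ Metric.ball p r, |f2 b - f2 p| ≤ L * |b - p| := fun b hb => by
    refine (convex_ball p r).norm_image_sub_le_of_norm_deriv_le (𝕜 := ℝ)
      (fun c hc => (hf c hc).1 2 (by norm_num)) (fun c hc => ?_) hp hb
    have := (hf c hc).2 3 le_rfl
    rwa [iteratedDeriv_succ] at this
  have h1 : ∀ b ∈ Metric.closedBall p |t|, |f1 b - f1 p - (b - p) * f2 p| ≤ L * |t| ^ 2 := by
    intro b hb
    have hd : ∀ c ∈ Metric.closedBall p |t|,
        HasDerivWithinAt (fun c => f1 c - (c - p) * f2 p) (f2 c - f2 p)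
          (Metric.closedBall p |t|) c := fun c hc => by
      have h := (d1 c (hsub hc)).sub (((hasDerivAt_id c).sub_const p).mul_const (f2 p))
      exact (h.congr_deriv (by simp)).hasDerivWithinAt
    have hmv := (convex_closedBall p |t|).norm_image_sub_le_of_norm_hasDerivWithin_le hd
      (C := L * |t|) (fun c hc => by
        rw [Real.norm_eq_abs]
        exact (h2 c (hsub hc)).trans (mul_le_mul_of_nonneg_left (hmem c hc) hL)) hpc hb
    rw [Real.norm_eq_abs, Real.norm_eq_abs] at hmv
    calc |f1 b - f1 p - (b - p) * f2 p|
        = |f1 b - (b - p) * f2 p - (f1 p - (p - p) * f2 p)| := by congr 1; ring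
      _ ≤ L * |t| * |b - p| := hmv
      _ ≤ L * |t| * |t| := by have := hmem b hb; gcongr
      _ = L * |t| ^ 2 := by ring
  have h0 : ∀ b ∈ Metric.closedBall p |t|,
      |f b - (b - p) * f1 p - (b - p) ^ 2 / 2 * f2 p - f p| ≤ L * |t| ^ 3 := by
    intro b hb
    have hd : ∀ c ∈ Metric.closedBall p |t|,
        HasDerivWithinAt (fun c => f c - (c - p) * f1 p - (c - p) ^ 2 / 2 * f2 p)
          (f1 c - f1 p - (c - p) * f2 p) (Metric.closedBall p |t|) c := fun c hc => by
      have hid := (hasDerivAt_id c).sub_const p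
      have h := ((d0 c (hsub hc)).sub (hid.mul_const (f1 p))).sub
        (((hid.pow 2).div_const 2).mul_const (f2 p))
      refine (h.congr_deriv ?_).hasDerivWithinAt
      simp
    have hmv := (convex_closedBall p |t|).norm_image_sub_le_of_norm_hasDerivWithin_le hd
      (C := L * |t| ^ 2) (fun c hc => h1 c hc) hpc hb
    rw [Real.norm_eq_abs, Real.norm_eq_abs] at hmv
    calc |f b - (b - p) * f1 p - (b - p) ^ 2 / 2 * f2 p - f p|
        = |f b - (b - p) * f1 p - (b - p) ^ 2 / 2 * f2 p -
            (f p - (p - p) * f1 p - (p - p) ^ 2 / 2 * f2 p)| := by congr 1; ring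
      _ ≤ L * |t| ^ 2 * |b - p| := hmv
      _ ≤ L * |t| ^ 2 * |t| := by have := hmem b hb; gcongr
      _ = L * |t| ^ 3 := by ring
  have e1 := _root_.abs_le.1 (h0 (p + t) (by simp))
  have e2 := _root_.abs_le.1 (h0 (p - t) (by simp))
  rw [_root_.abs_le]
  constructor <;> nlinarith [e1.1, e1.2, e2.1, e2.2]

end Taylor

namespace Population

variable {Ω : Type*} [MeasurableSpace Ω] {d : ℕ} (D : Population Ω d)

/-- The regularity properties, with explicit constants, that almost every covariate `x` has. -/
structure RegularAt (π : EuclideanSpace ℝ (Fin d) → ℝ) (r L ε : ℝ)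
    (x : EuclideanSpace ℝ (Fin d)) : Prop where
  ball_subset : Metric.ball (π x) r ⊆ D.actions
  smooth_fA : ThreeTimesDiffBounded (fun a => D.fA a x) (Metric.ball (π x) r) L
  smooth_fY : ∀ y ∈ D.outcomes,
    ThreeTimesDiffBounded (fun a => D.fY y a x) (Metric.ball (π x) r) L
  condY_eq : ∀ a ∈ D.actions, D.condY (x, a) =
    (volume.restrict D.outcomes).withDensity (fun y => ENNReal.ofReal (D.fY y a x))
  le_fA : ∀ a ∈ Metric.ball (π x) r, ε ≤ D.fA a x
  ae_le_fA : ∀ᵐ a ∂(volume.restrict D.actions), ε ≤ D.fA a x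

/-- The assumptions hold at almost every covariate, with common constants. Positivity is assumed
for almost every covariate at each treatment level; continuity of the density upgrades it to all
treatment levels near the policy at once. -/
lemma exists_regularAt (hpos : D.Positivity) (hsmooth : D.SmoothDensities)
    {π : EuclideanSpace ℝ (Fin d) → ℝ} (hπ_int : D.InteriorPolicy π) :
    ∃ r L ε : ℝ, 0 < r ∧ r ≤ 1 ∧ 0 ≤ L ∧ 0 < ε ∧
      ∀ᵐ x ∂(D.P₀.map D.X), D.RegularAt π r L ε x := by
  obtain ⟨ε, hε, hA⟩ := hpos
  obtain ⟨L, hL⟩ := hsmooth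
  obtain ⟨r, hr, hball⟩ := hπ_int
  refine ⟨min r 1, max L 0, ε, lt_min hr one_pos, min_le_right _ _, le_max_right _ _, hε, ?_⟩
  filter_upwards [hL, hball, D.law_Y, D.ae_ae_le_fA hA] with x h1 h2 h3 h4
  have hb : Metric.ball (π x) (min r 1) ⊆ D.actions :=
    (Metric.ball_subset_ball (min_le_left _ _)).trans h2
  have hbi : Metric.ball (π x) (min r 1) ⊆ interior D.actions :=
    interior_maximal hb Metric.isOpen_ball
  have hs := h1.1.mono hbi (le_max_left L 0)
  refine ⟨hb, hs, fun y hy => (h1.2 y hy).mono hbi (le_max_left L 0), fun a ha => ?_,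
    fun a ha => ?_, h4⟩
  · rw [D.condY_apply]; exact h3 a ha
  · by_contra! hlt
    have hev := ((hs.differentiableAt ha).continuousAt.eventually (gt_mem_nhds hlt)).and
      (Metric.isOpen_ball.mem_nhds ha)
    have hzero : volume {b | D.fA b x < ε ∧ b ∈ Metric.ball (π x) (min r 1)} = 0 := by
      rw [ae_restrict_iff' D.measurableSet_actions, ae_iff] at h4
      refine measure_mono_null ?_ h4
      intro b hb' hc
      exact absurd (hc (hb hb'.2)) (not_le.2 hb'.1)
    exact (Measure.measure_pos_of_mem_nhds volume hev).ne' hzero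

variable {D} {π : EuclideanSpace ℝ (Fin d) → ℝ} {r L ε : ℝ} {x : EuclideanSpace ℝ (Fin d)}

lemma measurable_fY_left (D : Population Ω d) (a : ℝ) (x : EuclideanSpace ℝ (Fin d)) :
    Measurable (fun y => D.fY y a x) :=
  D.measurable_fY.comp (measurable_id.prodMk (measurable_const (a := (a, x))))

lemma volume_outcomes_lt_top (D : Population Ω d) : volume D.outcomes < ⊤ := by
  obtain ⟨M, -, hM⟩ := D.exists_bound
  exact (measure_mono hM).trans_lt (by simp)

instance (D : Population Ω d) : IsFiniteMeasure (volume.restrict D.outcomes) :=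
  ⟨by simpa using D.volume_outcomes_lt_top⟩

lemma RegularAt.integral_condY (hx : D.RegularAt π r L ε x) {a : ℝ} (ha : a ∈ D.actions)
    (g : ℝ → ℝ) :
    ∫ y, g y ∂(D.condY (x, a)) = ∫ y in D.outcomes, D.fY y a x * g y := by
  rw [hx.condY_eq a ha, integral_withDensity_eq_integral_toReal_smul
    (D.measurable_fY_left a x).ennreal_ofReal
    (Eventually.of_forall fun _ => ENNReal.ofReal_lt_top)]
  refine setIntegral_congr_fun D.measurableSet_outcomes fun y hy => ?_
  simp only [smul_eq_mul]
  rw [ENNReal.toReal_ofReal (D.fY_nonneg x a ha y hy)]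

lemma RegularAt.condMean_eq (hx : D.RegularAt π r L ε x) {a : ℝ} (ha : a ∈ D.actions)
    (g : ℝ → ℝ) : D.condMean g (x, a) = ∫ y in D.outcomes, D.fY y a x * g y :=
  hx.integral_condY ha g

lemma RegularAt.ae_mem_outcomes (hx : D.RegularAt π r L ε x) {a : ℝ} (ha : a ∈ D.actions) :
    ∀ᵐ y ∂(D.condY (x, a)), y ∈ D.outcomes := by
  rw [hx.condY_eq a ha]
  exact withDensity_absolutelyContinuous _ _ (ae_restrict_mem D.measurableSet_outcomes)

lemma RegularAt.integrable_fY_mul (hx : D.RegularAt π r L ε x) {a : ℝ}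
    (ha : a ∈ Metric.ball (π x) r) {g : ℝ → ℝ} (hg : Measurable g) {c : ℝ}
    (hc : ∀ y ∈ D.outcomes, |g y| ≤ c) :
    Integrable (fun y => D.fY y a x * g y) (volume.restrict D.outcomes) := by
  refine Integrable.of_bound
    ((D.measurable_fY_left a x).mul hg).aestronglyMeasurable (L * c) ?_
  filter_upwards [ae_restrict_mem D.measurableSet_outcomes] with y hy
  rw [norm_mul, Real.norm_eq_abs, Real.norm_eq_abs]
  have h1 := (hx.smooth_fY y hy).abs_le ha
  have h2 := hc y hy
  have h3 := (abs_nonneg _).trans h1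
  gcongr

/-- `∂²_{aa}` of the conditional mean of `g(Y)` at `a = π(x)`, written with the differentiation
under the integral sign. -/
def curvature (D : Population Ω d) (π : EuclideanSpace ℝ (Fin d) → ℝ) (g : ℝ → ℝ)
    (x : EuclideanSpace ℝ (Fin d)) : ℝ :=
  ∫ y in D.outcomes, D.fYaa y (π x) x * g y

/-- The second derivative of the density is a limit of second difference quotients. -/
lemma RegularAt.aemeasurable_fYaa (hx : D.RegularAt π r L ε x) (hr : 0 < r) :
    AEMeasurable (fun y => D.fYaa y (π x) x) (volume.restrict D.outcomes) := by
  let t : ℕ → ℝ := fun n => 1 / ((n : ℝ) + 1)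
  have ht : Tendsto t atTop (𝓝 0) := tendsto_one_div_add_atTop_nhds_zero_nat
  have ht0 : ∀ n, 0 < t n := fun n => Nat.one_div_pos_of_nat
  refine aemeasurable_of_tendsto_metrizable_ae atTop
    (f := fun n y => (D.fY y (π x + t n) x + D.fY y (π x - t n) x - 2 * D.fY y (π x) x)
      / t n ^ 2) (fun n => ?_) ?_
  · exact ((((D.measurable_fY_left _ x).add (D.measurable_fY_left _ x)).sub
      ((D.measurable_fY_left _ x).const_mul 2)).div_const _).aemeasurable
  · filter_upwards [ae_restrict_mem D.measurableSet_outcomes] with y hy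
    rw [tendsto_iff_norm_sub_tendsto_zero]
    have hlim : Tendsto (fun n => 2 * L * t n) atTop (𝓝 0) := by
      simpa using ht.const_mul (2 * L)
    refine squeeze_zero' (Eventually.of_forall fun _ => norm_nonneg _) ?_ hlim
    filter_upwards [ht.eventually (gt_mem_nhds hr)] with n hn
    have h := (hx.smooth_fY y hy).abs_second_difference_le
      (t := t n) (by rwa [abs_of_pos (ht0 n)])
    rw [abs_of_pos (ht0 n)] at h
    have h3 : (D.fY y (π x + t n) x + D.fY y (π x - t n) x - 2 * D.fY y (π x) x) / t n ^ 2 -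
        D.fYaa y (π x) x = (D.fY y (π x + t n) x + D.fY y (π x - t n) x - 2 * D.fY y (π x) x
          - t n ^ 2 * D.fYaa y (π x) x) / t n ^ 2 := by
      have := (ht0 n).ne'
      field_simp
    rw [h3, Real.norm_eq_abs, abs_div, abs_of_pos (pow_pos (ht0 n) 2),
      div_le_iff₀ (pow_pos (ht0 n) 2)]
    calc _ ≤ 2 * L * t n ^ 3 := h
      _ = _ := by ring

lemma RegularAt.integrable_fYaa_mul (hx : D.RegularAt π r L ε x) (hr : 0 < r)
    {g : ℝ → ℝ} (hg : Measurable g) {c : ℝ} (hc : ∀ y ∈ D.outcomes, |g y| ≤ c) :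
    Integrable (fun y => D.fYaa y (π x) x * g y) (volume.restrict D.outcomes) := by
  refine Integrable.of_bound
    ((hx.aemeasurable_fYaa hr).mul hg.aemeasurable).aestronglyMeasurable (L * c) ?_
  filter_upwards [ae_restrict_mem D.measurableSet_outcomes] with y hy
  rw [norm_mul, Real.norm_eq_abs, Real.norm_eq_abs]
  have h1 := (hx.smooth_fY y hy _ (Metric.mem_ball_self hr)).2 2 (by norm_num)
  have h2 := hc y hy
  have h3 := (abs_nonneg _).trans h1
  change |D.fYaa y (π x) x| ≤ L at h1
  gcongr

lemma RegularAt.abs_curvature_le (hx : D.RegularAt π r L ε x) (hr : 0 < r)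
    {g : ℝ → ℝ} {c : ℝ} (hc : ∀ y ∈ D.outcomes, |g y| ≤ c) :
    |D.curvature π g x| ≤ L * c * volume.real D.outcomes := by
  have := norm_setIntegral_le_of_norm_le_const (μ := volume) (s := D.outcomes)
    (f := fun y => D.fYaa y (π x) x * g y) (C := L * c) D.volume_outcomes_lt_top
    (fun y hy => ?_)
  · simpa [curvature] using this
  · rw [norm_mul, Real.norm_eq_abs, Real.norm_eq_abs]
    have h1 := (hx.smooth_fY y hy _ (Metric.mem_ball_self hr)).2 2 (by norm_num)
    have h2 := hc y hy
    have h3 := (abs_nonneg _).trans h1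
    change |D.fYaa y (π x) x| ≤ L at h1
    gcongr

lemma RegularAt.abs_condMean_second_difference_le (hx : D.RegularAt π r L ε x) (hr : 0 < r)
    {g : ℝ → ℝ} (hg : Measurable g) {c : ℝ} (hc : ∀ y ∈ D.outcomes, |g y| ≤ c)
    {t : ℝ} (ht : |t| < r) :
    |D.condMean g (x, π x + t) + D.condMean g (x, π x - t) - 2 * D.condMean g (x, π x)
      - t ^ 2 * D.curvature π g x| ≤ 2 * L * c * volume.real D.outcomes * |t| ^ 3 := by
  have m1 : π x + t ∈ Metric.ball (π x) r := by simpa [Real.dist_eq] using ht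
  have m2 : π x - t ∈ Metric.ball (π x) r := by simpa [Real.dist_eq] using ht
  have m0 : π x ∈ Metric.ball (π x) r := Metric.mem_ball_self hr
  have i1 := hx.integrable_fY_mul m1 hg hc
  have i2 := hx.integrable_fY_mul m2 hg hc
  have i0 := hx.integrable_fY_mul m0 hg hc
  have i3 := hx.integrable_fYaa_mul hr hg hc
  have i12 : Integrable (fun y => D.fY y (π x + t) x * g y + D.fY y (π x - t) x * g y)
    (volume.restrict D.outcomes) := i1.add i2
  have i120 : Integrable (fun y => D.fY y (π x + t) x * g y + D.fY y (π x - t) x * g y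
    - 2 * (D.fY y (π x) x * g y)) (volume.restrict D.outcomes) := i12.sub (i0.const_mul 2)
  rw [hx.condMean_eq (hx.ball_subset m1), hx.condMean_eq (hx.ball_subset m2),
    hx.condMean_eq (hx.ball_subset m0), curvature, ← integral_const_mul, ← integral_const_mul,
    ← integral_add i1 i2, ← integral_sub i12 (i0.const_mul 2),
    ← integral_sub i120 (i3.const_mul _)]
  have := norm_setIntegral_le_of_norm_le_const (μ := volume) (s := D.outcomes)
    (f := fun y => D.fY y (π x + t) x * g y + D.fY y (π x - t) x * g y
      - 2 * (D.fY y (π x) x * g y) - t ^ 2 * (D.fYaa y (π x) x * g y))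
    (C := 2 * L * |t| ^ 3 * c) D.volume_outcomes_lt_top (fun y hy => ?_)
  · rw [Real.norm_eq_abs] at this
    refine this.trans (le_of_eq ?_)
    ring
  · have h1 := (hx.smooth_fY y hy).abs_second_difference_le ht
    have h2 := hc y hy
    have h3 : D.fY y (π x + t) x * g y + D.fY y (π x - t) x * g y
      - 2 * (D.fY y (π x) x * g y) - t ^ 2 * (D.fYaa y (π x) x * g y) =
      (D.fY y (π x + t) x + D.fY y (π x - t) x - 2 * D.fY y (π x) x
        - t ^ 2 * iteratedDeriv 2 (fun a => D.fY y a x) (π x)) * g y := by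
      rw [fYaa]; ring
    rw [h3, norm_mul, Real.norm_eq_abs, Real.norm_eq_abs]
    have h4 := (abs_nonneg _).trans h1
    gcongr

lemma RegularAt.abs_condMean_sub_le (hx : D.RegularAt π r L ε x) (hr : 0 < r)
    {g : ℝ → ℝ} (hg : Measurable g) {c : ℝ} (hc : ∀ y ∈ D.outcomes, |g y| ≤ c)
    {a : ℝ} (ha : a ∈ Metric.ball (π x) r) :
    |D.condMean g (x, a) - D.condMean g (x, π x)| ≤
      L * c * volume.real D.outcomes * |a - π x| := by
  have m0 : π x ∈ Metric.ball (π x) r := Metric.mem_ball_self hr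
  have i1 := hx.integrable_fY_mul ha hg hc
  have i0 := hx.integrable_fY_mul m0 hg hc
  rw [hx.condMean_eq (hx.ball_subset ha), hx.condMean_eq (hx.ball_subset m0), ← integral_sub i1 i0]
  have := norm_setIntegral_le_of_norm_le_const (μ := volume) (s := D.outcomes)
    (f := fun y => D.fY y a x * g y - D.fY y (π x) x * g y)
    (C := L * |a - π x| * c) D.volume_outcomes_lt_top (fun y hy => ?_)
  · rw [Real.norm_eq_abs] at this
    refine this.trans (le_of_eq ?_)
    ring
  · have h1 := (hx.smooth_fY y hy).abs_sub_le ha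
    have h2 := hc y hy
    rw [← sub_mul, norm_mul, Real.norm_eq_abs, Real.norm_eq_abs]
    have h4 := (abs_nonneg _).trans h1
    gcongr

end Population

/-! ### Moments of the kernel weights -/

lemma IsSecondOrderKernel.integrable {K : ℝ → ℝ} (hK : IsSecondOrderKernel K) : Integrable K := by
  by_contra h
  have := hK.integral_one
  rw [integral_undef h] at this
  exact zero_ne_one this

lemma IsSecondOrderKernel.integrable_sq {K : ℝ → ℝ} (hK : IsSecondOrderKernel K) :
    Integrable (fun u => K u ^ 2) := by
  obtain ⟨B, hB⟩ := hK.bounded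
  have := hK.integrable.bdd_mul hK.measurable.aestronglyMeasurable
    (Eventually.of_forall fun u => (Real.norm_eq_abs (K u)).le.trans (hB u))
  simpa [sq] using this

/-- The truncated second moment that controls the remainder of the bias expansion. The truncation
makes up for the third moment of `K`, which may be infinite. -/
lemma IsSecondOrderKernel.tendsto_truncated_moment {K : ℝ → ℝ} (hK : IsSecondOrderKernel K) :
    Tendsto (fun h : ℝ => ∫ u, u ^ 2 * K u * min (h * |u|) 1) (𝓝[>] 0) (𝓝 0) := by
  have hm := hK.measurable
  have : Tendsto (fun h : ℝ => ∫ u, u ^ 2 * K u * min (h * |u|) 1) (𝓝[>] 0)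
      (𝓝 (∫ _ : ℝ, (0 : ℝ))) := by
    refine tendsto_integral_filter_of_dominated_convergence (fun u => u ^ 2 * K u)
      (Eventually.of_forall fun h => by fun_prop) ?_ hK.second_moment ?_
    · filter_upwards [self_mem_nhdsWithin] with h (hh : 0 < h)
      refine Eventually.of_forall fun u => ?_
      have h1 : 0 ≤ u ^ 2 * K u := mul_nonneg (sq_nonneg u) (hK.nonneg u)
      have h2 : 0 ≤ min (h * |u|) 1 := le_min (by positivity) zero_le_one
      rw [Real.norm_eq_abs, abs_of_nonneg (mul_nonneg h1 h2)]
      exact mul_le_of_le_one_right h1 (min_le_right _ _)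
    · refine Eventually.of_forall fun u => ?_
      have h1 : Tendsto (fun h : ℝ => u ^ 2 * K u * min (h * |u|) 1) (𝓝 0)
          (𝓝 (u ^ 2 * K u * min (0 * |u|) 1)) := by
        have hc : Continuous fun h : ℝ => u ^ 2 * K u * min (h * |u|) 1 := by fun_prop
        exact hc.tendsto 0
      simpa using h1.mono_left nhdsWithin_le_nhds
  simpa using this

lemma integral_rescale (F : ℝ → ℝ) (p : ℝ) {h : ℝ} (hh : 0 < h) :
    ∫ a, 1 / h * F a = ∫ u, F (p - h * u) := by
  have h1 : ∫ a, F a = ∫ a, F (p - a) := (integral_sub_left_eq_self F volume p).symm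
  have h2 := Measure.integral_comp_mul_left (fun a => F (p - a)) h
  rw [h2, integral_const_mul, h1, abs_of_pos (inv_pos.2 hh), smul_eq_mul, one_div]

namespace Population

variable {Ω : Type*} [MeasurableSpace Ω] {d : ℕ} (D : Population Ω d)

/-- `q(x, a) E[g(Y) | X = x, A = a]`, extended by zero outside the treatment space. -/
def localMean (q : EuclideanSpace ℝ (Fin d) × ℝ → ℝ) (g : ℝ → ℝ) :
    EuclideanSpace ℝ (Fin d) × ℝ → ℝ :=
  Set.indicator {z | z.2 ∈ D.actions} (fun z => q z * D.condMean g z)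

lemma measurable_localMean {q : EuclideanSpace ℝ (Fin d) × ℝ → ℝ} (hq : Measurable q)
    {g : ℝ → ℝ} (hg : Measurable g) : Measurable (D.localMean q g) :=
  (hq.mul (D.measurable_condMean hg)).indicator (measurable_snd D.measurableSet_actions)

lemma localMean_of_mem (q : EuclideanSpace ℝ (Fin d) × ℝ → ℝ) (g : ℝ → ℝ)
    {x : EuclideanSpace ℝ (Fin d)} {a : ℝ} (ha : a ∈ D.actions) :
    D.localMean q g (x, a) = q (x, a) * D.condMean g (x, a) :=
  Set.indicator_of_mem (s := {z : EuclideanSpace ℝ (Fin d) × ℝ | z.2 ∈ D.actions})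
    (a := (x, a)) ha _

lemma localMean_of_notMem (q : EuclideanSpace ℝ (Fin d) × ℝ → ℝ) (g : ℝ → ℝ)
    {x : EuclideanSpace ℝ (Fin d)} {a : ℝ} (ha : a ∉ D.actions) : D.localMean q g (x, a) = 0 :=
  Set.indicator_of_notMem (s := {z : EuclideanSpace ℝ (Fin d) × ℝ | z.2 ∈ D.actions})
    (a := (x, a)) ha _

variable {D} {π : EuclideanSpace ℝ (Fin d) → ℝ} {r L ε c : ℝ} {g : ℝ → ℝ}

lemma RegularAt.abs_condMean_le {x : EuclideanSpace ℝ (Fin d)} (hx : D.RegularAt π r L ε x)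
    (hc : ∀ y ∈ D.outcomes, |g y| ≤ c) {a : ℝ} (ha : a ∈ D.actions) :
    |D.condMean g (x, a)| ≤ c := by
  refine D.abs_condMean_le ?_
  filter_upwards [hx.ae_mem_outcomes ha] with y hy using hc y hy

lemma RegularAt.abs_localMean_le {x : EuclideanSpace ℝ (Fin d)} (hx : D.RegularAt π r L ε x)
    (hc0 : 0 ≤ c) (hc : ∀ y ∈ D.outcomes, |g y| ≤ c) {q : EuclideanSpace ℝ (Fin d) × ℝ → ℝ}
    {b : ℝ} (hq : ∀ z, |q z| ≤ b) (a : ℝ) : |D.localMean q g (x, a)| ≤ b * c := by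
  have hb : 0 ≤ b := (abs_nonneg _).trans (hq (x, a))
  by_cases ha : a ∈ D.actions
  · rw [D.localMean_of_mem q g ha, abs_mul]
    have h1 := hq (x, a)
    have h2 := hx.abs_condMean_le hc ha
    gcongr
  · rw [D.localMean_of_notMem q g ha, abs_zero]; positivity

lemma obsLaw_ae_le_fA (hreg : ∀ᵐ x ∂(D.P₀.map D.X), D.RegularAt π r L ε x) :
    ∀ᵐ z ∂D.obsLaw, ε ≤ D.fA z.2.1 z.1 := by
  have hm : MeasurableSet {z : EuclideanSpace ℝ (Fin d) × ℝ | ε ≤ D.fA z.2 z.1} :=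
    measurableSet_le measurable_const (D.measurable_fA.comp measurable_swap)
  have h := D.ae_map_XA (p := fun z => ε ≤ D.fA z.2 z.1)
    (hreg.mono fun x hx => hx.ae_le_fA) hm
  have h2 := ae_of_ae_map D.measurable_XA.aemeasurable h
  refine (ae_map_iff D.measurable_XAY.aemeasurable ?_).2 h2
  exact measurableSet_le measurable_const
    (D.measurable_fA.comp (measurable_snd.fst.prodMk measurable_fst))

lemma obsLaw_ae_mem_outcomes (hcons : D.Consistency) :
    ∀ᵐ z ∂D.obsLaw, z.2.2 ∈ D.outcomes :=
  (ae_map_iff D.measurable_XAY.aemeasurable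
    (measurable_snd.snd D.measurableSet_outcomes)).2 (Eventually.of_forall fun ω => D.Y_mem hcons ω)

lemma obsLaw_ae_fA_nonneg : ∀ᵐ z ∂D.obsLaw, 0 ≤ D.fA z.2.1 z.1 := by
  refine (ae_map_iff D.measurable_XAY.aemeasurable ?_).2
    (Eventually.of_forall fun ω => D.fA_nonneg _ _ (D.A_mem ω))
  exact measurableSet_le measurable_const
    (D.measurable_fA.comp (measurable_snd.fst.prodMk measurable_fst))

/-- The inverse propensity weights cancel the density of the treatment, so that a weighted mean is
a kernel smoothing of the conditional means around `a = π(x)`. The factor `q` leaves room for the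
second inverse density in the squared weights. -/
lemma integral_obsLaw_kernel (hε : 0 < ε)
    (hreg : ∀ᵐ x ∂(D.P₀.map D.X), D.RegularAt π r L ε x) (hπ : Measurable π)
    {k : ℝ → ℝ} (hk : Measurable k) {q : EuclideanSpace ℝ (Fin d) × ℝ → ℝ} (hq : Measurable q)
    (hg : Measurable g) {h : ℝ} (hh : 0 < h)
    (hint : Integrable (fun z : EuclideanSpace ℝ (Fin d) × ℝ × ℝ =>
      1 / h * k ((π z.1 - z.2.1) / h) * q (z.1, z.2.1) / D.fA z.2.1 z.1 * g z.2.2) D.obsLaw) :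
    ∫ z, 1 / h * k ((π z.1 - z.2.1) / h) * q (z.1, z.2.1) / D.fA z.2.1 z.1 * g z.2.2 ∂D.obsLaw
      = ∫ x, (∫ u, k u * D.localMean q g (x, π x - h * u)) ∂(D.P₀.map D.X) := by
  have hmeas : Measurable (fun z : EuclideanSpace ℝ (Fin d) × ℝ × ℝ =>
      1 / h * k ((π z.1 - z.2.1) / h) * q (z.1, z.2.1) / D.fA z.2.1 z.1 * g z.2.2) := by
    have h1 : Measurable fun z : EuclideanSpace ℝ (Fin d) × ℝ × ℝ => D.fA z.2.1 z.1 :=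
      D.measurable_fA.comp (measurable_snd.fst.prodMk measurable_fst)
    fun_prop
  rw [D.integral_obsLaw hmeas hint]
  refine integral_congr_ae ?_
  filter_upwards [hreg] with x hx
  calc ∫ a in D.actions, D.fA a x * ∫ y, 1 / h * k ((π x - a) / h) * q (x, a) / D.fA a x * g y
          ∂(D.condY (x, a))
      = ∫ a in D.actions, 1 / h * (k ((π x - a) / h) * (q (x, a) * D.condMean g (x, a))) := by
        refine integral_congr_ae ?_
        filter_upwards [hx.ae_le_fA] with a ha
        have : D.fA a x ≠ 0 := (hε.trans_le ha).ne'
        rw [integral_const_mul, condMean]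
        field_simp
    _ = ∫ a, 1 / h * (k ((π x - a) / h) * D.localMean q g (x, a)) := by
        rw [← integral_indicator D.measurableSet_actions]
        refine integral_congr_ae (Eventually.of_forall fun a => ?_)
        by_cases ha : a ∈ D.actions
        · simp only [Set.indicator_of_mem ha, D.localMean_of_mem q g ha]
        · simp only [Set.indicator_of_notMem ha, D.localMean_of_notMem q g ha, mul_zero]
    _ = ∫ u, k u * D.localMean q g (x, π x - h * u) := by
        rw [integral_rescale (fun a => k ((π x - a) / h) * D.localMean q g (x, a)) (π x) hh]
        refine integral_congr_ae (Eventually.of_forall fun u => ?_)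
        simp only [sub_sub_cancel]
        rw [mul_div_cancel_left₀ u hh.ne']

lemma measurable_weight (D : Population Ω d) {K : ℝ → ℝ} (hK : Measurable K) (hπ : Measurable π)
    (h : ℝ) : Measurable (D.weight K π h) := by
  have h1 : Measurable fun z : EuclideanSpace ℝ (Fin d) × ℝ × ℝ => D.fA z.2.1 z.1 :=
    D.measurable_fA.comp (measurable_snd.fst.prodMk measurable_fst)
  unfold weight scaledKernel
  fun_prop

lemma abs_weight_le {K : ℝ → ℝ} {B : ℝ} (hB : ∀ u, |K u| ≤ B) (hε : 0 < ε) {h : ℝ} (hh : 0 < h)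
    {z : EuclideanSpace ℝ (Fin d) × ℝ × ℝ} (hz : ε ≤ D.fA z.2.1 z.1) :
    |D.weight K π h z| ≤ B / (h * ε) := by
  have hf : 0 < D.fA z.2.1 z.1 := hε.trans_le hz
  have hB0 : 0 ≤ B := (abs_nonneg _).trans (hB 0)
  unfold weight scaledKernel
  rw [abs_div, abs_mul, abs_of_pos hf, abs_of_pos (one_div_pos.2 hh)]
  calc 1 / h * |K ((π z.1 - z.2.1) / h)| / D.fA z.2.1 z.1 ≤ 1 / h * B / ε := by
        gcongr; exact hB _
    _ = _ := by field_simp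

section Limits

variable {K : ℝ → ℝ}

lemma integrable_weight_pow_mul (hK : IsSecondOrderKernel K) (hcons : D.Consistency)
    (hε : 0 < ε) (hreg : ∀ᵐ x ∂(D.P₀.map D.X), D.RegularAt π r L ε x) (hπ : Measurable π)
    (hg : Measurable g) (hc : ∀ y ∈ D.outcomes, |g y| ≤ c) {h : ℝ} (hh : 0 < h) (n : ℕ) :
    Integrable (fun z => D.weight K π h z ^ n * g z.2.2) D.obsLaw := by
  obtain ⟨B, hB⟩ := hK.bounded
  have hB0 : 0 ≤ B := (abs_nonneg _).trans (hB 0)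
  have hw := D.measurable_weight hK.measurable hπ h
  refine Integrable.of_bound (by fun_prop) ((B / (h * ε)) ^ n * c) ?_
  filter_upwards [obsLaw_ae_le_fA hreg, obsLaw_ae_mem_outcomes hcons] with z h1 h2
  rw [norm_mul, norm_pow, Real.norm_eq_abs, Real.norm_eq_abs]
  have h3 := abs_weight_le (π := π) hB hε hh h1
  have h4 := hc _ h2
  gcongr

lemma integral_weight_mul (hK : IsSecondOrderKernel K) (hcons : D.Consistency)
    (hε : 0 < ε) (hreg : ∀ᵐ x ∂(D.P₀.map D.X), D.RegularAt π r L ε x) (hπ : Measurable π)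
    (hg : Measurable g) (hc : ∀ y ∈ D.outcomes, |g y| ≤ c) {h : ℝ} (hh : 0 < h) :
    ∫ z, D.weight K π h z * g z.2.2 ∂D.obsLaw =
      ∫ x, (∫ u, K u * D.localMean (fun _ => 1) g (x, π x - h * u)) ∂(D.P₀.map D.X) := by
  have hid : ∀ z : EuclideanSpace ℝ (Fin d) × ℝ × ℝ, D.weight K π h z * g z.2.2 =
      1 / h * K ((π z.1 - z.2.1) / h) * 1 / D.fA z.2.1 z.1 * g z.2.2 := by
    intro z; simp [weight, scaledKernel]
  have hint := integrable_weight_pow_mul hK hcons hε hreg hπ hg hc hh 1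
  simp only [pow_one, hid] at hint
  simp only [hid]
  exact integral_obsLaw_kernel hε hreg hπ hK.measurable (q := fun _ => 1) measurable_const hg hh
    hint

lemma integral_weight_sq_mul (hK : IsSecondOrderKernel K) (hcons : D.Consistency)
    (hε : 0 < ε) (hreg : ∀ᵐ x ∂(D.P₀.map D.X), D.RegularAt π r L ε x) (hπ : Measurable π)
    (hg : Measurable g) (hc : ∀ y ∈ D.outcomes, |g y| ≤ c) {h : ℝ} (hh : 0 < h) :
    h * ∫ z, D.weight K π h z ^ 2 * g z.2.2 ∂D.obsLaw =
      ∫ x, (∫ u, K u ^ 2 * D.localMean (fun z => (max (D.fA z.2 z.1) ε)⁻¹) g (x, π x - h * u))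
        ∂(D.P₀.map D.X) := by
  have hfA : Measurable fun z : EuclideanSpace ℝ (Fin d) × ℝ => D.fA z.2 z.1 :=
    D.measurable_fA.comp measurable_swap
  have hid : (fun z : EuclideanSpace ℝ (Fin d) × ℝ × ℝ => h * (D.weight K π h z ^ 2 * g z.2.2))
      =ᵐ[D.obsLaw] fun z => 1 / h * K ((π z.1 - z.2.1) / h) ^ 2 * (max (D.fA z.2.1 z.1) ε)⁻¹
        / D.fA z.2.1 z.1 * g z.2.2 := by
    filter_upwards [obsLaw_ae_le_fA hreg] with z hz
    have : D.fA z.2.1 z.1 ≠ 0 := (hε.trans_le hz).ne'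
    rw [max_eq_left hz, weight, scaledKernel]
    field_simp
  have hint := ((integrable_weight_pow_mul hK hcons hε hreg hπ hg hc hh 2).const_mul h).congr hid
  rw [← integral_const_mul, integral_congr_ae hid]
  exact integral_obsLaw_kernel hε hreg hπ (k := fun u => K u ^ 2) (hK.measurable.pow_const 2)
    (q := fun z => (max (D.fA z.2 z.1) ε)⁻¹) (by fun_prop) hg hh hint

/-- Symmetric second differences of the local means, uniformly in the step `t ∈ ℝ`. -/
lemma RegularAt.abs_localMean_second_difference_le {x : EuclideanSpace ℝ (Fin d)}
    (hx : D.RegularAt π r L ε x) (hr : 0 < r) (hr1 : r ≤ 1) (hL : 0 ≤ L) (hg : Measurable g)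
    (hc0 : 0 ≤ c) (hc : ∀ y ∈ D.outcomes, |g y| ≤ c) (t : ℝ) :
    |D.localMean (fun _ => 1) g (x, π x + t) + D.localMean (fun _ => 1) g (x, π x - t)
        - 2 * D.condMean g (x, π x) - t ^ 2 * D.curvature π g x| ≤
      (2 * (L * c * volume.real D.outcomes) +
        (4 * c / r ^ 2 + L * c * volume.real D.outcomes) / r) * (t ^ 2 * min |t| 1) := by
  set V := L * c * volume.real D.outcomes with hV
  have hV0 : 0 ≤ V := by positivity
  rcases lt_or_ge |t| r with ht | ht
  · have m1 : π x + t ∈ Metric.ball (π x) r := by simpa [Real.dist_eq] using ht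
    have m2 : π x - t ∈ Metric.ball (π x) r := by simpa [Real.dist_eq] using ht
    rw [D.localMean_of_mem _ _ (hx.ball_subset m1), D.localMean_of_mem _ _ (hx.ball_subset m2),
      one_mul, one_mul, min_eq_left (ht.le.trans hr1)]
    refine (hx.abs_condMean_second_difference_le hr hg hc ht).trans ?_
    have h1 : |t| ^ 3 = t ^ 2 * |t| := by rw [← sq_abs t]; ring
    rw [h1]
    have h2 : 0 ≤ (4 * c / r ^ 2 + V) / r := by positivity
    have h3 : 0 ≤ t ^ 2 * |t| := by positivity
    calc 2 * L * c * volume.real D.outcomes * (t ^ 2 * |t|) = 2 * V * (t ^ 2 * |t|) := by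
          rw [hV]; ring
      _ ≤ _ := by gcongr; linarith
  · have hone : ∀ z : EuclideanSpace ℝ (Fin d) × ℝ, |(fun _ => (1 : ℝ)) z| ≤ 1 := by simp
    have b1 := hx.abs_localMean_le hc0 hc hone (π x + t)
    have b2 := hx.abs_localMean_le hc0 hc hone (π x - t)
    have b0 := hx.abs_condMean_le hc (hx.ball_subset (Metric.mem_ball_self hr))
    have b3 := hx.abs_curvature_le hr hc
    rw [← hV] at b3
    have ht2 : r ^ 2 ≤ t ^ 2 := by rw [← sq_abs t]; gcongr
    have hmin : r ≤ min |t| 1 := le_min ht hr1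
    have b4 : |t ^ 2 * D.curvature π g x| ≤ t ^ 2 * V := by
      rw [abs_mul, abs_of_nonneg (sq_nonneg t)]; gcongr
    have h1 : 4 * c ≤ 4 * c / r ^ 2 * t ^ 2 := by
      rw [div_mul_eq_mul_div, le_div_iff₀ (by positivity)]
      gcongr
    calc _ ≤ 4 * c + t ^ 2 * V := by
          rw [_root_.abs_le] at *
          constructor <;> linarith [b1.1, b1.2, b2.1, b2.2, b0.1, b0.2, b4.1, b4.2]
      _ ≤ (4 * c / r ^ 2 + V) * t ^ 2 := by linarith
      _ = (4 * c / r ^ 2 + V) / r * (t ^ 2 * r) := by field_simp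
      _ ≤ (4 * c / r ^ 2 + V) / r * (t ^ 2 * min |t| 1) := by gcongr
      _ ≤ _ := by gcongr; linarith

lemma aestronglyMeasurable_curvature (hr : 0 < r)
    (hreg : ∀ᵐ x ∂(D.P₀.map D.X), D.RegularAt π r L ε x) (hπ : Measurable π)
    (hg : Measurable g) (hc : ∀ y ∈ D.outcomes, |g y| ≤ c) :
    AEStronglyMeasurable (D.curvature π g) (D.P₀.map D.X) := by
  let t : ℕ → ℝ := fun n => 1 / ((n : ℝ) + 1)
  have ht : Tendsto t atTop (𝓝 0) := tendsto_one_div_add_atTop_nhds_zero_nat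
  have ht0 : ∀ n, 0 < t n := fun n => Nat.one_div_pos_of_nat
  have hm := D.measurable_condMean hg
  refine (aemeasurable_of_tendsto_metrizable_ae atTop
    (f := fun n x => (D.condMean g (x, π x + t n) + D.condMean g (x, π x - t n)
      - 2 * D.condMean g (x, π x)) / t n ^ 2) (fun n => ?_) ?_).aestronglyMeasurable
  · have h1 : Measurable fun x => D.condMean g (x, π x + t n) :=
      hm.comp (measurable_id.prodMk (hπ.add_const _))
    have h2 : Measurable fun x => D.condMean g (x, π x - t n) :=
      hm.comp (measurable_id.prodMk (hπ.sub_const _))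
    have h3 : Measurable fun x => D.condMean g (x, π x) := hm.comp (measurable_id.prodMk hπ)
    exact (((h1.add h2).sub (h3.const_mul 2)).div_const _).aemeasurable
  · filter_upwards [hreg] with x hx
    rw [tendsto_iff_norm_sub_tendsto_zero]
    have hlim : Tendsto (fun n => 2 * L * c * volume.real D.outcomes * t n) atTop (𝓝 0) := by
      simpa using ht.const_mul (2 * L * c * volume.real D.outcomes)
    refine squeeze_zero' (Eventually.of_forall fun _ => norm_nonneg _) ?_ hlim
    filter_upwards [ht.eventually (gt_mem_nhds hr)] with n hn
    have h := hx.abs_condMean_second_difference_le hr hg hc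
      (t := t n) (by rwa [abs_of_pos (ht0 n)])
    rw [abs_of_pos (ht0 n)] at h
    have h3 : (D.condMean g (x, π x + t n) + D.condMean g (x, π x - t n)
        - 2 * D.condMean g (x, π x)) / t n ^ 2 - D.curvature π g x =
        (D.condMean g (x, π x + t n) + D.condMean g (x, π x - t n)
        - 2 * D.condMean g (x, π x) - t n ^ 2 * D.curvature π g x) / t n ^ 2 := by
      have := (ht0 n).ne'
      field_simp
    rw [h3, Real.norm_eq_abs, abs_div, abs_of_pos (pow_pos (ht0 n) 2),
      div_le_iff₀ (pow_pos (ht0 n) 2)]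
    calc _ ≤ 2 * L * c * volume.real D.outcomes * t n ^ 3 := h
      _ = _ := by ring

/-- **Bias expansion**: the mean of the kernel-weighted outcomes is the policy mean plus
`h² / 2 ∫ u² K(u) du` times the mean curvature, up to `o(h²)`. -/
theorem tendsto_bias (hK : IsSecondOrderKernel K) (hcons : D.Consistency)
    (hr : 0 < r) (hr1 : r ≤ 1) (hL : 0 ≤ L) (hε : 0 < ε)
    (hreg : ∀ᵐ x ∂(D.P₀.map D.X), D.RegularAt π r L ε x) (hπ : Measurable π)
    (hg : Measurable g) (hc : ∀ y ∈ D.outcomes, |g y| ≤ c) :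
    Tendsto (fun h : ℝ => ((∫ z, D.weight K π h z * g z.2.2 ∂D.obsLaw)
        - ∫ x, D.condMean g (x, π x) ∂(D.P₀.map D.X)) / h ^ 2) (𝓝[>] 0)
      (𝓝 ((∫ u, u ^ 2 * K u) / 2 * ∫ x, D.curvature π g x ∂(D.P₀.map D.X))) := by
  wlog hc0 : 0 ≤ c generalizing c
  · exact this (c := max c 0) (fun y hy => (hc y hy).trans (le_max_left _ _)) (le_max_right _ _)
  set V := L * c * volume.real D.outcomes with hV
  set C := 2 * V + (4 * c / r ^ 2 + V) / r with hC
  set κ := ∫ u, u ^ 2 * K u with hκ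
  set m : EuclideanSpace ℝ (Fin d) × ℝ → ℝ := D.localMean (fun _ => 1) g with hm
  have hmm : Measurable m := D.measurable_localMean measurable_const hg
  have hcm : Measurable fun x => D.condMean g (x, π x) :=
    (D.measurable_condMean hg).comp (measurable_id.prodMk hπ)
  have hone : ∀ z : EuclideanSpace ℝ (Fin d) × ℝ, |(fun _ => (1 : ℝ)) z| ≤ 1 := by simp
  have hKi := hK.integrable
  have hKm := hK.measurable
  have icm : Integrable (fun x => D.condMean g (x, π x)) (D.P₀.map D.X) := by
    refine Integrable.of_bound hcm.aestronglyMeasurable c ?_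
    filter_upwards [hreg] with x hx
    exact hx.abs_condMean_le hc (hx.ball_subset (Metric.mem_ball_self hr))
  have icv : Integrable (D.curvature π g) (D.P₀.map D.X) := by
    refine Integrable.of_bound (aestronglyMeasurable_curvature hr hreg hπ hg hc) V ?_
    filter_upwards [hreg] with x hx using hx.abs_curvature_le hr hc
  have hbound : ∀ h : ℝ, 0 < h →
      |((∫ z, D.weight K π h z * g z.2.2 ∂D.obsLaw)
        - ∫ x, D.condMean g (x, π x) ∂(D.P₀.map D.X)) / h ^ 2
        - κ / 2 * ∫ x, D.curvature π g x ∂(D.P₀.map D.X)| ≤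
      C / 2 * ∫ u, u ^ 2 * K u * min (h * |u|) 1 := by
    intro h hh
    have iKm : ∀ x, D.RegularAt π r L ε x → ∀ s : ℝ,
        Integrable fun u => K u * m (x, π x + s * u) := by
      intro x hx s
      have h1 : Measurable fun u : ℝ => m (x, π x + s * u) := hmm.comp (by fun_prop)
      refine hKi.mul_bdd (c := 1 * c) h1.aestronglyMeasurable (Eventually.of_forall fun u => ?_)
      exact hx.abs_localMean_le hc0 hc hone _
    have itr : Integrable fun u => u ^ 2 * K u * min (h * |u|) 1 := by
      refine hK.second_moment.mul_bdd (c := 1)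
        (Measurable.aestronglyMeasurable (by fun_prop)) (Eventually.of_forall fun u => ?_)
      rw [Real.norm_eq_abs, abs_of_nonneg (le_min (by positivity) zero_le_one)]
      exact min_le_right _ _
    -- the odd part of the expansion in `h u` integrates to zero by the symmetry of `K`
    have hpt : ∀ x, D.RegularAt π r L ε x →
        |(∫ u, K u * m (x, π x - h * u)) - D.condMean g (x, π x)
          - h ^ 2 * (κ / 2) * D.curvature π g x| ≤
        C / 2 * h ^ 2 * ∫ u, u ^ 2 * K u * min (h * |u|) 1 := by
      intro x hx
      have i1 : Integrable fun u => K u * m (x, π x - h * u) := by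
        simpa [sub_eq_add_neg] using iKm x hx (-h)
      have i2 := iKm x hx h
      have hsymm : ∫ u, K u * m (x, π x - h * u) = ∫ u, K u * m (x, π x + h * u) := by
        rw [← integral_neg_eq_self]
        refine integral_congr_ae (Eventually.of_forall fun u => ?_)
        simp only [hK.symm]
        congr 3; ring
      have i3 : Integrable fun u => K u * m (x, π x + h * u) + K u * m (x, π x - h * u) :=
        i2.add i1
      have i4 : Integrable fun u => K u * (2 * D.condMean g (x, π x)) := hKi.mul_const _
      have i5 : Integrable fun u => u ^ 2 * K u * (h ^ 2 * D.curvature π g x) :=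
        hK.second_moment.mul_const _
      have i34 : Integrable fun u => K u * m (x, π x + h * u) + K u * m (x, π x - h * u)
        - K u * (2 * D.condMean g (x, π x)) := i3.sub i4
      have heq : (∫ u, K u * m (x, π x - h * u)) - D.condMean g (x, π x)
          - h ^ 2 * (κ / 2) * D.curvature π g x =
          (∫ u, (K u * m (x, π x + h * u) + K u * m (x, π x - h * u)
            - K u * (2 * D.condMean g (x, π x))
            - u ^ 2 * K u * (h ^ 2 * D.curvature π g x))) / 2 := by
        rw [integral_sub i34 i5, integral_sub i3 i4, integral_add i2 i1, integral_mul_const,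
          integral_mul_const, hK.integral_one, ← hsymm, ← hκ]
        ring
      rw [heq, abs_div, abs_two, div_le_iff₀ two_pos]
      calc |∫ u, (K u * m (x, π x + h * u) + K u * m (x, π x - h * u)
            - K u * (2 * D.condMean g (x, π x))
            - u ^ 2 * K u * (h ^ 2 * D.curvature π g x))|
          ≤ ∫ u, C * h ^ 2 * (u ^ 2 * K u * min (h * |u|) 1) := by
            rw [← Real.norm_eq_abs]
            refine norm_integral_le_of_norm_le (itr.const_mul _) (Eventually.of_forall fun u => ?_)
            have h1 := hx.abs_localMean_second_difference_le hr hr1 hL hg hc0 hc (h * u)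
            rw [← hV, ← hC, ← hm, abs_mul, abs_of_pos hh] at h1
            have h2 : K u * m (x, π x + h * u) + K u * m (x, π x - h * u)
              - K u * (2 * D.condMean g (x, π x)) - u ^ 2 * K u * (h ^ 2 * D.curvature π g x) =
              K u * (m (x, π x + h * u) + m (x, π x - h * u) - 2 * D.condMean g (x, π x)
                - (h * u) ^ 2 * D.curvature π g x) := by ring
            rw [h2, Real.norm_eq_abs, abs_mul, abs_of_nonneg (hK.nonneg u)]
            calc _ ≤ K u * (C * ((h * u) ^ 2 * min (h * |u|) 1)) := by
                  have := hK.nonneg u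
                  gcongr
              _ = _ := by ring
        _ = C / 2 * h ^ 2 * (∫ u, u ^ 2 * K u * min (h * |u|) 1) * 2 := by
            rw [integral_const_mul]; ring
    have iJ : Integrable (fun x => ∫ u, K u * m (x, π x - h * u)) (D.P₀.map D.X) := by
      refine Integrable.of_bound (C := c) ?_ ?_
      · have h1 : Measurable fun p : EuclideanSpace ℝ (Fin d) × ℝ =>
            K p.2 * m (p.1, π p.1 - h * p.2) := by
          have : Measurable fun p : EuclideanSpace ℝ (Fin d) × ℝ => m (p.1, π p.1 - h * p.2) :=
            hmm.comp (by fun_prop)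
          fun_prop
        exact h1.stronglyMeasurable.integral_prod_right'.aestronglyMeasurable
      · filter_upwards [hreg] with x hx
        calc ‖∫ u, K u * m (x, π x - h * u)‖ ≤ ∫ u, K u * c := by
              refine norm_integral_le_of_norm_le (hKi.mul_const c)
                (Eventually.of_forall fun u => ?_)
              rw [norm_mul, Real.norm_eq_abs, Real.norm_eq_abs, abs_of_nonneg (hK.nonneg u)]
              have h1 := hx.abs_localMean_le hc0 hc hone (π x - h * u)
              rw [one_mul] at h1
              exact mul_le_mul_of_nonneg_left h1 (hK.nonneg u)
          _ = c := by rw [integral_mul_const, hK.integral_one, one_mul]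
    rw [integral_weight_mul hK hcons hε hreg hπ hg hc hh]
    have i6 : Integrable (fun x => (∫ u, K u * m (x, π x - h * u)) - D.condMean g (x, π x))
      (D.P₀.map D.X) := iJ.sub icm
    have heq : ((∫ x, (∫ u, K u * m (x, π x - h * u)) ∂(D.P₀.map D.X))
        - ∫ x, D.condMean g (x, π x) ∂(D.P₀.map D.X)) / h ^ 2
        - κ / 2 * ∫ x, D.curvature π g x ∂(D.P₀.map D.X) =
        (∫ x, ((∫ u, K u * m (x, π x - h * u)) - D.condMean g (x, π x)
          - h ^ 2 * (κ / 2) * D.curvature π g x) ∂(D.P₀.map D.X)) / h ^ 2 := by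
      rw [integral_sub i6 (icv.const_mul _), integral_sub iJ icm, integral_const_mul]
      field_simp
    rw [heq, abs_div, abs_of_pos (pow_pos hh 2), div_le_iff₀ (pow_pos hh 2)]
    have h1 := norm_integral_le_of_norm_le_const (μ := D.P₀.map D.X)
      (f := fun x => (∫ u, K u * m (x, π x - h * u)) - D.condMean g (x, π x)
          - h ^ 2 * (κ / 2) * D.curvature π g x) (hreg.mono fun x hx => hpt x hx)
    rw [Real.norm_eq_abs, probReal_univ, mul_one] at h1
    refine h1.trans (le_of_eq ?_)
    ring
  rw [tendsto_iff_norm_sub_tendsto_zero]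
  have hlim := hK.tendsto_truncated_moment.const_mul (C / 2)
  rw [mul_zero] at hlim
  refine squeeze_zero' (Eventually.of_forall fun _ => norm_nonneg _) ?_ hlim
  filter_upwards [self_mem_nhdsWithin] with h (hh : 0 < h) using hbound h hh

/-- **Variance asymptotics** of the kernel-weighted outcomes. -/
theorem tendsto_second_moment (hK : IsSecondOrderKernel K) (hcons : D.Consistency)
    (hr : 0 < r) (hε : 0 < ε)
    (hreg : ∀ᵐ x ∂(D.P₀.map D.X), D.RegularAt π r L ε x) (hπ : Measurable π)
    (hg : Measurable g) (hc : ∀ y ∈ D.outcomes, |g y| ≤ c) :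
    Tendsto (fun h : ℝ => h * ∫ z, D.weight K π h z ^ 2 * g z.2.2 ∂D.obsLaw) (𝓝[>] 0)
      (𝓝 ((∫ u, K u ^ 2) * ∫ x, D.condMean g (x, π x) / D.fA (π x) x ∂(D.P₀.map D.X))) := by
  wlog hc0 : 0 ≤ c generalizing c
  · exact this (c := max c 0) (fun y hy => (hc y hy).trans (le_max_left _ _)) (le_max_right _ _)
  -- one of the two inverse densities in the squared weight survives; truncated at the positivity
  -- bound, it is bounded everywhere
  set q : EuclideanSpace ℝ (Fin d) × ℝ → ℝ := fun z => (max (D.fA z.2 z.1) ε)⁻¹ with hq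
  have hfA : Measurable fun z : EuclideanSpace ℝ (Fin d) × ℝ => D.fA z.2 z.1 :=
    D.measurable_fA.comp measurable_swap
  have hqm : Measurable q := by fun_prop
  have hqb : ∀ z, |q z| ≤ ε⁻¹ := fun z => by
    have : 0 < max (D.fA z.2 z.1) ε := hε.trans_le (le_max_right _ _)
    rw [hq, abs_of_pos (inv_pos.2 this)]
    exact inv_anti₀ hε (le_max_right _ _)
  set m := D.localMean q g with hm
  have hmm : Measurable m := D.measurable_localMean hqm hg
  have hKm := hK.measurable
  have hcont : ∀ x, D.RegularAt π r L ε x →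
      Tendsto (fun a => m (x, a)) (𝓝 (π x)) (𝓝 (D.condMean g (x, π x) / D.fA (π x) x)) := by
    intro x hx
    have hp := Metric.mem_ball_self (x := π x) hr
    have h1 : Tendsto (fun a => D.condMean g (x, a)) (𝓝 (π x)) (𝓝 (D.condMean g (x, π x))) := by
      rw [tendsto_iff_norm_sub_tendsto_zero]
      have hlim : Tendsto (fun a => L * c * volume.real D.outcomes * |a - π x|) (𝓝 (π x))
          (𝓝 0) := by
        have : Continuous fun a => L * c * volume.real D.outcomes * |a - π x| := by fun_prop
        simpa using this.tendsto (π x)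
      refine squeeze_zero' (Eventually.of_forall fun _ => norm_nonneg _) ?_ hlim
      filter_upwards [Metric.ball_mem_nhds (π x) hr] with a ha
      exact hx.abs_condMean_sub_le hr hg hc ha
    have h2 : Tendsto (fun a => q (x, a)) (𝓝 (π x)) (𝓝 ((D.fA (π x) x)⁻¹)) := by
      have h3 : ContinuousAt (fun a => D.fA a x) (π x) :=
        (hx.smooth_fA.differentiableAt hp).continuousAt
      have h4 : Tendsto (fun a => (max (D.fA a x) ε)⁻¹) (𝓝 (π x))
          (𝓝 ((max (D.fA (π x) x) ε)⁻¹)) :=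
        (h3.max (continuousAt_const (y := ε))).inv₀ (hε.trans_le (le_max_right _ _)).ne'
      rwa [max_eq_left (hx.le_fA _ hp)] at h4
    have h5 := h2.mul h1
    rw [inv_mul_eq_div] at h5
    refine h5.congr' ?_
    filter_upwards [Metric.ball_mem_nhds (π x) hr] with a ha
    rw [hm, D.localMean_of_mem q g (hx.ball_subset ha)]
  have hmain : Tendsto (fun h : ℝ => ∫ x, (∫ u, K u ^ 2 * m (x, π x - h * u)) ∂(D.P₀.map D.X))
      (𝓝[>] 0) (𝓝 (∫ x, (∫ u, K u ^ 2 * (D.condMean g (x, π x) / D.fA (π x) x))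
        ∂(D.P₀.map D.X))) := by
    have hb : ∀ x, D.RegularAt π r L ε x → ∀ (h u : ℝ),
        ‖K u ^ 2 * m (x, π x - h * u)‖ ≤ K u ^ 2 * (ε⁻¹ * c) := by
      intro x hx h u
      rw [norm_mul, Real.norm_eq_abs, Real.norm_eq_abs, abs_of_nonneg (sq_nonneg (K u))]
      exact mul_le_mul_of_nonneg_left (hx.abs_localMean_le hc0 hc hqb _) (sq_nonneg _)
    refine tendsto_integral_filter_of_dominated_convergence
      (fun _ => ∫ u, K u ^ 2 * (ε⁻¹ * c)) (Eventually.of_forall fun h => ?_)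
      (Eventually.of_forall fun h => ?_) (integrable_const _) ?_
    · have h1 : Measurable fun p : EuclideanSpace ℝ (Fin d) × ℝ =>
          K p.2 ^ 2 * m (p.1, π p.1 - h * p.2) := by
        have : Measurable fun p : EuclideanSpace ℝ (Fin d) × ℝ => m (p.1, π p.1 - h * p.2) :=
          hmm.comp (by fun_prop)
        fun_prop
      exact h1.stronglyMeasurable.integral_prod_right'.aestronglyMeasurable
    · filter_upwards [hreg] with x hx
      exact norm_integral_le_of_norm_le (hK.integrable_sq.mul_const _)
        (Eventually.of_forall fun u => hb x hx h u)
    · filter_upwards [hreg] with x hx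
      refine tendsto_integral_filter_of_dominated_convergence (fun u => K u ^ 2 * (ε⁻¹ * c))
        (Eventually.of_forall fun h => ?_)
        (Eventually.of_forall fun h => Eventually.of_forall fun u => hb x hx h u)
        (hK.integrable_sq.mul_const _) (Eventually.of_forall fun u => ?_)
      · have : Measurable fun u : ℝ => m (x, π x - h * u) := hmm.comp (by fun_prop)
        exact Measurable.aestronglyMeasurable (by fun_prop)
      · have h1 : Tendsto (fun h : ℝ => π x - h * u) (𝓝[>] 0) (𝓝 (π x)) := by
          have : Continuous fun h : ℝ => π x - h * u := by fun_prop
          simpa using (this.tendsto 0).mono_left nhdsWithin_le_nhds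
        exact ((hcont x hx).comp h1).const_mul _
  simp only [integral_mul_const, integral_const_mul] at hmain
  refine hmain.congr' ?_
  filter_upwards [self_mem_nhdsWithin] with h (hh : 0 < h)
  rw [integral_weight_sq_mul hK hcons hε hreg hπ hg hc hh]

end Limits

end Population

/-! ### The bias and variance constants -/

namespace Population

variable {Ω : Type*} [MeasurableSpace Ω] {d : ℕ} {D : Population Ω d}
  {π : EuclideanSpace ℝ (Fin d) → ℝ} {r L ε c : ℝ} {g : ℝ → ℝ}

lemma policyMean_eq {G : ℝ → EuclideanSpace ℝ (Fin d) → ℝ} {F : EuclideanSpace ℝ (Fin d) → ℝ}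
    (hF : AEStronglyMeasurable F (D.P₀.map D.X))
    (h : ∀ᵐ x ∂(D.P₀.map D.X), ∫ ω', G (D.Y ω') x ∂(D.cond (x, π x)) = F x) :
    D.policyMean π G = ∫ x, F x ∂(D.P₀.map D.X) := by
  have h' : (fun x => ∫ ω', G (D.Y ω') x ∂(D.cond (x, π x))) =ᵐ[D.P₀.map D.X] F := h
  rw [policyMean, ← integral_congr_ae h',
    integral_map D.measurable_X.aemeasurable (hF.congr h'.symm)]

lemma integral_cond_eq_condMean (hg : Measurable g) (z : EuclideanSpace ℝ (Fin d) × ℝ) :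
    ∫ ω, g (D.Y ω) ∂(D.cond z) = D.condMean g z := by
  rw [condMean, condY_apply, integral_map D.measurable_Y.aemeasurable hg.aestronglyMeasurable]

lemma bias_eq (hr : 0 < r) (hreg : ∀ᵐ x ∂(D.P₀.map D.X), D.RegularAt π r L ε x)
    (hscore : D.ScoreWellDefined π) (hπ : Measurable π) (K : ℝ → ℝ) {α : ℝ} (hα : 0 < α) :
    D.bias K π α = (∫ u, u ^ 2 * K u) / 2 *
      ∫ x, D.curvature π (fun y => Real.exp (-y / α)) x ∂(D.P₀.map D.X) := by
  have hg : Measurable fun y : ℝ => Real.exp (-y / α) := by fun_prop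
  obtain ⟨M, -, hM⟩ := D.exists_bound
  have hc : ∀ y ∈ D.outcomes, |Real.exp (-y / α)| ≤ 1 := fun y hy => by
    rw [abs_of_pos (Real.exp_pos _), Real.exp_le_one_iff]
    exact div_nonpos_of_nonpos_of_nonneg (by linarith [(hM hy).1]) hα.le
  rw [bias, policyMean_eq (aestronglyMeasurable_curvature hr hreg hπ hg hc)]
  filter_upwards [hreg, hscore] with x hx hsc
  have hmem : π x ∈ D.actions := hx.ball_subset (Metric.mem_ball_self hr)
  have hae : AEMeasurable (fun y => Real.exp (-y / α) * (D.fYaa y (π x) x / D.fY y (π x) x))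
      (D.condY (x, π x)) := by
    rw [hx.condY_eq _ hmem]
    refine AEMeasurable.mono_ac ?_ (withDensity_absolutelyContinuous _ _)
    exact hg.aemeasurable.mul
      ((hx.aemeasurable_fYaa hr).div (D.measurable_fY_left _ _).aemeasurable)
  have h1 := integral_map D.measurable_Y.aemeasurable
    (by rw [← D.condY_apply]; exact hae.aestronglyMeasurable)
  rw [← h1, ← D.condY_apply, hx.integral_condY hmem, curvature]
  refine integral_congr_ae ?_
  filter_upwards [hsc] with y hy
  by_cases h0 : D.fY y (π x) x = 0
  · rw [h0, hy h0]; simp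
  · field_simp

lemma RegularAt.integrable_condY {x : EuclideanSpace ℝ (Fin d)} (hx : D.RegularAt π r L ε x)
    {a : ℝ} (ha : a ∈ D.actions) (hg : Measurable g) (hc : ∀ y ∈ D.outcomes, |g y| ≤ c) :
    Integrable g (D.condY (x, a)) := by
  refine Integrable.of_bound hg.aestronglyMeasurable c ?_
  filter_upwards [hx.ae_mem_outcomes ha] with y hy using hc y hy

/-- The variance constant is a weighted second moment of `exp(-Y / α) - W(α)`. -/
lemma variance_eq (hr : 0 < r) (hε : 0 < ε)
    (hreg : ∀ᵐ x ∂(D.P₀.map D.X), D.RegularAt π r L ε x) (hπ : Measurable π)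
    (K : ℝ → ℝ) {α : ℝ} (hα : 0 < α) :
    D.variance K π α = (∫ u, K u ^ 2) *
      ∫ x, D.condMean (fun y => (Real.exp (-y / α) - D.W π α) ^ 2) (x, π x) / D.fA (π x) x
        ∂(D.P₀.map D.X) := by
  set w := D.W π α with hw
  have hg1 : Measurable fun y : ℝ => Real.exp (-y / α) := by fun_prop
  have hg2 : Measurable fun y : ℝ => Real.exp (-(2 * y) / α) := by fun_prop
  obtain ⟨M, -, hM⟩ := D.exists_bound
  have hc1 : ∀ y ∈ D.outcomes, |Real.exp (-y / α)| ≤ 1 := fun y hy => by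
    rw [abs_of_pos (Real.exp_pos _), Real.exp_le_one_iff]
    exact div_nonpos_of_nonpos_of_nonneg (by linarith [(hM hy).1]) hα.le
  have hc2 : ∀ y ∈ D.outcomes, |Real.exp (-(2 * y) / α)| ≤ 1 := fun y hy => by
    rw [abs_of_pos (Real.exp_pos _), Real.exp_le_one_iff]
    exact div_nonpos_of_nonpos_of_nonneg (by linarith [(hM hy).1]) hα.le
  have hfA : Measurable fun x => D.fA (π x) x := D.measurable_fA.comp (hπ.prodMk measurable_id)
  have hpair : Measurable fun x => (x, π x) := measurable_id.prodMk hπ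
  have hm1 : Measurable fun x => D.condMean (fun y => Real.exp (-y / α)) (x, π x) / D.fA (π x) x :=
    ((D.measurable_condMean hg1).comp hpair).div hfA
  have hm2 : Measurable fun x =>
      D.condMean (fun y => Real.exp (-(2 * y) / α)) (x, π x) / D.fA (π x) x :=
    ((D.measurable_condMean hg2).comp hpair).div hfA
  have hmem : ∀ x, D.RegularAt π r L ε x → π x ∈ D.actions := fun x hx =>
    hx.ball_subset (Metric.mem_ball_self hr)
  have hle : ∀ x, D.RegularAt π r L ε x → ε ≤ D.fA (π x) x := fun x hx =>
    hx.le_fA _ (Metric.mem_ball_self hr)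
  have e1 : D.policyMean π (fun y x => Real.exp (-y / α) / D.fA (π x) x) =
      ∫ x, D.condMean (fun y => Real.exp (-y / α)) (x, π x) / D.fA (π x) x ∂(D.P₀.map D.X) := by
    refine policyMean_eq hm1.aestronglyMeasurable (Eventually.of_forall fun x => ?_)
    rw [integral_div, integral_cond_eq_condMean hg1]
  have e2 : D.policyMean π (fun y x => Real.exp (-(2 * y) / α) / D.fA (π x) x) =
      ∫ x, D.condMean (fun y => Real.exp (-(2 * y) / α)) (x, π x) / D.fA (π x) x
        ∂(D.P₀.map D.X) := by
    refine policyMean_eq hm2.aestronglyMeasurable (Eventually.of_forall fun x => ?_)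
    rw [integral_div, integral_cond_eq_condMean hg2]
  have e0 : ∫ ω, 1 / D.fA (π (D.X ω)) (D.X ω) ∂D.P₀ =
      ∫ x, 1 / D.fA (π x) x ∂(D.P₀.map D.X) := by
    have hm0 : Measurable fun x => 1 / D.fA (π x) x := measurable_const.div hfA
    rw [integral_map D.measurable_X.aemeasurable hm0.aestronglyMeasurable]
  have hbd : ∀ x, D.RegularAt π r L ε x → ∀ s : ℝ, |s| ≤ 1 → ‖s / D.fA (π x) x‖ ≤ 1 / ε := by
    intro x hx s hs
    rw [norm_div, Real.norm_eq_abs, Real.norm_eq_abs, abs_of_pos (hε.trans_le (hle x hx))]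
    have := hle x hx
    gcongr
  have i1 : Integrable (fun x => D.condMean (fun y => Real.exp (-y / α)) (x, π x) /
      D.fA (π x) x) (D.P₀.map D.X) :=
    Integrable.of_bound hm1.aestronglyMeasurable (1 / ε)
      (hreg.mono fun x hx => hbd x hx _ (hx.abs_condMean_le hc1 (hmem x hx)))
  have i2 : Integrable (fun x => D.condMean (fun y => Real.exp (-(2 * y) / α)) (x, π x) /
      D.fA (π x) x) (D.P₀.map D.X) :=
    Integrable.of_bound hm2.aestronglyMeasurable (1 / ε)
      (hreg.mono fun x hx => hbd x hx _ (hx.abs_condMean_le hc2 (hmem x hx)))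
  have i0 : Integrable (fun x => 1 / D.fA (π x) x) (D.P₀.map D.X) :=
    Integrable.of_bound (measurable_const.div hfA).aestronglyMeasurable (1 / ε)
      (hreg.mono fun x hx => hbd x hx 1 (by simp))
  have i20 : Integrable (fun x => D.condMean (fun y => Real.exp (-(2 * y) / α)) (x, π x) /
      D.fA (π x) x + 1 / D.fA (π x) x * w ^ 2) (D.P₀.map D.X) := i2.add (i0.mul_const _)
  rw [variance, e0, e1, e2, ← hw, mul_right_comm 2]
  congr 1
  rw [← integral_mul_const, ← integral_add i2 (i0.mul_const _), ← integral_const_mul,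
    ← integral_sub i20 (i1.const_mul _)]
  refine integral_congr_ae ?_
  filter_upwards [hreg] with x hx
  have j1 := hx.integrable_condY (hmem x hx) hg1 hc1
  have j2 := hx.integrable_condY (hmem x hx) hg2 hc2
  have j3 : Integrable (fun y => Real.exp (-(2 * y) / α) - 2 * w * Real.exp (-y / α))
    (D.condY (x, π x)) := j2.sub (j1.const_mul _)
  have hexp : ∀ y : ℝ, (Real.exp (-y / α) - w) ^ 2 =
      Real.exp (-(2 * y) / α) - 2 * w * Real.exp (-y / α) + w ^ 2 := by
    intro y
    have : Real.exp (-(2 * y) / α) = Real.exp (-y / α) ^ 2 := by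
      rw [← Real.exp_nat_mul]; congr 1; push_cast; ring
    rw [this]; ring
  have hcm : D.condMean (fun y => (Real.exp (-y / α) - w) ^ 2) (x, π x) =
      D.condMean (fun y => Real.exp (-(2 * y) / α)) (x, π x)
        - 2 * w * D.condMean (fun y => Real.exp (-y / α)) (x, π x) + w ^ 2 := by
    simp only [condMean, hexp]
    rw [integral_add j3 (integrable_const _), integral_sub j2 (j1.const_mul _),
      integral_const_mul]
    simp
  rw [hcm]
  ring

lemma variance_nonneg (hr : 0 < r) (hε : 0 < ε)
    (hreg : ∀ᵐ x ∂(D.P₀.map D.X), D.RegularAt π r L ε x) (hπ : Measurable π)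
    (K : ℝ → ℝ) {α : ℝ} (hα : 0 < α) : 0 ≤ D.variance K π α := by
  rw [variance_eq hr hε hreg hπ K hα]
  refine mul_nonneg (integral_nonneg fun u => sq_nonneg _) (integral_nonneg_of_ae ?_)
  filter_upwards [hreg] with x hx
  exact div_nonneg (integral_nonneg fun y => sq_nonneg _)
    (hε.le.trans (hx.le_fA _ (Metric.mem_ball_self hr)))

/-- The conditional densities of `Y` integrate to one, so their total curvature vanishes. -/
lemma RegularAt.curvature_one {x : EuclideanSpace ℝ (Fin d)} (hx : D.RegularAt π r L ε x)
    (hr : 0 < r) : D.curvature π (fun _ => 1) x = 0 := by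
  have hb : ∀ t, 0 < t → t < r →
      |D.curvature π (fun _ => 1) x| ≤ 2 * L * 1 * volume.real D.outcomes * t := by
    intro t ht htr
    have h := hx.abs_condMean_second_difference_le hr (g := fun _ => 1) measurable_const
      (c := 1) (by simp) (t := t) (by rwa [abs_of_pos ht])
    have h1 : ∀ z, D.condMean (fun _ => 1) z = 1 := fun z => by simp [condMean]
    rw [h1, h1, h1, abs_of_pos ht] at h
    have h2 : (1 : ℝ) + 1 - 2 * 1 - t ^ 2 * D.curvature π (fun _ => 1) x =
      -(t ^ 2 * D.curvature π (fun _ => 1) x) := by ring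
    rw [h2, abs_neg, abs_mul, abs_of_pos (pow_pos ht 2)] at h
    refine le_of_mul_le_mul_left (h.trans (le_of_eq ?_)) (pow_pos ht 2)
    ring
  have hlim : Tendsto (fun t : ℝ => 2 * L * 1 * volume.real D.outcomes * t) (𝓝[>] 0) (𝓝 0) := by
    have : Continuous fun t : ℝ => 2 * L * 1 * volume.real D.outcomes * t := by fun_prop
    simpa using (this.tendsto 0).mono_left nhdsWithin_le_nhds
  refine abs_nonpos_iff.1 (ge_of_tendsto hlim ?_)
  filter_upwards [self_mem_nhdsWithin, (gt_mem_nhds hr).filter_mono nhdsWithin_le_nhds]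
    with t ht htr using hb t ht htr

lemma RegularAt.curvature_sub_const {x : EuclideanSpace ℝ (Fin d)} (hx : D.RegularAt π r L ε x)
    (hr : 0 < r) (hg : Measurable g) (hc : ∀ y ∈ D.outcomes, |g y| ≤ c) (w : ℝ) :
    D.curvature π (fun y => g y - w) x = D.curvature π g x := by
  have h1 := hx.curvature_one hr
  have i1 := hx.integrable_fYaa_mul hr hg hc
  have i2 := hx.integrable_fYaa_mul hr (g := fun _ => 1) measurable_const (c := 1) (by simp)
  have h2 : D.curvature π (fun y => g y - w) x =
      D.curvature π g x - w * D.curvature π (fun _ => 1) x := by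
    rw [curvature, curvature, curvature, ← integral_const_mul, ← integral_sub i1 (i2.const_mul w)]
    refine integral_congr_ae (Eventually.of_forall fun y => ?_)
    simp only; ring
  rw [h2, h1]; ring

end Population

/-! ### Weighted empirical measures -/

section Empirical

/-- Ratios of weighted sums are moments of the weighted empirical measure. -/
lemma exists_weightedEmpirical {N : ℕ} {w y : ℕ → ℝ} {M : ℝ}
    (hw : ∀ i, 0 ≤ w i) (hy : ∀ i, y i ∈ Set.Icc 0 M)
    (hS : ∑ i ∈ Finset.range N, w i ≠ 0) :
    ∃ μ : Measure ℝ, IsProbabilityMeasure μ ∧ (∀ᵐ t ∂μ, id t ∈ Set.Icc 0 M) ∧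
      ∀ f : ℝ → ℝ, ∫ t, f t ∂μ = (∑ i ∈ Finset.range N, w i * f (y i)) /
        ∑ i ∈ Finset.range N, w i := by
  set S := ∑ i ∈ Finset.range N, w i with hSdef
  have hS0 : 0 < S := lt_of_le_of_ne (Finset.sum_nonneg fun i _ => hw i) hS.symm
  let μ : Measure ℝ := ∑ i ∈ Finset.range N, ENNReal.ofReal (w i / S) • Measure.dirac (y i)
  have hint : ∀ f : ℝ → ℝ, ∫ t, f t ∂μ = (∑ i ∈ Finset.range N, w i * f (y i)) / S := by
    intro f
    rw [integral_finsetSum_measure]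
    · rw [Finset.sum_div]
      refine Finset.sum_congr rfl fun i _ => ?_
      rw [integral_smul_measure, integral_dirac, ENNReal.toReal_ofReal
        (div_nonneg (hw i) hS0.le), smul_eq_mul]
      ring
    · intro i _
      exact (integrable_dirac (by simp)).smul_measure ENNReal.ofReal_ne_top
  refine ⟨μ, ⟨?_⟩, ?_, hint⟩
  · have h1 : μ Set.univ = ∑ i ∈ Finset.range N, ENNReal.ofReal (w i / S) := by
      simp [μ, Measure.finsetSum_apply]
    rw [h1, ← ENNReal.ofReal_sum_of_nonneg fun i _ => div_nonneg (hw i) hS0.le,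
      ← Finset.sum_div, ← hSdef, div_self hS, ENNReal.ofReal_one]
  · rw [ae_iff]
    simp only [μ, Measure.finsetSum_apply, Measure.smul_apply, smul_eq_mul]
    refine Finset.sum_eq_zero fun i _ => ?_
    have hm : MeasurableSet {t : ℝ | ¬ id t ∈ Set.Icc 0 M} := measurableSet_Icc.compl
    rw [Measure.dirac_apply' _ hm, Set.indicator_of_notMem (by simpa using hy i), mul_zero]

lemma dualObjective_congr_log {W W' : ℝ → ℝ} (η : ℝ)
    (h : ∀ α, Real.log (W α) = Real.log (W' α)) :
    dualObjective W η = dualObjective W' η := by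
  funext α
  unfold dualObjective
  simp only [h]

end Empirical

namespace Population

variable {Ω : Type*} [MeasurableSpace Ω] {d : ℕ} {D : Population Ω d}
  {π : EuclideanSpace ℝ (Fin d) → ℝ}

/-- The kernel-weighted mean `N⁻¹ ∑ᵢ wᵢ g(Yᵢ)`. -/
def kernelMean (D : Population Ω d) (K : ℝ → ℝ) (π : EuclideanSpace ℝ (Fin d) → ℝ) (h : ℝ) (N : ℕ)
    (z : ℕ → EuclideanSpace ℝ (Fin d) × ℝ × ℝ) (g : ℝ → ℝ) : ℝ :=
  1 / (N : ℝ) * ∑ i ∈ Finset.range N, D.weight K π h (z i) * g (z i).2.2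

lemma normalizer_eq (K : ℝ → ℝ) (h : ℝ) (N : ℕ)
    (z : ℕ → EuclideanSpace ℝ (Fin d) × ℝ × ℝ) :
    D.normalizer K π h N z = D.kernelMean K π h N z (fun _ => 1) := by
  simp [normalizer, kernelMean]

lemma Wbar_eq (K : ℝ → ℝ) (h : ℝ) (N : ℕ)
    (z : ℕ → EuclideanSpace ℝ (Fin d) × ℝ × ℝ) (α : ℝ) :
    D.Wbar K π h N z α = D.kernelMean K π h N z (fun y => Real.exp (-y / α)) := rfl

/-- The normalized estimator `Ŵ` is the exponential moment of a probability measure on `[0, M]`;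
in the degenerate case of a vanishing normalization the logarithm cannot tell its junk value `0`
from the moments, all equal to `1`, of the point mass at `0`. -/
lemma exists_empirical {K : ℝ → ℝ} {h : ℝ} {N : ℕ}
    {z : ℕ → EuclideanSpace ℝ (Fin d) × ℝ × ℝ} {M : ℝ} (hM : 0 ≤ M)
    (hw : ∀ i, 0 ≤ D.weight K π h (z i)) (hy : ∀ i, (z i).2.2 ∈ Set.Icc 0 M) :
    ∃ μ : Measure ℝ, IsProbabilityMeasure μ ∧ (∀ᵐ t ∂μ, id t ∈ Set.Icc 0 M) ∧
      (∀ η, dualObjective (D.What K π h N z) η = dualObjective (expMoment μ id) η) ∧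
      (D.normalizer K π h N z ≠ 0 → ∀ f : ℝ → ℝ, ∫ t, f t ∂μ =
        D.kernelMean K π h N z f / D.normalizer K π h N z) := by
  by_cases hS : D.normalizer K π h N z = 0
  · refine ⟨Measure.dirac 0, inferInstance, ?_, fun η => dualObjective_congr_log η fun α => ?_,
      fun h => absurd hS h⟩
    · have hm : MeasurableSet {t : ℝ | id t ∈ Set.Icc 0 M} := measurableSet_Icc
      rw [ae_dirac_iff hm]
      simpa using hM
    · rw [What, hS, div_zero, expMoment, integral_dirac]
      simp
  · have hN : (N : ℝ) ≠ 0 := by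
      intro h0
      rw [normalizer, h0] at hS
      simp at hS
    have hsum : ∑ i ∈ Finset.range N, D.weight K π h (z i) ≠ 0 := by
      intro h0
      rw [normalizer, h0, mul_zero] at hS
      exact hS rfl
    obtain ⟨μ, h1, h2, h3⟩ := exists_weightedEmpirical hw hy hsum
    have h4 : ∀ f : ℝ → ℝ, ∫ t, f t ∂μ =
        D.kernelMean K π h N z f / D.normalizer K π h N z := by
      intro f
      rw [h3, kernelMean, normalizer, mul_div_mul_left _ _ (one_div_ne_zero hN)]
    refine ⟨μ, h1, h2, fun η => dualObjective_congr_log η fun α => ?_, fun _ => h4⟩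
    rw [What, Wbar_eq, ← h4]
    rfl

lemma Qhat_eq_iSup {K : ℝ → ℝ} {h η : ℝ} (hη : 0 ≤ η) {N : ℕ}
    {z : ℕ → EuclideanSpace ℝ (Fin d) × ℝ × ℝ} {M : ℝ} (hM : 0 ≤ M)
    (hw : ∀ i, 0 ≤ D.weight K π h (z i)) (hy : ∀ i, (z i).2.2 ∈ Set.Icc 0 M) :
    D.Qhat K π η h N z = ⨆ q : {q : ℚ // 0 < q},
      (-((q : ℚ) : ℝ) * Real.log (D.What K π h N z ((q : ℚ) : ℝ)) - ((q : ℚ) : ℝ) * η) := by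
  obtain ⟨μ, hμ, h1, h2, -⟩ := exists_empirical (N := N) hM hw hy
  have h3 : D.Qhat K π η h N z = dualValue (expMoment μ id) η := by
    rw [Qhat, dualValue, dualValue, h2]
  rw [h3, dualValue_eq_iSup aemeasurable_id h1 hη]
  congr 1
  funext q
  rw [← h2, dualObjective_of_pos (by exact_mod_cast q.2)]

end Population

/-! ### Asymptotics of the kernel-weighted sample means -/

section StochasticOrder

variable {Ω' : Type*} [MeasurableSpace Ω'] {Pr : Measure Ω'}

lemma BoundedInProb.tendsto_of_isLittleO {X Y : ℕ × Ω' → ℝ} (hX : BoundedInProb Pr X)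
    (h : Y =o[inProb Pr] X) : Tendsto Y (inProb Pr) (𝓝 0) := by
  refine (hX.mul_tendsto_zero h.tendsto_div_nhds_zero).congr' ?_
  filter_upwards [h.bound one_pos] with z hz
  by_cases h0 : X z = 0
  · simp only [h0, norm_zero, mul_zero, norm_le_zero_iff] at hz
    simp [h0, hz]
  · field_simp

lemma BoundedInProb.prodMk {E F : Type*} [NormedAddCommGroup E] [NormedAddCommGroup F]
    {G : ℕ → ℝ} {X : ℕ × Ω' → E} {Y : ℕ × Ω' → F} {x : E} {y : F}
    (hX : BoundedInProb Pr (fun z => G z.1 * ‖X z - x‖))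
    (hY : BoundedInProb Pr (fun z => G z.1 * ‖Y z - y‖)) :
    BoundedInProb Pr (fun z => G z.1 * ‖(X z, Y z) - (x, y)‖) := by
  refine (hX.add hY).of_isBigO (Asymptotics.IsBigO.of_bound 1 (Eventually.of_forall fun z => ?_))
  have h1 := norm_nonneg (X z - x)
  have h2 := norm_nonneg (Y z - y)
  rw [one_mul, ← mul_add, norm_mul, norm_mul, Prod.mk_sub_mk, Prod.norm_mk,
    Real.norm_of_nonneg (h1.trans (le_max_left _ _)), Real.norm_of_nonneg (add_nonneg h1 h2)]
  gcongr
  exact max_le (by linarith) (by linarith)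

lemma BoundedInProb.mul_norm {G : ℕ → ℝ} {X : ℕ × Ω' → ℝ} {x : ℝ}
    (hX : BoundedInProb Pr (fun z => G z.1 * (X z - x))) :
    BoundedInProb Pr (fun z => G z.1 * ‖X z - x‖) :=
  hX.of_isBigO (Asymptotics.IsBigO.of_bound 1 (Eventually.of_forall fun z => by
    rw [one_mul, norm_mul, norm_mul, norm_norm]))

end StochasticOrder

namespace Population

section Sample

variable {Ω : Type*} [MeasurableSpace Ω] {d : ℕ} {D : Population Ω d}
  {π : EuclideanSpace ℝ (Fin d) → ℝ} {r L ε c : ℝ} {g : ℝ → ℝ} {K : ℝ → ℝ}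
  {Ω' : Type*} [MeasurableSpace Ω'] {Pr : Measure Ω'}
  {Z : ℕ → Ω' → EuclideanSpace ℝ (Fin d) × ℝ × ℝ}

lemma IsIIDSample.map_eq (hZ : D.IsIIDSample Pr Z) (i : ℕ) : Pr.map (Z i) = D.obsLaw :=
  (hZ.2 i).map_eq

lemma IsIIDSample.aemeasurable (hZ : D.IsIIDSample Pr Z) (i : ℕ) : AEMeasurable (Z i) Pr :=
  (hZ.2 i).aemeasurable_fst

lemma IsIIDSample.identDistrib (hZ : D.IsIIDSample Pr Z) (i j : ℕ) :
    IdentDistrib (Z i) (Z j) Pr Pr :=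
  (hZ.2 i).trans (hZ.2 j).symm

lemma IsIIDSample.integral_eq (hZ : D.IsIIDSample Pr Z)
    {f : EuclideanSpace ℝ (Fin d) × ℝ × ℝ → ℝ} (hf : Measurable f) (i : ℕ) :
    ∫ ω, f (Z i ω) ∂Pr = ∫ z, f z ∂D.obsLaw := by
  rw [← hZ.map_eq i, integral_map (hZ.aemeasurable i) hf.aestronglyMeasurable]

lemma IsIIDSample.ae (hZ : D.IsIIDSample Pr Z)
    {p : EuclideanSpace ℝ (Fin d) × ℝ × ℝ → Prop} (h : ∀ᵐ z ∂D.obsLaw, p z) :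
    ∀ᵐ ω ∂Pr, ∀ i, p (Z i ω) :=
  ae_all_iff.2 fun i => ae_of_ae_map (hZ.aemeasurable i) (by rw [hZ.map_eq]; exact h)

lemma IsIIDSample.ae_regular (hZ : D.IsIIDSample Pr Z) (hcons : D.Consistency)
    (hK : IsSecondOrderKernel K) (π : EuclideanSpace ℝ (Fin d) → ℝ) {h : ℝ} (hh : 0 < h) :
    ∀ᵐ ω ∂Pr, ∀ i, 0 ≤ D.weight K π h (Z i ω) ∧ (Z i ω).2.2 ∈ D.outcomes := by
  refine hZ.ae (p := fun z => 0 ≤ D.weight K π h z ∧ z.2.2 ∈ D.outcomes) ?_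
  filter_upwards [obsLaw_ae_mem_outcomes hcons, obsLaw_ae_fA_nonneg] with z h1 h2
  refine ⟨div_nonneg (mul_nonneg (one_div_nonneg.2 hh.le) (hK.nonneg _)) h2, h1⟩

lemma IsIIDSample.aemeasurable_kernelMean (hZ : D.IsIIDSample Pr Z) (hK : Measurable K)
    (hπ : Measurable π) (hg : Measurable g) (h : ℝ) (N : ℕ) :
    AEMeasurable (fun ω => D.kernelMean K π h N (fun i => Z i ω) g) Pr := by
  have hw := D.measurable_weight hK hπ h
  unfold kernelMean
  refine AEMeasurable.const_mul (Finset.aemeasurable_fun_sum _ fun i _ => ?_) _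
  have h1 : Measurable fun z => D.weight K π h z * g z.2.2 := by fun_prop
  exact h1.comp_aemeasurable (hZ.aemeasurable i)

variable [IsProbabilityMeasure Pr]

/-- The variance of a kernel-weighted sample mean is at most `1 / N` times the second moment of a
summand. -/
lemma IsIIDSample.integral_sq_kernelMean_sub_le (hZ : D.IsIIDSample Pr Z)
    (hK : IsSecondOrderKernel K) (hcons : D.Consistency) (hε : 0 < ε)
    (hreg : ∀ᵐ x ∂(D.P₀.map D.X), D.RegularAt π r L ε x) (hπ : Measurable π)
    (hg : Measurable g) (hc : ∀ y ∈ D.outcomes, |g y| ≤ c) {h : ℝ} (hh : 0 < h)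
    {N : ℕ} (hN : 0 < N) :
    Integrable (fun ω => (D.kernelMean K π h N (fun i => Z i ω) g
      - ∫ z, D.weight K π h z * g z.2.2 ∂D.obsLaw) ^ 2) Pr ∧
    ∫ ω, (D.kernelMean K π h N (fun i => Z i ω) g
      - ∫ z, D.weight K π h z * g z.2.2 ∂D.obsLaw) ^ 2 ∂Pr ≤
      1 / (N : ℝ) * ∫ z, D.weight K π h z ^ 2 * g z.2.2 ^ 2 ∂D.obsLaw := by
  obtain ⟨B, hB⟩ := hK.bounded
  have hB0 : 0 ≤ B := (abs_nonneg _).trans (hB 0)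
  have hN0 : (N : ℝ) ≠ 0 := by exact_mod_cast hN.ne'
  have hw := D.measurable_weight hK.measurable hπ h
  let f : EuclideanSpace ℝ (Fin d) × ℝ × ℝ → ℝ := fun z => D.weight K π h z * g z.2.2
  have hf : Measurable f := by fun_prop
  have hfb : ∀ᵐ ω ∂Pr, ∀ i, ‖f (Z i ω)‖ ≤ B / (h * ε) * c := by
    refine hZ.ae (p := fun z => ‖f z‖ ≤ B / (h * ε) * c) ?_
    filter_upwards [obsLaw_ae_le_fA hreg, obsLaw_ae_mem_outcomes hcons] with z h1 h2
    rw [norm_mul, Real.norm_eq_abs, Real.norm_eq_abs]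
    have h3 := abs_weight_le (π := π) hB hε hh h1
    have h4 := hc _ h2
    gcongr
  have hmem : ∀ i, MemLp (fun ω => f (Z i ω)) 2 Pr := fun i =>
    MemLp.of_bound (hf.comp_aemeasurable (hZ.aemeasurable i)).aestronglyMeasurable _
      (hfb.mono fun ω hω => hω i)
  have hsum : MemLp (fun ω => ∑ i ∈ Finset.range N, f (Z i ω)) 2 Pr :=
    memLp_finsetSum _ fun i _ => hmem i
  have hT : MemLp (fun ω => D.kernelMean K π h N (fun i => Z i ω) g) 2 Pr := hsum.const_mul _
  have hmean : ∫ ω, D.kernelMean K π h N (fun i => Z i ω) g ∂Pr = ∫ z, f z ∂D.obsLaw := by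
    unfold kernelMean
    rw [integral_const_mul, integral_finsetSum _ fun i _ => (hmem i).integrable one_le_two]
    rw [Finset.sum_congr rfl fun i _ => hZ.integral_eq hf i]
    simp only [Finset.sum_const, Finset.card_range, nsmul_eq_mul, f]
    field_simp
  refine ⟨(hT.sub (memLp_const _)).integrable_sq, ?_⟩
  have hvar : Var[fun ω => D.kernelMean K π h N (fun i => Z i ω) g; Pr] =
      (1 / (N : ℝ)) ^ 2 * ∑ i ∈ Finset.range N, Var[fun ω => f (Z i ω); Pr] := by
    have h1 := IndepFun.variance_sum (μ := Pr) (X := fun i ω => f (Z i ω))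
      (s := Finset.range N) (fun i _ => hmem i) (fun i _ j _ hij =>
        (hZ.1.indepFun hij).comp hf hf)
    rw [← h1, ← variance_const_mul]
    congr 1
    funext ω
    simp [kernelMean, f]
  have hvi : ∀ i, Var[fun ω => f (Z i ω); Pr] ≤
      ∫ z, D.weight K π h z ^ 2 * g z.2.2 ^ 2 ∂D.obsLaw := by
    intro i
    refine (variance_le_expectation_sq (hmem i).1).trans (le_of_eq ?_)
    have := hZ.integral_eq (f := fun z => D.weight K π h z ^ 2 * g z.2.2 ^ 2) (by fun_prop) i
    rw [← this]
    refine integral_congr_ae (Eventually.of_forall fun ω => ?_)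
    simp [f, mul_pow]
  have hve := variance_eq_integral hT.1.aemeasurable
  rw [hmean] at hve
  change _ = ∫ ω, (D.kernelMean K π h N (fun i => Z i ω) g -
    ∫ z, D.weight K π h z * g z.2.2 ∂D.obsLaw) ^ 2 ∂Pr at hve
  rw [← hve, hvar]
  calc _ ≤ (1 / (N : ℝ)) ^ 2 * ∑ _i ∈ Finset.range N,
        ∫ z, D.weight K π h z ^ 2 * g z.2.2 ^ 2 ∂D.obsLaw := by
        gcongr; exact hvi _
    _ = _ := by
        simp only [Finset.sum_const, Finset.card_range, nsmul_eq_mul]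
        field_simp

variable {h : ℕ → ℝ}

lemma sqrt_mul_sq_eq {N : ℕ} {t : ℝ} (ht : 0 < t) :
    Real.sqrt (N * t) * t ^ 2 = Real.sqrt (N * t ^ 5) := by
  have : (N : ℝ) * t ^ 5 = N * t * (t ^ 2) ^ 2 := by ring
  rw [this, Real.sqrt_mul (x := N * t) (by positivity), Real.sqrt_sq (by positivity)]

/-- Kernel-weighted sample means estimate the policy means at the rate `√(N h)`. -/
theorem IsIIDSample.boundedInProb_kernelMean (hZ : D.IsIIDSample Pr Z)
    (hK : IsSecondOrderKernel K) (hcons : D.Consistency)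
    (hr : 0 < r) (hr1 : r ≤ 1) (hL : 0 ≤ L) (hε : 0 < ε)
    (hreg : ∀ᵐ x ∂(D.P₀.map D.X), D.RegularAt π r L ε x) (hπ : Measurable π)
    (h_pos : ∀ N, 0 < h N) (h_zero : Tendsto h atTop (𝓝 0))
    {C : ℝ} (hNh5 : Tendsto (fun N : ℕ => (N : ℝ) * h N ^ 5) atTop (𝓝 C))
    (hg : Measurable g) (hc : ∀ y ∈ D.outcomes, |g y| ≤ c) :
    BoundedInProb Pr (fun p : ℕ × Ω' => Real.sqrt (p.1 * h p.1) *
      (D.kernelMean K π (h p.1) p.1 (fun i => Z i p.2) g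
        - ∫ x, D.condMean g (x, π x) ∂(D.P₀.map D.X))) := by
  have hh : Tendsto h atTop (𝓝[>] 0) :=
    tendsto_nhdsWithin_iff.2 ⟨h_zero, Eventually.of_forall h_pos⟩
  set m := ∫ x, D.condMean g (x, π x) ∂(D.P₀.map D.X) with hm
  let e : ℕ → ℝ := fun N => ∫ z, D.weight K π (h N) z * g z.2.2 ∂D.obsLaw
  have hb := (tendsto_bias hK hcons hr hr1 hL hε hreg hπ hg hc).comp hh
  have hg2 : ∀ y ∈ D.outcomes, |g y ^ 2| ≤ c ^ 2 := fun y hy => by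
    rw [abs_pow]; have := hc y hy; gcongr
  have hv := (tendsto_second_moment hK hcons hr hε hreg hπ (hg.pow_const 2) hg2).comp hh
  obtain ⟨Cv, hCv⟩ := hv.isBoundedUnder_le
  rw [eventually_map] at hCv
  have hdet : Tendsto (fun N : ℕ => Real.sqrt (N * h N) * (e N - m)) atTop
      (𝓝 (Real.sqrt C * ((∫ u, u ^ 2 * K u) / 2 *
        ∫ x, D.curvature π g x ∂(D.P₀.map D.X)))) := by
    refine ((Real.continuous_sqrt.tendsto C).comp hNh5 |>.mul hb).congr fun N => ?_
    simp only [Function.comp_apply]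
    have := (h_pos N).ne'
    rw [← sqrt_mul_sq_eq (h_pos N)]
    field_simp
    rfl
  have h1 : BoundedInProb Pr (fun p : ℕ × Ω' => Real.sqrt (p.1 * h p.1) *
      (D.kernelMean K π (h p.1) p.1 (fun i => Z i p.2) g - e p.1)) := by
    refine BoundedInProb.of_integral_sq (C := Cv) ?_ ?_
    · filter_upwards [eventually_gt_atTop 0] with N hN
      have := (hZ.integral_sq_kernelMean_sub_le hK hcons hε hreg hπ hg hc (h_pos N) hN).1
      simpa only [mul_pow] using this.const_mul _
    · filter_upwards [eventually_gt_atTop 0, hCv] with N hN h2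
      have h3 := (hZ.integral_sq_kernelMean_sub_le hK hcons hε hreg hπ hg hc (h_pos N) hN).2
      have hN0 : (0 : ℝ) < N := by exact_mod_cast hN
      have hp := h_pos N
      simp only [mul_pow]
      rw [integral_const_mul, Real.sq_sqrt (by positivity)]
      calc _ ≤ (N : ℝ) * h N * (1 / (N : ℝ) *
            ∫ z, D.weight K π (h N) z ^ 2 * g z.2.2 ^ 2 ∂D.obsLaw) := by gcongr
        _ = h N * ∫ z, D.weight K π (h N) z ^ 2 * g z.2.2 ^ 2 ∂D.obsLaw := by field_simp
        _ ≤ Cv := h2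
  obtain ⟨Cd, hCd⟩ := hdet.abs.isBoundedUnder_le
  rw [eventually_map] at hCd
  have h2 : BoundedInProb Pr (fun p : ℕ × Ω' => Real.sqrt (p.1 * h p.1) * (e p.1 - m)) :=
    BoundedInProb.of_bounded (x := fun N : ℕ => Real.sqrt (N * h N) * (e N - m))
      (fun _ => rfl) hCd
  refine (h1.add h2).of_isBigO (Asymptotics.IsBigO.of_bound 1 (Eventually.of_forall fun p => ?_))
  rw [one_mul]
  refine le_of_eq (congrArg _ ?_)
  ring

/-- Asymptotic normality of the kernel-weighted sample means, centered at their means, for a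
function `g` whose policy mean vanishes. -/
theorem IsIIDSample.tendstoInDistribution_kernelMean (hZ : D.IsIIDSample Pr Z)
    (hK : IsSecondOrderKernel K) (hcons : D.Consistency)
    (hr : 0 < r) (hr1 : r ≤ 1) (hL : 0 ≤ L) (hε : 0 < ε)
    (hreg : ∀ᵐ x ∂(D.P₀.map D.X), D.RegularAt π r L ε x) (hπ : Measurable π)
    (h_pos : ∀ N, 0 < h N) (h_zero : Tendsto h atTop (𝓝 0))
    (hNh : Tendsto (fun N : ℕ => (N : ℝ) * h N) atTop atTop)
    (hg : Measurable g) (hc : ∀ y ∈ D.outcomes, |g y| ≤ c)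
    (hg0 : ∫ x, D.condMean g (x, π x) ∂(D.P₀.map D.X) = 0) (s : ℝ) {v : ℝ}
    (hv : v = s ^ 2 * ((∫ u, K u ^ 2) *
      ∫ x, D.condMean (fun y => g y ^ 2) (x, π x) / D.fA (π x) x ∂(D.P₀.map D.X)))
    (hv0 : 0 ≤ v) :
    TendstoInDistribution (fun (N : ℕ) (ω : Ω') => s * (Real.sqrt (N * h N) *
      (D.kernelMean K π (h N) N (fun i => Z i ω) g
        - ∫ z, D.weight K π (h N) z * g z.2.2 ∂D.obsLaw))) atTop (fun x : ℝ => x)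
      (fun _ => Pr) (gaussianReal 0 v.toNNReal) := by
  have hh : Tendsto h atTop (𝓝[>] 0) :=
    tendsto_nhdsWithin_iff.2 ⟨h_zero, Eventually.of_forall h_pos⟩
  obtain ⟨B, hB⟩ := hK.bounded
  have hB0 : 0 ≤ B := (abs_nonneg _).trans (hB 0)
  let e : ℕ → ℝ := fun N => ∫ z, D.weight K π (h N) z * g z.2.2 ∂D.obsLaw
  let f : ℕ → EuclideanSpace ℝ (Fin d) × ℝ × ℝ → ℝ := fun N z =>
    s * (Real.sqrt (h N) * (D.weight K π (h N) z * g z.2.2 - e N))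
  have hw : ∀ N, Measurable (D.weight K π (h N)) := fun N =>
    D.measurable_weight hK.measurable hπ (h N)
  have hf : ∀ N, Measurable (f N) := fun N => by
    have := hw N
    fun_prop
  have hbw : ∀ N, ∀ᵐ z ∂D.obsLaw, |D.weight K π (h N) z * g z.2.2| ≤ B / (h N * ε) * c := by
    intro N
    filter_upwards [obsLaw_ae_le_fA hreg, obsLaw_ae_mem_outcomes hcons] with z h1 h2
    rw [abs_mul]
    have h3 := abs_weight_le (π := π) hB hε (h_pos N) h1
    have h4 := hc _ h2
    have : 0 < h N := h_pos N
    gcongr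
  have hbe : ∀ N, |e N| ≤ B / (h N * ε) * c := by
    intro N
    have := norm_integral_le_of_norm_le_const (μ := D.obsLaw)
      (f := fun z => D.weight K π (h N) z * g z.2.2)
      (by simpa only [Real.norm_eq_abs] using hbw N)
    simpa using this
  have iw : ∀ N, Integrable (fun z => D.weight K π (h N) z * g z.2.2) D.obsLaw := fun N => by
    simpa using integrable_weight_pow_mul hK hcons hε hreg hπ hg hc (h_pos N) 1
  have hg2 : ∀ y ∈ D.outcomes, |g y ^ 2| ≤ c ^ 2 := fun y hy => by
    rw [abs_pow]; have := hc y hy; gcongr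
  have iw2 : ∀ N, Integrable (fun z => D.weight K π (h N) z ^ 2 * g z.2.2 ^ 2) D.obsLaw :=
    fun N => integrable_weight_pow_mul hK hcons hε hreg hπ (hg.pow_const 2) hg2 (h_pos N) 2
  have hclt := tendstoInDistribution_triangular (Pr := Pr) hZ.1 (fun i => hZ.identDistrib i 0)
    hf (c := fun N => |s| * (Real.sqrt (h N) * (2 * (B / (h N * ε) * c)))) ?_ ?_ ?_ hv0 ?_
  · refine hclt.congr (fun N => Eventually.of_forall fun ω => ?_) (Eventually.of_forall fun _ => rfl)
    simp only [f]
    rcases Nat.eq_zero_or_pos N with rfl | hN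
    · simp
    have hN0 : (0 : ℝ) < N := by exact_mod_cast hN
    have hsq : (0 : ℝ) < Real.sqrt N := Real.sqrt_pos.2 hN0
    rw [← Finset.mul_sum, ← Finset.mul_sum, Finset.sum_sub_distrib, Finset.sum_const,
      Finset.card_range, nsmul_eq_mul, Real.sqrt_mul hN0.le, kernelMean]
    have h5 : (N : ℝ) = Real.sqrt N * Real.sqrt N := (Real.mul_self_sqrt hN0.le).symm
    set S := ∑ i ∈ Finset.range N, D.weight K π (h N) (Z i ω) * g (Z i ω).2.2
    change (Real.sqrt N)⁻¹ * (s * (Real.sqrt (h N) * (S - N * e N))) =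
      s * (Real.sqrt N * Real.sqrt (h N) * (1 / (N : ℝ) * S - e N))
    have h6 : 1 / (N : ℝ) * S - e N = 1 / (N : ℝ) * (S - N * e N) := by field_simp
    have h7 : (Real.sqrt N)⁻¹ = Real.sqrt N * (1 / (N : ℝ)) := by
      rw [eq_comm, mul_one_div, div_eq_iff hN0.ne']
      nth_rewrite 3 [h5]
      field_simp
    rw [h6, h7]; ring
  · intro N
    refine (hZ.ae (p := fun z => |f N z| ≤ _) ?_).mono fun ω hω => hω 0
    filter_upwards [hbw N] with z hz
    simp only [f]
    rw [abs_mul, abs_mul, abs_of_nonneg (Real.sqrt_nonneg _)]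
    have := (abs_sub (D.weight K π (h N) z * g z.2.2) (e N)).trans (add_le_add hz (hbe N))
    rw [← two_mul] at this
    gcongr
  · have hG : Tendsto (fun N : ℕ => (Real.sqrt (N * h N))⁻¹) atTop (𝓝 0) :=
      tendsto_inv_atTop_zero.comp (Real.tendsto_sqrt_atTop.comp hNh)
    have := hG.const_mul (|s| * (2 * (B / ε * c)))
    rw [mul_zero] at this
    refine this.congr fun N => ?_
    have hp := h_pos N
    have hs : 0 < Real.sqrt (h N) := Real.sqrt_pos.2 hp
    rw [Real.sqrt_mul (by positivity), mul_inv]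
    have h5 : h N = Real.sqrt (h N) * Real.sqrt (h N) := (Real.mul_self_sqrt hp.le).symm
    have h6 : B / (h N * ε) = B / ε * ((Real.sqrt (h N))⁻¹ * (Real.sqrt (h N))⁻¹) := by
      nth_rewrite 1 [h5]
      field_simp
    rw [h6]
    field_simp
  · intro N
    rw [hZ.integral_eq (hf N) 0]
    simp only [f]
    rw [integral_const_mul, integral_const_mul, integral_sub (iw N) (integrable_const _)]
    simp [e]
  · have he : Tendsto e atTop (𝓝 0) := by
      have hb := (tendsto_bias hK hcons hr hr1 hL hε hreg hπ hg hc).comp hh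
      have h1 := (h_zero.pow 2).mul hb
      rw [hg0] at h1
      simp only [ne_eq, OfNat.ofNat_ne_zero, not_false_eq_true, zero_pow, zero_mul] at h1
      refine h1.congr fun N => ?_
      have := (h_pos N).ne'
      simp only [Function.comp_apply, sub_zero, e]
      field_simp
    have hv2 := (tendsto_second_moment hK hcons hr hε hreg hπ (hg.pow_const 2) hg2).comp hh
    have h1 := (hv2.sub (h_zero.mul (he.pow 2))).const_mul (s ^ 2)
    rw [zero_mul, sub_zero, ← hv] at h1
    refine h1.congr fun N => ?_
    have hint := hZ.integral_eq (f := fun z => f N z ^ 2) ((hf N).pow_const 2) 0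
    rw [hint]
    have h2 : ∀ z, f N z ^ 2 = s ^ 2 * (h N * (D.weight K π (h N) z ^ 2 * g z.2.2 ^ 2
        - 2 * e N * (D.weight K π (h N) z * g z.2.2) + e N ^ 2)) := by
      intro z
      simp only [f]
      rw [mul_pow, mul_pow, Real.sq_sqrt (h_pos N).le]
      ring
    have i3 : Integrable (fun z => D.weight K π (h N) z ^ 2 * g z.2.2 ^ 2
        - 2 * e N * (D.weight K π (h N) z * g z.2.2)) D.obsLaw :=
      (iw2 N).sub ((iw N).const_mul _)
    simp only [h2]
    rw [integral_const_mul, integral_const_mul, integral_add i3 (integrable_const _),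
      integral_sub (iw2 N) ((iw N).const_mul _), integral_const_mul]
    simp only [integral_const, probReal_univ, smul_eq_mul, one_mul, Function.comp_apply]
    change _ = s ^ 2 * (h N * (_ - 2 * e N * e N + e N ^ 2))
    ring

end Sample

end Population

/-! ### The estimated dual value and its asymptotic distribution -/

/-- The derivative of the dual objective at `α`, for moments `v = (s, w, e)` given up to
normalization by the total mass `s`. -/
def momentSlope (η α : ℝ) (v : ℝ × ℝ × ℝ) : ℝ := dualSlope η α (v.2.1 / v.1) (v.2.2 / v.1)

/-- The dual objective at `α`, for moments `v = (s, w, e)` given up to normalization by the total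
mass `s`. -/
def momentValue (η α : ℝ) (v : ℝ × ℝ × ℝ) : ℝ := -α * (Real.log v.2.1 - Real.log v.1) - α * η

lemma differentiableAt_momentSlope (η : ℝ) {α : ℝ} (hα : 0 < α) {v : ℝ × ℝ × ℝ} (h1 : v.1 ≠ 0)
    (h2 : v.2.1 ≠ 0) : DifferentiableAt ℝ (momentSlope η α) v := by
  have d1 : DifferentiableAt ℝ (fun v : ℝ × ℝ × ℝ => v.2.1 * v.1⁻¹) v :=
    DifferentiableAt.mul (by fun_prop) (DifferentiableAt.inv (by fun_prop) h1)
  have d2 : DifferentiableAt ℝ (fun v : ℝ × ℝ × ℝ => v.2.2 * v.1⁻¹) v :=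
    DifferentiableAt.mul (by fun_prop) (DifferentiableAt.inv (by fun_prop) h1)
  have h3 : v.2.1 * v.1⁻¹ ≠ 0 := mul_ne_zero h2 (inv_ne_zero h1)
  unfold momentSlope dualSlope
  simp only [div_eq_mul_inv]
  exact ((d1.log h3).neg.sub
    (d2.mul ((d1.const_mul α).inv (mul_ne_zero hα.ne' h3)))).sub_const η

lemma hasFDerivAt_momentValue (η α : ℝ) {v : ℝ × ℝ × ℝ} (h1 : v.1 ≠ 0) (h2 : v.2.1 ≠ 0) :
    HasFDerivAt (momentValue η α)
      ((-α) • (v.2.1⁻¹ • (ContinuousLinearMap.fst ℝ ℝ ℝ).comp (ContinuousLinearMap.snd ℝ ℝ (ℝ × ℝ))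
        - v.1⁻¹ • ContinuousLinearMap.fst ℝ ℝ (ℝ × ℝ))) v := by
  have d1 : HasFDerivAt (fun v : ℝ × ℝ × ℝ => v.1) (ContinuousLinearMap.fst ℝ ℝ (ℝ × ℝ)) v :=
    hasFDerivAt_fst
  have d2 : HasFDerivAt (fun v : ℝ × ℝ × ℝ => v.2.1)
      ((ContinuousLinearMap.fst ℝ ℝ ℝ).comp (ContinuousLinearMap.snd ℝ ℝ (ℝ × ℝ))) v :=
    ((ContinuousLinearMap.fst ℝ ℝ ℝ).comp (ContinuousLinearMap.snd ℝ ℝ (ℝ × ℝ))).hasFDerivAt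
  exact (((d2.log h2).sub (d1.log h1)).const_mul (-α)).sub_const (α * η)

namespace Population

variable {Ω : Type*} [MeasurableSpace Ω] {d : ℕ} {D : Population Ω d}
  {π : EuclideanSpace ℝ (Fin d) → ℝ} {K : ℝ → ℝ} {η : ℝ}

/-- The total mass and the (unnormalized) exponential and tilted moments of the weighted
sample. -/
def sampleMoments (D : Population Ω d) (K : ℝ → ℝ) (π : EuclideanSpace ℝ (Fin d) → ℝ) (h : ℝ)
    (N : ℕ) (z : ℕ → EuclideanSpace ℝ (Fin d) × ℝ × ℝ) (α : ℝ) : ℝ × ℝ × ℝ :=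
  (D.kernelMean K π h N z (fun _ => 1), D.kernelMean K π h N z (fun y => Real.exp (-y / α)),
    D.kernelMean K π h N z (fun y => y * Real.exp (-y / α)))

/-- The total mass and the exponential and tilted moments of `Y(π(X))`. -/
def policyMoments (D : Population Ω d) (π : EuclideanSpace ℝ (Fin d) → ℝ) (α : ℝ) : ℝ × ℝ × ℝ :=
  (1, D.W π α, tiltMoment D.P₀ (D.policyOutcome π) α)

lemma ae_policyOutcome_mem_Icc (hπ_int : D.InteriorPolicy π) {M : ℝ}
    (hM : D.outcomes ⊆ Set.Icc 0 M) : ∀ᵐ ω ∂D.P₀, D.policyOutcome π ω ∈ Set.Icc 0 M :=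
  (D.policyOutcome_mem hπ_int).mono fun _ hω => hM hω

lemma integral_policyOutcome_of_bounded (hcons : D.Consistency) (hunconf : D.Unconfoundedness)
    (hπ : Measurable π) (hπ_int : D.InteriorPolicy π) {g : ℝ → ℝ} (hg : Measurable g) {c : ℝ}
    (hc : ∀ y ∈ D.outcomes, |g y| ≤ c) :
    Integrable (fun ω => g (D.policyOutcome π ω)) D.P₀ ∧
      ∫ ω, g (D.policyOutcome π ω) ∂D.P₀ = ∫ x, D.condMean g (x, π x) ∂(D.P₀.map D.X) := by
  have hint : Integrable (fun ω => g (D.policyOutcome π ω)) D.P₀ :=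
    Integrable.of_bound (hg.comp (D.measurable_policyOutcome hπ)).aestronglyMeasurable c
      ((D.policyOutcome_mem hπ_int).mono fun _ hω => hc _ hω)
  exact ⟨hint, D.integral_policyOutcome hcons hunconf hπ hπ_int hg hint⟩

lemma abs_exp_neg_div_le_one {α y : ℝ} (hα : 0 < α) (hy : 0 ≤ y) : |Real.exp (-y / α)| ≤ 1 := by
  rw [abs_of_pos (Real.exp_pos _), Real.exp_le_one_iff]
  exact div_nonpos_of_nonpos_of_nonneg (by linarith) hα.le

variable {Ω' : Type*} [MeasurableSpace Ω'] {Pr : Measure Ω'}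
  {Z : ℕ → Ω' → EuclideanSpace ℝ (Fin d) × ℝ × ℝ} {G h : ℕ → ℝ}

lemma boundedInProb_sampleMoments (hcons : D.Consistency) (hunconf : D.Unconfoundedness)
    (hπ : Measurable π) (hπ_int : D.InteriorPolicy π)
    (hb : ∀ (g : ℝ → ℝ) (c : ℝ), Measurable g → (∀ y ∈ D.outcomes, |g y| ≤ c) →
      BoundedInProb Pr (fun p : ℕ × Ω' => G p.1 *
        (D.kernelMean K π (h p.1) p.1 (fun i => Z i p.2) g
          - ∫ x, D.condMean g (x, π x) ∂(D.P₀.map D.X)))) {α : ℝ} (hα : 0 < α) :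
    BoundedInProb Pr (fun p : ℕ × Ω' => G p.1 *
      ‖D.sampleMoments K π (h p.1) p.1 (fun i => Z i p.2) α - D.policyMoments π α‖) := by
  obtain ⟨M, hM0, hM⟩ := D.exists_bound
  have key : ∀ (g : ℝ → ℝ) (c : ℝ), Measurable g → (∀ y ∈ D.outcomes, |g y| ≤ c) →
      BoundedInProb Pr (fun p : ℕ × Ω' => G p.1 *
        ‖D.kernelMean K π (h p.1) p.1 (fun i => Z i p.2) g
          - ∫ ω, g (D.policyOutcome π ω) ∂D.P₀‖) := by
    intro g c hg hc
    rw [(integral_policyOutcome_of_bounded hcons hunconf hπ hπ_int hg hc).2]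
    exact (hb g c hg hc).mul_norm
  have h1 := key (fun _ => 1) 1 measurable_const (by simp)
  have h2 := key (fun y => Real.exp (-y / α)) 1 (by fun_prop)
    fun y hy => abs_exp_neg_div_le_one hα (hM hy).1
  have h3 := key (fun y => y * Real.exp (-y / α)) (M * 1) (by fun_prop) fun y hy => by
    rw [abs_mul, abs_of_nonneg (hM hy).1]
    have := abs_exp_neg_div_le_one hα (hM hy).1
    have := (hM hy).2
    gcongr
  simp only [integral_const, probReal_univ, smul_eq_mul, one_mul] at h1
  exact h1.prodMk (h2.prodMk h3)

/-- The estimated dual value is the estimated dual objective at the population optimum, up to an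
error that is negligible with respect to the sampling error of the moments: the estimated
objective is concave, its derivative at the optimum is of the order of the sampling error, and its
maximizer is consistent. -/
theorem tendsto_Qhat_sub_momentValue (hG : Tendsto G atTop atTop) (hη : 0 < η)
    (hπ : Measurable π) (hπ_int : D.InteriorPolicy π)
    (hatom : ∀ c, D.P₀ {ω | D.policyOutcome π ω = c} = 0)
    (hreg : ∀ N, ∀ᵐ ω ∂Pr, ∀ i, 0 ≤ D.weight K π (h N) (Z i ω) ∧ (Z i ω).2.2 ∈ D.outcomes)
    (hb : ∀ α, 0 < α → BoundedInProb Pr (fun p : ℕ × Ω' => G p.1 *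
      ‖D.sampleMoments K π (h p.1) p.1 (fun i => Z i p.2) α - D.policyMoments π α‖))
    {α : ℝ} (hα : 0 < α) (hslope : momentSlope η α (D.policyMoments π α) = 0) :
    Tendsto (fun p : ℕ × Ω' => G p.1 * (D.Qhat K π η (h p.1) p.1 (fun i => Z i p.2)
      - momentValue η α (D.sampleMoments K π (h p.1) p.1 (fun i => Z i p.2) α)))
      (inProb Pr) (𝓝 0) := by
  obtain ⟨M, hM0, hM⟩ := D.exists_bound
  have hU : AEMeasurable (D.policyOutcome π) D.P₀ := (D.measurable_policyOutcome hπ).aemeasurable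
  have hUM := ae_policyOutcome_mem_Icc hπ_int hM
  have hconst : ∀ c, ¬ ∀ᵐ ω ∂D.P₀, D.policyOutcome π ω = c := by
    intro c hc
    have h1 : ∀ᵐ ω ∂D.P₀, D.policyOutcome π ω ≠ c := by rw [ae_iff]; simpa using hatom c
    obtain ⟨ω, h2, h3⟩ := (hc.and h1).exists
    exact h3 h2
  have hdiff : ∀ β, 0 < β → DifferentiableAt ℝ (momentSlope η β) (D.policyMoments π β) :=
    fun β hβ => differentiableAt_momentSlope η hβ one_ne_zero (expMoment_pos hU hUM hβ).ne'
  have hpop : ∀ β, momentSlope η β (D.policyMoments π β) =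
      dualSlope η β (expMoment D.P₀ (D.policyOutcome π) β)
        (tiltMoment D.P₀ (D.policyOutcome π) β) := by
    intro β
    simp only [momentSlope, policyMoments, div_one]
    rfl
  have hcons : ∀ β, 0 < β → Tendsto (fun p : ℕ × Ω' =>
      momentSlope η β (D.sampleMoments K π (h p.1) p.1 (fun i => Z i p.2) β)) (inProb Pr)
      (𝓝 (momentSlope η β (D.policyMoments π β))) := fun β hβ =>
    (hdiff β hβ).continuousAt.tendsto.comp (tendsto_of_boundedInProb hG (hb β hβ))
  have hsl := (hb α hα).comp_hasFDerivAt hG (hdiff α hα)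
  rw [hslope] at hsl
  refine hsl.tendsto_of_isLittleO (Asymptotics.isLittleO_iff.2 fun c hc => ?_)
  set δ := min c (α / 2) with hδ
  have hδ0 : 0 < δ := lt_min hc (by linarith)
  have hδα : δ < α := (min_le_right _ _).trans_lt (by linarith)
  -- at `α ± δ` the population slope has a strict sign, which the sample slope inherits
  have hleft : 0 < momentSlope η (α - δ) (D.policyMoments π (α - δ)) := by
    rw [← hslope, hpop, hpop]
    exact dualSlope_strictAnti hU hUM hconst η (by linarith) (by linarith)
  have hright : momentSlope η (α + δ) (D.policyMoments π (α + δ)) < 0 := by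
    rw [← hslope, hpop, hpop]
    exact dualSlope_strictAnti hU hUM hconst η hα (by linarith)
  have hS : Tendsto (fun p : ℕ × Ω' =>
      (D.sampleMoments K π (h p.1) p.1 (fun i => Z i p.2) α).1) (inProb Pr) (𝓝 1) :=
    (continuous_fst.tendsto _).comp (tendsto_of_boundedInProb hG (hb α hα))
  filter_upwards [(hcons (α - δ) (by linarith)).eventually (lt_mem_nhds hleft),
    (hcons (α + δ) (by linarith)).eventually (gt_mem_nhds hright),
    hS.eventually (lt_mem_nhds one_pos),
    eventually_inProb_of_ae (Pr := Pr) (p := fun p : ℕ × Ω' => ∀ i,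
      0 ≤ D.weight K π (h p.1) (Z i p.2) ∧ (Z i p.2).2.2 ∈ D.outcomes)
      (Eventually.of_forall hreg)] with p h1 h2 h3 h4
  obtain ⟨μ, hμ, hμM, hobj, hmom⟩ := exists_empirical (D := D) (K := K) (π := π) (h := h p.1)
    (N := p.1) (z := fun i => Z i p.2) hM0 (fun i => (h4 i).1) (fun i => hM (h4 i).2)
  have hS0 : D.normalizer K π (h p.1) p.1 (fun i => Z i p.2) ≠ 0 := by
    rw [normalizer_eq]; exact h3.ne'
  have hmom' := hmom hS0
  rw [normalizer_eq] at hmom'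
  have hemp : ∀ β, momentSlope η β (D.sampleMoments K π (h p.1) p.1 (fun i => Z i p.2) β) =
      dualSlope η β (expMoment μ id β) (tiltMoment μ id β) := by
    intro β
    rw [expMoment, tiltMoment, hmom', hmom']
    rfl
  rw [hemp] at h1 h2
  have hQ : D.Qhat K π η (h p.1) p.1 (fun i => Z i p.2) = dualValue (expMoment μ id) η := by
    rw [Qhat, dualValue, dualValue, hobj]
  have hV : momentValue η α (D.sampleMoments K π (h p.1) p.1 (fun i => Z i p.2) α) =
      dualObjective (expMoment μ id) η α := by
    have hpos := expMoment_pos aemeasurable_id hμM hα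
    have hE : expMoment μ id α = (D.sampleMoments K π (h p.1) p.1 (fun i => Z i p.2) α).2.1 /
        (D.sampleMoments K π (h p.1) p.1 (fun i => Z i p.2) α).1 := by
      rw [expMoment, hmom']; rfl
    have hne : (D.sampleMoments K π (h p.1) p.1 (fun i => Z i p.2) α).2.1 ≠ 0 := by
      intro h0
      rw [hE, h0, zero_div] at hpos
      exact lt_irrefl _ hpos
    rw [dualObjective_of_pos hα, hE, Real.log_div hne h3.ne', momentValue]
  rw [hQ, hV, hemp, sub_zero, norm_mul, norm_mul]
  have hup := dualValue_le_of_slope aemeasurable_id hμM hδ0 hδα h1.le h2.le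
  have hlow := le_dualValue aemeasurable_id hμM hη.le hα.le
  rw [Real.norm_of_nonneg (sub_nonneg.2 hlow), mul_left_comm]
  refine mul_le_mul_of_nonneg_left ?_ (norm_nonneg _)
  have h5 : δ * |dualSlope η α (expMoment μ id α) (tiltMoment μ id α)| ≤
      c * |dualSlope η α (expMoment μ id α) (tiltMoment μ id α)| :=
    mul_le_mul_of_nonneg_right (min_le_left _ _) (abs_nonneg _)
  rw [Real.norm_eq_abs]
  linarith

lemma IsIIDSample.aemeasurable_Qhat (hZ : D.IsIIDSample Pr Z) (hcons : D.Consistency)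
    (hK : IsSecondOrderKernel K) (hπ : Measurable π) (hη : 0 < η) {h : ℝ} (hh : 0 < h) (N : ℕ) :
    AEMeasurable (fun ω => D.Qhat K π η h N (fun i => Z i ω)) Pr := by
  obtain ⟨M, hM0, hM⟩ := D.exists_bound
  have hm : AEMeasurable (fun ω => ⨆ q : {q : ℚ // 0 < q},
      (-((q : ℚ) : ℝ) * Real.log (D.What K π h N (fun i => Z i ω) ((q : ℚ) : ℝ))
        - ((q : ℚ) : ℝ) * η)) Pr := by
    refine AEMeasurable.iSup fun q => ?_
    have h1 := hZ.aemeasurable_kernelMean hK.measurable hπ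
      (g := fun y => Real.exp (-y / ((q : ℚ) : ℝ))) (by fun_prop) h N
    have h2 := hZ.aemeasurable_kernelMean hK.measurable hπ (g := fun _ => 1) measurable_const h N
    simp only [What, Wbar_eq, normalizer_eq]
    exact ((Real.measurable_log.comp_aemeasurable (h1.div h2)).const_mul _).sub_const _
  refine hm.congr ?_
  filter_upwards [hZ.ae_regular hcons hK π hh] with ω hω
  exact (Qhat_eq_iSup hη.le hM0 (fun i => (hω i).1) fun i => hM (hω i).2).symm

end Population
end

theorem theorem2 {Ω : Type*} [MeasurableSpace Ω] {d : ℕ} (D : Population Ω d)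
    (hcons : D.Consistency) (hunconf : D.Unconfoundedness) (hpos : D.Positivity)
    (hsmooth : D.SmoothDensities)
    (K : ℝ → ℝ) (hK : IsSecondOrderKernel K)
    (π : EuclideanSpace ℝ (Fin d) → ℝ) (hπ : Measurable π)
    (hπ_int : D.InteriorPolicy π) (hπ_score : D.ScoreWellDefined π)
    (η : ℝ) (hη : 0 < η)
    {Ω' : Type*} [MeasurableSpace Ω'] (Pr : Measure Ω') [IsProbabilityMeasure Pr]
    (Z : ℕ → Ω' → EuclideanSpace ℝ (Fin d) × ℝ × ℝ) (hZ : D.IsIIDSample Pr Z)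
    (h : ℕ → ℝ) (h_pos : ∀ N, 0 < h N) (h_zero : Tendsto h atTop (𝓝 0))
    (hNh : Tendsto (fun N : ℕ => (N : ℝ) * h N) atTop atTop)
    (C : ℝ) (hNh5 : Tendsto (fun N : ℕ => (N : ℝ) * h N ^ 5) atTop (𝓝 C))
    (αs : ℝ) (hαs : D.IsDualOptimal π η αs) :
    0 < αs ∧
    0 ≤ αs ^ 2 * D.variance K π αs / D.W π αs ^ 2 ∧
    TendstoInDistribution
      (fun (N : ℕ) (ω : Ω') =>
        Real.sqrt ((N : ℝ) * h N) *
          (D.Qhat K π η (h N) N (fun i => Z i ω) - D.QDRO π η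
            + αs * D.bias K π αs / D.W π αs * h N ^ 2))
      atTop (fun x : ℝ => x) (fun _ => Pr)
      (gaussianReal 0 (Real.toNNReal (αs ^ 2 * D.variance K π αs / D.W π αs ^ 2))) := by
  obtain ⟨r, L, ε, hr, hr1, hL, hε, hreg⟩ := D.exists_regularAt hpos hsmooth hπ_int
  obtain ⟨M, hM0, hM⟩ := D.exists_bound
  have hU : AEMeasurable (D.policyOutcome π) D.P₀ := (D.measurable_policyOutcome hπ).aemeasurable
  have hUM := Population.ae_policyOutcome_mem_Icc hπ_int hM
  have hatom := D.policyOutcome_no_atom hcons hunconf hπ hπ_int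
  have hα : 0 < αs := pos_of_dualOptimal hU hUM hatom hαs.1 hαs.2
  have hslope := dualSlope_eq_zero hU hUM η hα hαs.2
  have hQ : D.QDRO π η = dualObjective (D.W π) η αs :=
    sInf_klBall_eq_dualObjective hU hUM hη.le hα hslope
  have hW : 0 < D.W π αs := expMoment_pos hU hUM hα
  have hv0 : 0 ≤ αs ^ 2 * D.variance K π αs / D.W π αs ^ 2 := by
    have := Population.variance_nonneg hr hε hreg hπ K hα
    positivity
  refine ⟨hα, hv0, ?_⟩
  set W := D.W π αs with hWdef
  set G : ℕ → ℝ := fun N => Real.sqrt (N * h N) with hGdef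
  have hG : Tendsto G atTop atTop := Real.tendsto_sqrt_atTop.comp hNh
  have hb : ∀ α, 0 < α → BoundedInProb Pr (fun p : ℕ × Ω' => G p.1 *
      ‖D.sampleMoments K π (h p.1) p.1 (fun i => Z i p.2) α - D.policyMoments π α‖) :=
    fun α hα => Population.boundedInProb_sampleMoments hcons hunconf hπ hπ_int
      (fun g c hg hc => hZ.boundedInProb_kernelMean hK hcons hr hr1 hL hε hreg hπ h_pos h_zero
        hNh5 hg hc) hα
  have hmslope : momentSlope η αs (D.policyMoments π αs) = 0 := by
    rw [← hslope]
    simp only [momentSlope, Population.policyMoments, div_one]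
    rfl
  have hR1 := Population.tendsto_Qhat_sub_momentValue (K := K) hG hη hπ hπ_int hatom
    (fun N => hZ.ae_regular hcons hK π (h_pos N)) hb hα hmslope
  have hR2 := delta_method hG (hb αs hα)
    (hasFDerivAt_momentValue η αs (v := D.policyMoments π αs) one_ne_zero hW.ne')
  -- the derivative of the objective in the moments `(s, w)` is `-(αs / W) (dw - W ds)`, which makes
  -- the mean of `g₀` the linear part of the error
  set g₀ : ℝ → ℝ := fun y => Real.exp (-y / αs) - W with hg₀
  have hgm : Measurable g₀ := by fun_prop
  have hexp : ∀ y ∈ D.outcomes, |Real.exp (-y / αs)| ≤ 1 := fun y hy =>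
    Population.abs_exp_neg_div_le_one hα (hM hy).1
  have hgc : ∀ y ∈ D.outcomes, |g₀ y| ≤ 1 + |W| := fun y hy =>
    (abs_sub _ _).trans (add_le_add (hexp y hy) le_rfl)
  have hg0 : ∫ x, D.condMean g₀ (x, π x) ∂(D.P₀.map D.X) = 0 := by
    rw [← (Population.integral_policyOutcome_of_bounded hcons hunconf hπ hπ_int hgm hgc).2]
    simp only [hg₀]
    rw [integral_sub (integrable_exp_neg_div hU hUM hα) (integrable_const _)]
    simp [hWdef, Population.W]
  set s : ℝ := -αs / W with hs
  have hvar : αs ^ 2 * D.variance K π αs / W ^ 2 = s ^ 2 * ((∫ u, K u ^ 2) *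
      ∫ x, D.condMean (fun y => g₀ y ^ 2) (x, π x) / D.fA (π x) x ∂(D.P₀.map D.X)) := by
    rw [Population.variance_eq hr hε hreg hπ K hα, hs]
    ring
  have hclt := hZ.tendstoInDistribution_kernelMean hK hcons hr hr1 hL hε hreg hπ h_pos h_zero
    hNh hgm hgc hg0 s hvar hv0
  let e : ℕ → ℝ := fun N => ∫ z, D.weight K π (h N) z * g₀ z.2.2 ∂D.obsLaw
  -- the deterministic part: smoothing bias plus its correction
  have hR3 : Tendsto (fun N : ℕ => s * (G N * h N ^ 2 * (e N / h N ^ 2 - D.bias K π αs)))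
      atTop (𝓝 0) := by
    have hbias := (Population.tendsto_bias hK hcons hr hr1 hL hε hreg hπ hgm hgc).comp
      (tendsto_nhdsWithin_iff.2 ⟨h_zero, Eventually.of_forall h_pos⟩)
    have hcurv : ∫ x, D.curvature π g₀ x ∂(D.P₀.map D.X) =
        ∫ x, D.curvature π (fun y => Real.exp (-y / αs)) x ∂(D.P₀.map D.X) :=
      integral_congr_ae (hreg.mono fun x hx => hx.curvature_sub_const hr (by fun_prop) hexp W)
    rw [hcurv, ← Population.bias_eq hr hreg hπ_score hπ K hα, hg0] at hbias
    have h5 : Tendsto (fun N => G N * h N ^ 2) atTop (𝓝 (Real.sqrt C)) :=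
      ((Real.continuous_sqrt.tendsto C).comp hNh5).congr fun N =>
        (Population.sqrt_mul_sq_eq (h_pos N)).symm
    have := (h5.mul (hbias.sub_const (D.bias K π αs))).const_mul s
    simpa [e] using this
  refine tendstoInDistribution_of_tendstoInMeasure_sub _ _ hclt ?_ fun N =>
    (((hZ.aemeasurable_Qhat hcons hK hπ hη (h_pos N) N).sub_const _).add_const _).const_mul _
  refine tendstoInMeasure_of_inProb ?_
  -- the three errors: optimization over `α`, linearization, and bias
  have hsum := (hR1.add hR2).add (hR3.comp tendsto_fst_inProb)
  simp only [add_zero] at hsum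
  refine hsum.congr fun p => ?_
  have hpop : momentValue η αs (D.policyMoments π αs) = D.QDRO π η := by
    rw [hQ, dualObjective_of_pos hα, momentValue]
    simp only [Population.policyMoments, Real.log_one, sub_zero]
  have hmean : D.kernelMean K π (h p.1) p.1 (fun i => Z i p.2) g₀ =
      (D.sampleMoments K π (h p.1) p.1 (fun i => Z i p.2) αs).2.1 -
        W * (D.sampleMoments K π (h p.1) p.1 (fun i => Z i p.2) αs).1 := by
    simp only [Population.sampleMoments, Population.kernelMean, hg₀, Finset.mul_sum,
      ← Finset.sum_sub_distrib]
    refine Finset.sum_congr rfl fun i _ => ?_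
    ring
  have hh := (h_pos p.1).ne'
  simp only [Pi.sub_apply, Function.comp_apply, smul_apply, sub_apply,
    ContinuousLinearMap.comp_apply, ContinuousLinearMap.coe_fst', ContinuousLinearMap.coe_snd',
    Prod.fst_sub, Prod.snd_sub, smul_eq_mul]
  rw [hpop, hmean]
  set V := D.sampleMoments K π (h p.1) p.1 (fun i => Z i p.2) αs
  have e1 : (D.policyMoments π αs).1 = 1 := rfl
  have e2 : (D.policyMoments π αs).2.1 = W := rfl
  rw [e1, e2]
  change _ = G p.1 * _ - s * (G p.1 * (_ - e p.1))
  rw [hs]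
  field_simp
  ring
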